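/- **Setting.** An effect algebra is a set $E$ with constants $0,1$ and a commutative, associative partial operation $\oplus$ such that every $a$ has a unique $a'$ with $a\oplus a'=1$, and $a\oplus 1$ is defined only for $a=0$; $a\le b$ means $a\oplus c=b$ for some $c=:b\ominus a$, and $na=a\oplus\dots\oplus a$ ($n$ times). $E$ is *archimedean* if $a=0$ whenever $na$ exists for all $n$, and *divisible* if for all $a\in E$, $n\ge1$ there is a unique $x=:a/n$ with $nx=a$; for integers $0\le k\le n$, $n\ge 1$, put $\frac kn a=k(a/n)$. Elements $a,b$ are *Mackey compatible* if $a=a_1\oplus c$, $b=b_1\oplus c$ with $a_1\oplus b_1\oplus c$ defined. A *compression* is an additive map $J:E\to E$ with $J(a)=a$ for $a\le J(1)$ and $J(a)=0\Leftrightarrow a\le J(1)'$. A *compression base* is a family $(J_p)_{p\in P}$ of compressions indexed by a sub-effect algebra $P\subseteq E$ (the projections) with $J_p(1)=p$, such that for Mackey compatible $p,q\in P$ one has $J_pJ_q=J_r$ for some $r\in P$. Put $C(p)=\{a: a=J_p(a)\oplus J_{p'}(a)\}$, $PC(A)=\{p\in P: A\subseteq C(p)\}$, $P(A)=PC(PC(A)\cup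 A)$, $P(a)=P(\{a\})$ and $P(a,b)=P(\{a,b\})$. Write $aCb$ if every element of $P(a)$ is Mackey compatible with every element of $P(b)$, and let $P_\le(a,b)$ be the set of $p\in P(a,b)$ with $J_p(a)\le J_p(b)$ and $J_{p'}(b)\le J_{p'}(a)$. $E$ is *spectral* if (1) for every $a$ there is $a^\circ\in P$ (the projection cover) with $a\le q\Leftrightarrow a^\circ\le q$ for all $q\in P$; (2) for every $a$ there is a Boolean subalgebra $B\subseteq P$ such that for all $p\in P$: $a\in C(p)\Leftrightarrow B\subseteq C(p)$; and (3) $P_\le(a,b)\neq\emptyset$ whenever $aCb$. In that case, for $aCb$, put $(b-a)_+=J_p(b)\ominus J_p(a)$ with $p\in P_\le(a,b)$ (independent of $p$). For a binary string $w=w_1\dots w_l$ let $l(w)=l$, $k(w)=\sum_j w_j2^{l-j}$, $\lambda(w)=k(w)2^{-l}$, $\lambda(w+1)=(k(w)+1)2^{-l}$; $\mathcal B$ is the set of all binary strings, including the empty string $\varepsilon$. For $a$ in a spectral $E$ put $\hat u_\varepsilon=a^\circ$, $c_\varepsilon=a$, and $$\hat u_{w0}=((c_w-c_w')_+^{\circ})'\wedge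 \hat u_w,\qquad \hat u_{w1}=\hat u_w\wedge \hat u_{w0}',$$ $$c_{w0}=\hat u_{w0}\ominus[(c_w'-c_w)_+\wedge \hat u_w],\qquad c_{w1}=(c_w-c_w')_+\wedge \hat u_w.$$ The *binary spectral resolution* of $a$ is $p_0=(a^\circ)'$, $p_{\lambda(w1)}=(a^\circ)'\oplus\bigoplus\{\hat u_{v}: l(v)=l(w)+1,\ k(v)\le k(w0)\}$, $p_1=1$. The *rational spectral resolution* of $a$ in $E$ is $p_{a,\lambda}=\bigwedge\{p_\mu:\mu\in[0,1]\text{ dyadic},\ \mu>\lambda\}$ for $\lambda\in[0,1]\cap\mathbb Q$ (so $p_{a,1}=1$). The *universal group* of $E$ is a partially ordered abelian group $G$ with order unit $u$ such that $E$ is identified with the interval $[0,u]$ in $G$ (where $\oplus$ is the restriction of $+$), $G^+$ consists of the finite sums of elements of $E$, and every map from $E$ to an abelian group that is additive on orthogonal pairs extends uniquely to a homomorphism of $G$. The $J_p$ then extend uniquely to order-preserving endomorphisms of $G$, also denoted $J_p$. Put $C_G(p)=\{g: g=J_p(g)+J_{p'}(g)\}$, $PC(g)=\{p\in P:g\in C_G(p)\}$,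 $P(g)=\{p\in PC(g): p\in C_G(q)\ \forall q\in PC(g)\}$. $G$ is *spectral* if (general comparability) for every $g\in G$ there is $p\in P(g)$ with $J_{p'}(g)\le0\le J_p(g)$, and (Rickart property) for every $g\in G$ there is $g^*\in P$ such that for all $p\in P$: $p\le g^*\Leftrightarrow(g\in C_G(p)\text{ and }J_p(g)=0)$. In that case every $g$ has a unique orthogonal decomposition $g=g_+-g_-$ with $g_\pm\ge0$, $J_p(g)=g_+$, $J_{p'}(g)=-g_-$ for some $p\in P$, and the rational spectral resolution of $g$ in $G$ is $p^G_{g,m/n}=((ng-mu)_+)^*$ ($m\in\mathbb Z$, $n\ge1$). Let $\|g\|=\inf\{n/k: n,k\in\mathbb N,\ k\ge 1,\ -nu\le kg\le nu\}$. **Theorem.** Let $E$ be an archimedean divisible effect algebra with a compression base $(J_p)_{p\in P}$. Then $E$ has a universal group, and for every universal group $(G,u)$ of $E$: $E$ is spectral if and only if $G$ is spectral (with respect to the extended compression base). In this case $\|\cdot\|$ vanishes only at $0$, and for every $a\in E$: (i) $p_{a,m/n}=p^G_{a,m/n}$ for all integers $n\ge1$, $0\le m\le n$; (ii) $a$ is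 the norm limit $a=\lim_{n\to\infty}\sum_{l(w)=n}\lambda(w)u_w$, where $u_w=p_{a,\lambda(w+1)}\wedge p_{a,\lambda(w)}'$; (iii) for $b\in E$: $a=b$ if and only if $p_{a,\lambda(w)}=p_{b,\lambda(w)}$ for all $w\in\mathcal B$; (iv) for $q\in P$: $a\in C(q)$ if and only if $p_{a,\lambda(w)}\in C(q)$ for all $w\in\mathcal B$. -/

import Mathlib

universe v

/-- An effect algebra: the partial operation `⊕` is `oplus`, where `oplus a b = none` means that
`a ⊕ b` is not defined and `oplus a b = some c` means that it is defined and equal to `c`. -/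
class EffectAlgebra (E : Type v) extends Zero E, One E where
  oplus : E → E → Option E
  oplus_comm : ∀ a b c : E, oplus a b = some c → oplus b a = some c
  oplus_assoc : ∀ a b c d e : E, oplus a b = some d → oplus d c = some e →
    ∃ f, oplus b c = some f ∧ oplus a f = some e
  exists_unique_compl : ∀ a : E, ∃! b : E, oplus a b = some 1
  eq_zero_of_oplus_one : ∀ a b : E, oplus a 1 = some b → a = 0

namespace EffectAlgebra

section Basic

variable {E : Type v} [EffectAlgebra E]

/-- The orthosupplement `a'`. -/
noncomputable def compl (a : E) : E := Classical.choose (exists_unique_compl a)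

theorem oplus_compl (a : E) : oplus a (compl a) = some 1 :=
  (Classical.choose_spec (exists_unique_compl a)).1

theorem eq_compl {a b : E} (h : oplus a b = some 1) : b = compl a :=
  (Classical.choose_spec (exists_unique_compl a)).2 b h

theorem compl_compl (a : E) : compl (compl a) = a :=
  (eq_compl (oplus_comm _ _ _ (oplus_compl a))).symm

theorem one_oplus_zero : oplus (1 : E) 0 = some 1 := by
  have h := oplus_compl (1 : E)
  have h0 := eq_zero_of_oplus_one _ _ (oplus_comm _ _ _ h)
  rwa [h0] at h

theorem oplus_zero (a : E) : oplus a 0 = some a := by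
  obtain ⟨f, hf, hf'⟩ := oplus_assoc _ _ _ _ _ (oplus_compl (compl a)) one_oplus_zero
  rw [compl_compl] at hf
  rw [hf, eq_compl hf', compl_compl]

theorem oplus_cancel {a b c d : E} (hb : oplus a b = some d) (hc : oplus a c = some d) :
    b = c := by
  obtain ⟨f, hf, hf'⟩ := oplus_assoc _ _ _ _ _ hb (oplus_compl d)
  obtain ⟨g, hg, hg'⟩ := oplus_assoc _ _ _ _ _ hc (oplus_compl d)
  rw [eq_compl hf'] at hf
  rw [eq_compl hg'] at hg
  obtain ⟨x, hx, hx'⟩ := oplus_assoc _ _ _ _ _ hf (oplus_comm _ _ _ (oplus_compl a))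
  obtain ⟨y, hy, hy'⟩ := oplus_assoc _ _ _ _ _ hg (oplus_comm _ _ _ (oplus_compl a))
  have hxy : x = y := Option.some.inj (hx.symm.trans hy)
  subst hxy
  rw [eq_compl (oplus_comm _ _ _ hx'), eq_compl (oplus_comm _ _ _ hy')]

theorem eq_zero_of_oplus_eq_zero {a b : E} (h : oplus a b = some 0) : b = 0 := by
  obtain ⟨f, hf, -⟩ := oplus_assoc _ _ _ _ _ h (oplus_comm _ _ _ one_oplus_zero)
  exact eq_zero_of_oplus_one _ _ hf

/-- The partial order of an effect algebra: `a ≤ b` iff `a ⊕ c = b` for some `c`. -/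
instance instPartialOrder : PartialOrder E where
  le a b := ∃ c, oplus a c = some b
  le_refl a := ⟨0, oplus_zero a⟩
  le_trans a b c := by
    rintro ⟨x, hx⟩ ⟨y, hy⟩
    obtain ⟨f, -, hf⟩ := oplus_assoc _ _ _ _ _ hx hy
    exact ⟨f, hf⟩
  le_antisymm a b := by
    rintro ⟨x, hx⟩ ⟨y, hy⟩
    obtain ⟨f, hf, hf'⟩ := oplus_assoc _ _ _ _ _ hx hy
    have h0 : f = 0 := oplus_cancel hf' (oplus_zero a)
    rw [h0] at hf
    have hx0 : x = 0 := eq_zero_of_oplus_eq_zero (oplus_comm _ _ _ hf)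
    rw [hx0, oplus_zero] at hx
    exact Option.some.inj hx

open Classical in
/-- `b ⊖ a`, meaningful when `a ≤ b` (and `0` otherwise). -/
noncomputable def osub (b a : E) : E :=
  if h : ∃ c, oplus a c = some b then Classical.choose h else 0

open Classical in
/-- The infimum of a set in `E`, meaningful when it exists (and `0` otherwise). -/
noncomputable def inf (S : Set E) : E :=
  if h : ∃ x, IsGLB S x then Classical.choose h else 0

/-- The orthogonal sum of a finite family, if it is defined. -/
def osum : List E → Option E
  | [] => some 0
  | a :: l => (osum l).bind (oplus a)

/-- `n a = a ⊕ ⋯ ⊕ a` (`n` summands), if it is defined. -/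
def nmul (n : ℕ) (a : E) : Option E := osum (List.replicate n a)

variable (E) in
def IsArchimedean : Prop := ∀ a : E, (∀ n : ℕ, (nmul n a).isSome) → a = 0

variable (E) in
def IsDivisible : Prop := ∀ a : E, ∀ n : ℕ, 0 < n → ∃! x : E, nmul n x = some a

open Classical in
/-- `a / n`: the element `x` with `n x = a`. -/
noncomputable def divBy (a : E) (n : ℕ) : E :=
  if h : ∃ x, nmul n x = some a then Classical.choose h else 0

/-- The rational multiple `(k / n) a = k (a / n)` for `k ≤ n`. -/
noncomputable def fracMul (k n : ℕ) (a : E) : E := (nmul k (divBy a n)).getD 0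

/-- Mackey compatibility `a ↔ b`. -/
def Mackey (a b : E) : Prop :=
  ∃ a₁ b₁ c : E, oplus a₁ c = some a ∧ oplus b₁ c = some b ∧
    ∃ d, oplus a₁ b₁ = some d ∧ (oplus d c).isSome

structure IsSubEffectAlgebra (P : Set E) : Prop where
  zero_mem : 0 ∈ P
  one_mem : 1 ∈ P
  compl_mem : ∀ a ∈ P, compl a ∈ P
  oplus_mem : ∀ a ∈ P, ∀ b ∈ P, ∀ c, oplus a b = some c → c ∈ P

/-- `m` is the meet of `p` and `q` in the poset `P`. -/
def IsMeetIn (P : Set E) (p q m : E) : Prop :=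
  m ∈ P ∧ m ≤ p ∧ m ≤ q ∧ ∀ x ∈ P, x ≤ p → x ≤ q → x ≤ m

/-- `j` is the join of `p` and `q` in the poset `P`. -/
def IsJoinIn (P : Set E) (p q j : E) : Prop :=
  j ∈ P ∧ p ≤ j ∧ q ≤ j ∧ ∀ x ∈ P, p ≤ x → q ≤ x → j ≤ x

/-- `B` is a Boolean subalgebra of the orthomodular poset `P` (`P` consists of sharp elements, so
that `p'` is a complement of `p`). -/
structure IsBooleanSubalgebra (P B : Set E) : Prop where
  subset : B ⊆ P
  zero_mem : 0 ∈ B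
  one_mem : 1 ∈ B
  compl_mem : ∀ p ∈ B, compl p ∈ B
  meet_mem : ∀ p ∈ B, ∀ q ∈ B, ∃ m ∈ B, IsMeetIn P p q m
  join_mem : ∀ p ∈ B, ∀ q ∈ B, ∃ j ∈ B, IsJoinIn P p q j
  distrib : ∀ p ∈ B, ∀ q ∈ B, ∀ r ∈ B, ∀ j m m₁ m₂ : E, IsJoinIn P q r j → IsMeetIn P p j m →
    IsMeetIn P p q m₁ → IsMeetIn P p r m₂ → IsJoinIn P m₁ m₂ m

/-- Additive maps of effect algebras. -/
def IsAdditive (φ : E → E) : Prop :=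
  ∀ a b c : E, oplus a b = some c → oplus (φ a) (φ b) = some (φ c)

structure IsRetraction (J : E → E) : Prop where
  additive : IsAdditive J
  eq_self : ∀ a : E, a ≤ J 1 → J a = a

structure IsCompression (J : E → E) : Prop extends IsRetraction J where
  eq_zero_iff : ∀ a : E, J a = 0 ↔ a ≤ compl (J 1)

end Basic

/-- A compression base `(J p)_{p ∈ P}`. The values `J p` with `p ∉ P` play no role. -/
structure CompressionBase (E : Type v) [EffectAlgebra E] where
  P : Set E
  J : E → E → E
  isSub : IsSubEffectAlgebra P
  isCompression : ∀ p ∈ P, IsCompression (J p)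
  focus : ∀ p ∈ P, J p 1 = p
  comp : ∀ p ∈ P, ∀ q ∈ P, Mackey p q → ∃ r ∈ P, ∀ a, J p (J q a) = J r a

/-! ### Binary strings -/

/-- `k(w) = ∑ j, w_j 2^(l(w) - j)`. -/
def strNum (w : List Bool) : ℕ := w.foldl (fun k b => 2 * k + b.toNat) 0

/-- `λ(w) = k(w) / 2^l(w)`. -/
def strVal (w : List Bool) : ℚ := (strNum w : ℚ) / 2 ^ w.length

/-- `λ(w+1) = (k(w) + 1) / 2^l(w)`, which is `1` when `w` consists of ones only. -/
def strValSucc (w : List Bool) : ℚ := ((strNum w : ℚ) + 1) / 2 ^ w.length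

/-- The list of all binary strings of length `n`, without repetition. -/
def binStrings : ℕ → List (List Bool)
  | 0 => [[]]
  | n + 1 => (binStrings n).flatMap fun w => [w ++ [false], w ++ [true]]

namespace CompressionBase

section

variable {E : Type v} [EffectAlgebra E] (cb : CompressionBase E)

/-- The commutant `C(p)` of a projection. -/
def C (p : E) : Set E := {a | oplus (cb.J p a) (cb.J (compl p) a) = some a}

/-- The set `PC(A)` of the projections that commute with all elements of `A`. -/
def PC (A : Set E) : Set E := {p | p ∈ cb.P ∧ ∀ a ∈ A, a ∈ cb.C p}

/-- The bicommutant `P(Q) = PC(PC(Q) ∪ Q)`. -/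
def bicomm (Q : Set E) : Set E := cb.PC (cb.PC Q ∪ Q)

def IsProjCover (p a : E) : Prop := p ∈ cb.P ∧ ∀ q ∈ cb.P, a ≤ q ↔ p ≤ q

def HasProjCover : Prop := ∀ a : E, ∃ p, cb.IsProjCover p a

def IsBElement (a : E) : Prop :=
  ∃ B : Set E, IsBooleanSubalgebra cb.P B ∧ ∀ p ∈ cb.P, a ∈ cb.C p ↔ B ⊆ cb.C p

/-- The relation `e C f`. -/
def Commute (e f : E) : Prop := ∀ p ∈ cb.bicomm {e}, ∀ q ∈ cb.bicomm {f}, Mackey p q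

/-- The set `P_≤(e, f)`. -/
def Ple (e f : E) : Set E :=
  {p | p ∈ cb.bicomm {e, f} ∧ cb.J p e ≤ cb.J p f ∧ cb.J (compl p) f ≤ cb.J (compl p) e}

def HasBComparability : Prop :=
  (∀ a : E, cb.IsBElement a) ∧ ∀ e f : E, cb.Commute e f → (cb.Ple e f).Nonempty

/-- Spectrality of `E` with respect to the compression base. -/
def IsSpectral : Prop := cb.HasBComparability ∧ cb.HasProjCover

open Classical in
/-- The projection cover `a°`. -/
noncomputable def cover (a : E) : E :=
  if h : ∃ p, cb.IsProjCover p a then Classical.choose h else 0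

open Classical in
/-- The positive part `(b - a)₊ = J p b ⊖ J p a`, where `p ∈ P_≤(a, b)`. -/
noncomputable def posPart (b a : E) : E :=
  if h : (cb.Ple a b).Nonempty then osub (cb.J h.choose b) (cb.J h.choose a) else 0

/-- `u_{w0} = ((c_w - c_w')₊°)' ∧ u_w`, from `x = (u_w, c_w)`. -/
noncomputable def lowerProj (x : E × E) : E :=
  inf {compl (cb.cover (cb.posPart x.2 (compl x.2))), x.1}

/-- The step from `(u_w, c_w)` to `(u_{wi}, c_{wi})`, by the splitting of `c_w` in `[0, u_w]`. -/
noncomputable def splitStep (x : E × E) : Bool → E × E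
  | false => (cb.lowerProj x, osub (cb.lowerProj x) (inf {cb.posPart (compl x.2) x.2, x.1}))
  | true => (inf {x.1, compl (cb.lowerProj x)}, inf {cb.posPart x.2 (compl x.2), x.1})

/-- The pair `(u_w, c_w)`, starting with `(a°, a)` at the empty string. -/
noncomputable def splitPair (a : E) (w : List Bool) : E × E :=
  w.foldl cb.splitStep (cb.cover a, a)

/-- The binary spectral projection `p_{λ(w1)}`. For strings of equal length the lexicographical
order is the order of the numbers `k`. -/
noncomputable def binProj (a : E) (w : List Bool) : E :=
  (osum (compl (cb.cover a) ::
    ((binStrings (w.length + 1)).filter fun s => strNum s ≤ strNum (w ++ [false])).map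
      fun s => (cb.splitPair a s).1)).getD 0

open Classical in
/-- The binary spectral resolution of `a`, for dyadic `μ ∈ [0, 1]`: `p_0 = (a°)'`, then
`p_{λ(w1)}`, and `p_1 = 1`. -/
noncomputable def binRes (a : E) (μ : ℚ) : E :=
  if μ = 0 then compl (cb.cover a)
  else if h : ∃ w : List Bool, strVal (w ++ [true]) = μ then cb.binProj a (Classical.choose h)
  else 1

/-- The rational spectral resolution of `a` in `E`, for rational `r ∈ [0, 1]`: the infimum of
the binary spectral projections with dyadic index `μ > r`. -/
noncomputable def ratRes (a : E) (r : ℚ) : E :=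
  inf {x | ∃ k n : ℕ, k ≤ 2 ^ n ∧ r < (k : ℚ) / 2 ^ n ∧ x = cb.binRes a ((k : ℚ) / 2 ^ n)}

/-- `p_{a,λ(w+1)} ∧ p_{a,λ(w)}'`. -/
noncomputable def stepProj (a : E) (w : List Bool) : E :=
  inf {cb.ratRes a (strValSucc w), compl (cb.ratRes a (strVal w))}

end

end CompressionBase

/-! ### Ordered groups -/

section Group

variable {E : Type v} [EffectAlgebra E]
variable {G : Type v} [AddCommGroup G] [PartialOrder G]

/-- `(G, u)` is a partially ordered abelian group with order unit `u`, and `ι` is an isomorphism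
of the effect algebra `E` onto the unit interval `G[0,u]`. -/
structure IsUnitInterval (ι : E → G) (u : G) : Prop where
  zero_le : 0 ≤ u
  order_unit : ∀ g : G, ∃ n : ℕ, g ≤ n • u
  injective : Function.Injective ι
  range_eq : Set.range ι = Set.Icc 0 u
  map_one : ι 1 = u
  oplus_iff : ∀ a b c : E, oplus a b = some c ↔ ι a + ι b = ι c

/-- `(G, u)` with `ι : E → G` is the universal group of the effect algebra `E`. -/
structure IsUniversalGroup (ι : E → G) (u : G) : Prop extends IsUnitInterval ι u where
  nonneg_iff : ∀ g : G, 0 ≤ g ↔ g ∈ AddSubmonoid.closure (Set.range ι)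
  existsUnique_lift : ∀ (H : Type v) [AddCommGroup H] (φ : E → H),
    (∀ a b c : E, oplus a b = some c → φ c = φ a + φ b) → ∃! f : G →+ H, ∀ a, f (ι a) = φ a

/-- A compression base on `G`, where `ι` identifies `E` with the unit interval of `G`: a family of
order-preserving endomorphisms of `G` whose restrictions to the unit interval form a compression
base. -/
structure GroupCompressionBase (ι : E → G) (u : G) (h : IsUnitInterval ι u) where
  base : CompressionBase E
  J : E → G →+ G
  mono : ∀ p ∈ base.P, Monotone (J p)
  restrict : ∀ p ∈ base.P, ∀ a, J p (ι a) = ι (base.J p a)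

open Classical in
/-- The unique extension of a compression base on `E` to the universal group of `E`. -/
noncomputable def CompressionBase.extend [IsOrderedAddMonoid G] (cb : CompressionBase E)
    {ι : E → G} {u : G} (hG : IsUniversalGroup ι u) :
    GroupCompressionBase ι u hG.toIsUnitInterval :=
  have key : ∀ p ∈ cb.P, ∃! f : G →+ G, ∀ a, f (ι a) = ι (cb.J p a) := fun p hp =>
    hG.existsUnique_lift G (fun a => ι (cb.J p a)) fun _ _ _ h =>
      ((hG.oplus_iff _ _ _).1 ((cb.isCompression p hp).additive _ _ _ h)).symm
  { base := cb
    J := fun p => if hp : p ∈ cb.P then Classical.choose (key p hp) else 0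
    mono := by
      intro p hp x y hxy
      simp only [dif_pos hp]
      have hspec := (Classical.choose_spec (key p hp)).1
      have hmem : ∀ z ∈ AddSubmonoid.closure (Set.range ι),
          Classical.choose (key p hp) z ∈ AddSubmonoid.closure (Set.range ι) := by
        intro z hz
        induction hz using AddSubmonoid.closure_induction with
        | mem z hz =>
          obtain ⟨a, rfl⟩ := hz
          rw [hspec]
          exact AddSubmonoid.subset_closure ⟨_, rfl⟩
        | zero => rw [map_zero]; exact zero_mem _
        | add a b _ _ ha hb => rw [map_add]; exact add_mem ha hb
      rw [← sub_nonneg, ← map_sub, hG.nonneg_iff]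
      exact hmem _ ((hG.nonneg_iff (y - x)).1 (sub_nonneg.2 hxy))
    restrict := by
      intro p hp a
      simp only [dif_pos hp]
      exact (Classical.choose_spec (key p hp)).1 a }

/-- The order unit seminorm `‖g‖ = inf {n / k : -n u ≤ k g ≤ n u}`. -/
noncomputable def ouNorm (u g : G) : ℝ :=
  sInf {r : ℝ | ∃ n k : ℕ, 0 < k ∧ -(n • u) ≤ k • g ∧ k • g ≤ n • u ∧ r = (n : ℝ) / k}

namespace GroupCompressionBase

variable {ι : E → G} {u : G} {h : IsUnitInterval ι u} (B : GroupCompressionBase ι u h)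

/-- The commutant `C_G(p)`. -/
def C (p : E) : Set G := {g | g = B.J p g + B.J (compl p) g}

/-- `PC(g)`. -/
def PC (g : G) : Set E := {p | p ∈ B.base.P ∧ g ∈ B.C p}

/-- The bicommutant `P(g)`. -/
def bicomm (g : G) : Set E := {p | p ∈ B.PC g ∧ ∀ q ∈ B.PC g, ι p ∈ B.C q}

/-- General comparability: `P_±(g)` is nonempty for all `g`. -/
def HasGeneralComparability : Prop :=
  ∀ g : G, ∃ p ∈ B.bicomm g, B.J (compl p) g ≤ 0 ∧ 0 ≤ B.J p g

/-- `r` is the value `g^*` of the Rickart mapping at `g`. -/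
def IsRickart (g : G) (r : E) : Prop :=
  r ∈ B.base.P ∧ ∀ p ∈ B.base.P, p ≤ r ↔ (g ∈ B.C p ∧ B.J p g = 0)

/-- The Rickart property: there is a Rickart mapping. -/
def HasRickart : Prop := ∃ star : G → E, ∀ g, B.IsRickart g (star g)

/-- Spectrality of `G` with respect to the compression base. -/
def IsSpectral : Prop := B.HasGeneralComparability ∧ B.HasRickart

open Classical in
/-- The Rickart mapping `g ↦ g^*`. -/
noncomputable def star (g : G) : E :=
  if h : ∃ r, B.IsRickart g r then Classical.choose h else 0

/-- `g = x - y` is an orthogonal decomposition of `g`. -/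
def IsOrthDecomp (g x y : G) : Prop :=
  g = x - y ∧ 0 ≤ x ∧ 0 ≤ y ∧ ∃ p ∈ B.base.P, B.J p g = x ∧ B.J (compl p) g = -y

open Classical in
/-- The positive part `g₊` in the orthogonal decomposition of `g`. -/
noncomputable def posPart (g : G) : G :=
  if h : ∃ x y, B.IsOrthDecomp g x y then Classical.choose h else 0

/-- The spectral projection `p_{g,λ} = ((n g - m u)₊)^*` of `g` in `G` for `λ = m / n`. -/
noncomputable def specProj (g : G) (m : ℤ) (n : ℕ) : E :=
  B.star (B.posPart (n • g - m • u))

end GroupCompressionBase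

end Group

end EffectAlgebra

set_option linter.unusedSectionVars false

/-! Halving makes addition total: in a divisible effect algebra a/2 ⊕ b/2 always exists, so the
formal multiples 2^k a form a cancellative cone, and its Grothendieck group is a universal group
(`exists_isUniversalGroup`). Every universal group of E is a rational vector space on which
nonnegative scalars preserve positivity (`IsUniversalGroup.ratModule`,
`IsUniversalGroup.posSMulMono`), and the compressions extend to it. The arguments are carried out
there, for a `CompressionSystem`, where Mackey compatibility of projections becomes commutation
(`mackey_iff`).

The two notions of spectrality are both compared with a third, `CompressionSystem.Spectral`:
comparability for every g and a cover for every g ≥ 0. For G the passage is direct, since g^* is the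
complement of the sum of the supports of the positive and negative parts. From E to G, every g is a
positive multiple of b - u/2 with b in E, and u/2 commutes with every projection, so comparability
in E applies to u/2 and b (`spectral_of_isSpectral`). From G to E, the point is that a projection
commuting with the bicommutant of a commutes with a: a is approximated by Riemann sums of its
spectral projections, and archimedeanity removes the error (`riemann_sum_bounds`,
`com_of_com_upper`, `isSpectral_of_spectral`).

For the resolutions, let e_t be the support of the positive part of a - t u. Binary splitting is
bisection of [0,1]: û_w is e_{λ(w)} - e_{λ(w+1)}, and c_w is a - λ(w)u, compressed to û_w and scaled
by 2^l(w) (`map_splitPair`). Telescoping gives p_μ = u - e_μ for dyadic μ (`map_binRes`), and right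
continuity gives p_{a,t} = u - e_t for rational t (`map_ratRes`). The definition in G yields the
same projection because supports are invariant under positive scaling (`map_specProj`). The
remaining claims follow from the Riemann sum bound. -/

namespace EffectAlgebra

/-! ### Halving and midpoints in a 2-divisible effect algebra -/

section Divisible

variable {E : Type v} [EffectAlgebra E]

theorem oplus_assoc' {a b c f e : E} (hf : oplus b c = some f) (he : oplus a f = some e) :
    ∃ d, oplus a b = some d ∧ oplus d c = some e := by
  obtain ⟨d, hd, hd'⟩ := oplus_assoc c b a f e (oplus_comm _ _ _ hf) (oplus_comm _ _ _ he)
  exact ⟨d, oplus_comm _ _ _ hd, oplus_comm _ _ _ hd'⟩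

/-- Interchange law (a + b) + (c + d) = (a + c) + (b + d). That the regrouped sums are defined is
part of the conclusion; combined with uniqueness of halves, this drives the calculus of halving. -/
theorem oplus_oplus_comm {a b c d x y s : E} (hx : oplus a b = some x) (hy : oplus c d = some y)
    (hs : oplus x y = some s) :
    ∃ z t, oplus a c = some z ∧ oplus b d = some t ∧ oplus z t = some s := by
  obtain ⟨f, hf, hf'⟩ := oplus_assoc _ _ _ _ _ hx hs
  obtain ⟨g, hg, hg'⟩ := oplus_assoc' hy hf
  obtain ⟨t, ht, ht'⟩ := oplus_assoc _ _ _ _ _ (oplus_comm _ _ _ hg) hg'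
  obtain ⟨z, hz, hz'⟩ := oplus_assoc' ht' hf'
  exact ⟨z, t, hz, ht, hz'⟩

theorem nmul_two (a : E) : nmul 2 a = oplus a a := by
  simp [nmul, osum, List.replicate, oplus_zero]

/-- An effect algebra is 2-divisible if every element is uniquely a sum of two equal ones. -/
class TwoDivisible (E : Type v) [EffectAlgebra E] : Prop where
  exists_unique_half : ∀ a : E, ∃! x : E, oplus x x = some a

theorem IsDivisible.twoDivisible (h : IsDivisible E) : TwoDivisible E :=
  ⟨fun a => by simpa only [nmul_two] using h a 2 two_pos⟩

variable [TwoDivisible E]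

/-- The half of an element. -/
noncomputable def half (a : E) : E := (TwoDivisible.exists_unique_half a).choose

theorem half_oplus_half (a : E) : oplus (half a) (half a) = some a :=
  (TwoDivisible.exists_unique_half a).choose_spec.1

theorem eq_half {a x : E} (h : oplus x x = some a) : x = half a :=
  (TwoDivisible.exists_unique_half a).choose_spec.2 x h

theorem half_injective : Function.Injective (half : E → E) := fun a b h =>
  Option.some.inj (by rw [← half_oplus_half a, ← half_oplus_half b, h])

theorem half_zero : half (0 : E) = 0 := (eq_half (oplus_zero 0)).symm

theorem half_oplus {a b c : E} (h : oplus a b = some c) :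
    oplus (half a) (half b) = some (half c) := by
  obtain ⟨z, t, hz, ht, hs⟩ := oplus_oplus_comm (half_oplus_half a) (half_oplus_half b) h
  have : z = t := Option.some.inj (hz.symm.trans ht)
  subst this
  rw [hz, eq_half hs]

theorem oplus_of_half {a b c : E} (h : oplus (half a) (half b) = some (half c)) :
    oplus a b = some c := by
  obtain ⟨z, t, hz, ht, hs⟩ := oplus_oplus_comm h h (half_oplus_half c)
  rw [half_oplus_half] at hz ht
  cases hz; cases ht; exact hs

/-- Halving a ⊕ a' = 1 and b ⊕ b' = 1 splits each copy of 1/2 in 1/2 ⊕ 1/2 = 1; regrouping puts a/2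
next to b/2. Thus the partial operation becomes total after halving. -/
theorem exists_half_oplus_half (a b : E) : ∃ c, oplus (half a) (half b) = some c := by
  have ha := half_oplus (oplus_compl a)
  have hb := half_oplus (oplus_compl b)
  obtain ⟨z, t, hz, -, -⟩ := oplus_oplus_comm ha hb (half_oplus_half 1)
  exact ⟨z, hz⟩

/-- The midpoint `a/2 ⊕ b/2`. -/
noncomputable def mid (a b : E) : E := (exists_half_oplus_half a b).choose

theorem half_oplus_half_eq (a b : E) : oplus (half a) (half b) = some (mid a b) :=
  (exists_half_oplus_half a b).choose_spec

theorem mid_eq_iff {a b c : E} : mid a b = c ↔ oplus (half a) (half b) = some c := by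
  rw [half_oplus_half_eq, Option.some_inj]

theorem mid_comm (a b : E) : mid a b = mid b a :=
  mid_eq_iff.2 (oplus_comm _ _ _ (half_oplus_half_eq b a))

theorem mid_self (a : E) : mid a a = a := mid_eq_iff.2 (half_oplus_half a)

theorem mid_zero (a : E) : mid a 0 = half a := mid_eq_iff.2 (by rw [half_zero, oplus_zero])

theorem half_mid (a b : E) : half (mid a b) = mid (half a) (half b) :=
  (mid_eq_iff.2 (half_oplus (half_oplus_half_eq a b))).symm

theorem mid_left_cancel {a b c : E} (h : mid a b = mid a c) : b = c :=
  half_injective (oplus_cancel (mid_eq_iff.1 h) (half_oplus_half_eq a c))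

/-- Halving the outer terms gives all three elements the weight 1/4. This is associativity of
addition in the cone. -/
theorem mid_assoc (a b c : E) : mid (mid a b) (half c) = mid (half a) (mid b c) := by
  rw [mid_eq_iff]
  have h1 := half_oplus (half_oplus_half_eq b c)
  obtain ⟨d, hd, hd'⟩ := oplus_assoc' h1 (half_oplus_half_eq (half a) (mid b c))
  rw [half_oplus (half_oplus_half_eq a b)] at hd
  cases hd
  exact hd'

theorem oplus_iff_mid {a b c : E} : oplus a b = some c ↔ mid a b = half c := by
  rw [mid_eq_iff]
  exact ⟨half_oplus, oplus_of_half⟩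

theorem iterate_half_mid (n : ℕ) (a b : E) :
    half^[n] (mid a b) = mid (half^[n] a) (half^[n] b) := by
  induction n with
  | zero => rfl
  | succ n ih => simp only [Function.iterate_succ_apply', ih, half_mid]

theorem iterate_half_zero (n : ℕ) : half^[n] (0 : E) = 0 :=
  Function.iterate_fixed half_zero n

theorem mid_eq_zero {a b : E} (h : mid a b = 0) : b = 0 := by
  rw [mid_eq_iff] at h
  exact half_injective ((eq_zero_of_oplus_eq_zero h).trans half_zero.symm)

/-- Doubling a ⊕ c = b/2 and regrouping shows that a ⊕ a exists and lies below b. Iterated, this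
shows that the interval of the cone below 1 contains nothing outside E. -/
theorem exists_half_of_le {a b : E} (h : a ≤ half b) : ∃ a', a = half a' ∧ a' ≤ b := by
  obtain ⟨c, hc⟩ := h
  obtain ⟨z, t, hz, -, hs⟩ := oplus_oplus_comm hc hc (half_oplus_half b)
  exact ⟨z, eq_half hz, t, hs⟩

theorem exists_iterate_half_of_le (n : ℕ) {a b : E} (h : a ≤ half^[n] b) :
    ∃ a', a = half^[n] a' ∧ a' ≤ b := by
  induction n generalizing b with
  | zero => exact ⟨a, rfl, h⟩
  | succ n ih =>
    obtain ⟨c, rfl, hc⟩ := ih (b := half b) h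
    obtain ⟨d, rfl, hd⟩ := exists_half_of_le hc
    exact ⟨d, rfl, hd⟩

/-! ### The cone generated by a divisible effect algebra -/

variable (E) in
/-- Pairs `(k, a)` represent `2 ^ k * a`. -/
def dyadicSetoid : Setoid (ℕ × E) where
  r x y := half^[y.1] x.2 = half^[x.1] y.2
  iseqv :=
    { refl := fun _ => rfl
      symm := fun h => h.symm
      trans := by
        rintro ⟨k, a⟩ ⟨l, b⟩ ⟨m, c⟩ h1 h2
        simp only at h1 h2 ⊢
        apply half_injective.iterate l
        rw [← Function.iterate_add_apply, add_comm, Function.iterate_add_apply, h1,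
          ← Function.iterate_add_apply, add_comm, Function.iterate_add_apply, h2,
          ← Function.iterate_add_apply, add_comm, Function.iterate_add_apply] }

variable (E) in
/-- The positive cone of the universal group of a divisible effect algebra. -/
def Cone : Type v := Quotient (dyadicSetoid E)

namespace Cone

/-- The element `2 ^ k * a`. -/
def mk (k : ℕ) (a : E) : Cone E := Quotient.mk (dyadicSetoid E) (k, a)

theorem mk_eq_mk {k l : ℕ} {a b : E} : mk k a = mk l b ↔ half^[l] a = half^[k] b :=
  Quotient.eq (r := dyadicSetoid E)

theorem mk_succ_half (k : ℕ) (a : E) : mk (k + 1) (half a) = mk k a :=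
  mk_eq_mk.2 (by rw [← Function.iterate_succ_apply])

theorem mk_add_iterate (n k : ℕ) (a : E) : mk (k + n) (half^[n] a) = mk k a := by
  rw [mk_eq_mk, ← Function.iterate_add_apply]

theorem exists_mk (x : Cone E) : ∃ k a, x = mk k a := by
  obtain ⟨⟨k, a⟩, rfl⟩ := Quotient.exists_rep x
  exact ⟨k, a, rfl⟩

theorem exists_mk₂ (x y : Cone E) : ∃ k a b, x = mk k a ∧ y = mk k b := by
  obtain ⟨k, a, rfl⟩ := exists_mk x
  obtain ⟨l, b, rfl⟩ := exists_mk y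
  exact ⟨k + l, half^[l] a, half^[k] b, (mk_add_iterate ..).symm,
    by rw [add_comm, mk_add_iterate]⟩

theorem exists_mk₃ (x y z : Cone E) : ∃ k a b c, x = mk k a ∧ y = mk k b ∧ z = mk k c := by
  obtain ⟨k, a, b, rfl, rfl⟩ := exists_mk₂ x y
  obtain ⟨l, c, rfl⟩ := exists_mk z
  exact ⟨k + l, half^[l] a, half^[l] b, half^[k] c, (mk_add_iterate ..).symm,
    (mk_add_iterate ..).symm, by rw [add_comm, mk_add_iterate]⟩

theorem mk_inj {k : ℕ} {a b : E} : mk k a = mk k b ↔ a = b := by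
  rw [mk_eq_mk, (half_injective.iterate k).eq_iff]

noncomputable instance : Zero (Cone E) := ⟨mk 0 0⟩

theorem mk_zero (k : ℕ) : mk k (0 : E) = 0 := by
  refine mk_eq_mk.2 ?_
  rw [iterate_half_zero, iterate_half_zero]

theorem mk_eq_zero {k : ℕ} {a : E} : mk k a = 0 ↔ a = 0 := by
  rw [← mk_zero k, mk_inj]

/-- Both summands are brought to the common exponent k + l; one further power of 2 compensates for
taking the midpoint, which is always defined. -/
noncomputable instance : Add (Cone E) where
  add := Quotient.map₂ (fun x y : ℕ × E => (x.1 + y.1 + 1, mid (half^[y.1] x.2) (half^[x.1] y.2)))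
    (by
      rintro ⟨k, a⟩ ⟨k', a'⟩ h ⟨l, b⟩ ⟨l', b'⟩ h'
      change half^[k'] a = half^[k] a' at h
      change half^[l'] b = half^[l] b' at h'
      change half^[k' + l' + 1] (mid (half^[l] a) (half^[k] b)) =
        half^[k + l + 1] (mid (half^[l'] a') (half^[k'] b'))
      simp only [iterate_half_mid, ← Function.iterate_add_apply]
      congr 1
      · rw [show k' + l' + 1 + l = (l' + l + 1) + k' by ring, Function.iterate_add_apply, h,
          ← Function.iterate_add_apply, show l' + l + 1 + k = k + l + 1 + l' by ring]
      · rw [show k' + l' + 1 + k = (k' + k + 1) + l' by ring, Function.iterate_add_apply, h',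
          ← Function.iterate_add_apply, show k' + k + 1 + l = k + l + 1 + k' by ring])

theorem mk_add_mk (k : ℕ) (a b : E) : mk k a + mk k b = mk (k + 1) (mid a b) := by
  change mk (k + k + 1) (mid (half^[k] a) (half^[k] b)) = _
  rw [← iterate_half_mid, show k + k + 1 = k + 1 + k by ring, mk_add_iterate]

noncomputable instance : AddCommMonoid (Cone E) where
  add_assoc x y z := by
    obtain ⟨k, a, b, c, rfl, rfl, rfl⟩ := exists_mk₃ x y z
    rw [mk_add_mk, mk_add_mk, ← mk_succ_half k c, ← mk_succ_half k a, mk_add_mk, mk_add_mk,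
      mid_assoc]
  zero_add x := by
    obtain ⟨k, a, rfl⟩ := exists_mk x
    rw [← mk_zero k, mk_add_mk, mid_comm, mid_zero, mk_succ_half]
  add_zero x := by
    obtain ⟨k, a, rfl⟩ := exists_mk x
    rw [← mk_zero k, mk_add_mk, mid_zero, mk_succ_half]
  add_comm x y := by
    obtain ⟨k, a, b, rfl, rfl⟩ := exists_mk₂ x y
    rw [mk_add_mk, mk_add_mk, mid_comm]
  nsmul := nsmulRec

theorem add_left_cancel' {x y z : Cone E} (h : x + y = x + z) : y = z := by
  obtain ⟨k, a, b, c, rfl, rfl, rfl⟩ := exists_mk₃ x y z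
  rw [mk_add_mk, mk_add_mk, mk_inj] at h
  rw [mid_left_cancel h]

theorem eq_zero_of_add_eq_zero {x y : Cone E} (h : x + y = 0) : y = 0 := by
  obtain ⟨k, a, b, rfl, rfl⟩ := exists_mk₂ x y
  rw [mk_add_mk, mk_eq_zero] at h
  rw [mid_eq_zero h, mk_zero]

instance : PartialOrder (Cone E) where
  le x y := ∃ z, x + z = y
  le_refl x := ⟨0, add_zero x⟩
  le_trans x y z := by
    rintro ⟨a, rfl⟩ ⟨b, rfl⟩
    exact ⟨a + b, (add_assoc _ _ _).symm⟩
  le_antisymm x y := by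
    rintro ⟨a, rfl⟩ ⟨b, hb⟩
    have h : a + b = 0 := add_left_cancel' (x := x) (by rw [← add_assoc, hb, add_zero])
    rw [add_comm] at h
    rw [eq_zero_of_add_eq_zero h, add_zero]

instance : IsOrderedCancelAddMonoid (Cone E) where
  add_le_add_left x y h z := by
    obtain ⟨a, rfl⟩ := h
    exact ⟨a, add_right_comm ..⟩
  le_of_add_le_add_left x y z h := by
    obtain ⟨a, ha⟩ := h
    exact ⟨a, add_left_cancel' (x := x) (by rw [← add_assoc, ha])⟩

theorem mk_add_self (k : ℕ) (a : E) : mk k a + mk k a = mk (k + 1) a := by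
  rw [mk_add_mk, mid_self]

theorem two_pow_nsmul_mk (k : ℕ) (a : E) : 2 ^ k • mk 0 a = mk k a := by
  induction k with
  | zero => simp
  | succ k ih => rw [pow_succ, mul_smul, two_nsmul, smul_add, ih, mk_add_self]

theorem mk_add_mk_eq_iff {k : ℕ} {a b c : E} :
    mk k a + mk k b = mk k c ↔ oplus a b = some c := by
  rw [mk_add_mk, ← mk_succ_half k c, mk_inj, oplus_iff_mid]

theorem mk_le_mk {k : ℕ} {a b : E} : mk k a ≤ mk k b ↔ a ≤ b := by
  constructor
  · rintro ⟨z, hz⟩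
    obtain ⟨l, c, rfl⟩ := exists_mk z
    rw [← mk_add_iterate l k a, ← mk_add_iterate l k b, ← mk_add_iterate k l c, add_comm l k,
      mk_add_mk_eq_iff] at hz
    obtain ⟨a', ha, hab⟩ := exists_iterate_half_of_le l ⟨_, hz⟩
    rwa [half_injective.iterate l ha]
  · rintro ⟨c, hc⟩
    exact ⟨mk k c, mk_add_mk_eq_iff.2 hc⟩

theorem exists_of_le_mk_zero {x : Cone E} {b : E} (h : x ≤ mk 0 b) : ∃ a, x = mk 0 a := by
  obtain ⟨k, a, rfl⟩ := exists_mk x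
  rw [← mk_add_iterate k 0 b, zero_add, mk_le_mk] at h
  obtain ⟨a', rfl, -⟩ := exists_iterate_half_of_le k h
  exact ⟨a', by rw [← mk_add_iterate k 0 a', zero_add]⟩

theorem mk_mem_closure (k : ℕ) (a : E) :
    mk k a ∈ AddSubmonoid.closure (Set.range (mk (E := E) 0)) := by
  rw [← two_pow_nsmul_mk]
  exact nsmul_mem (AddSubmonoid.subset_closure (Set.mem_range_self a)) _

/-- An additive map from a divisible effect algebra to a group extends to the cone. -/
theorem exists_lift {H : Type*} [AddCommGroup H] (φ : E → H)
    (hφ : ∀ a b c : E, oplus a b = some c → φ c = φ a + φ b) :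
    ∃ f : Cone E →+ H, ∀ a, f (mk 0 a) = φ a := by
  -- H may have torsion, so values of φ are compared by multiplying up from iterated halves and
  -- never by dividing in H.
  have hit : ∀ n a, 2 ^ n • φ (half^[n] a) = φ a := by
    intro n a
    induction n with
    | zero => simp
    | succ n ih =>
      rw [pow_succ, mul_smul, two_nsmul, Function.iterate_succ_apply',
        ← hφ _ _ _ (half_oplus_half _), ih]
  let F : Cone E → H := Quotient.lift (fun x : ℕ × E => 2 ^ x.1 • φ x.2) (by
    rintro ⟨k, a⟩ ⟨l, b⟩ h
    change half^[l] a = half^[k] b at h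
    change 2 ^ k • φ a = 2 ^ l • φ b
    rw [← hit l a, h, ← hit k b, smul_smul, smul_smul, mul_comm])
  have hF : ∀ k a, F (mk k a) = 2 ^ k • φ a := fun _ _ => rfl
  refine ⟨⟨⟨F, ?_⟩, ?_⟩, fun a => (hF 0 a).trans (by simp)⟩
  · have h0 := hφ _ _ _ (oplus_zero (0 : E))
    rw [← mk_zero 0, hF, left_eq_add.1 h0, smul_zero]
  · intro x y
    obtain ⟨k, a, b, rfl, rfl⟩ := exists_mk₂ x y
    change F (mk k a + mk k b) = F (mk k a) + F (mk k b)
    have h2 : ∀ a, 2 • φ (half a) = φ a := hit 1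
    rw [mk_add_mk, hF, hF, hF, pow_succ, mul_smul, hφ _ _ _ (half_oplus_half_eq a b), smul_add 2,
      h2, h2, smul_add]

end Cone

open Algebra in
/-- A divisible effect algebra has a universal group. -/
theorem exists_isUniversalGroup : ∃ (G : Type v) (_ : AddCommGroup G) (_ : PartialOrder G)
    (_ : IsOrderedAddMonoid G) (u : G) (ι : E → G), IsUniversalGroup ι u := by
  let j : Cone E →+ GrothendieckAddGroup (Cone E) := GrothendieckAddGroup.of
  have hj : ∀ x, j x = AddLocalization.mk x 0 := fun x =>
    (AddLocalization.mk_zero_eq_addMonoidOf_mk x).symm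
  have hmk : ∀ x y, AddLocalization.mk x y = j x - j y := fun x y => by
    rw [hj, hj, GrothendieckAddGroup.mk_sub_mk]
    simp
  have hle : ∀ x y, j x ≤ j y ↔ x ≤ y := fun x y => by
    rw [hj, hj, AddLocalization.mk_le_mk]; simp
  have hinj : Function.Injective j := fun x y h =>
    le_antisymm ((hle _ _).1 h.le) ((hle _ _).1 h.ge)
  -- The order of the cone is the algebraic one, so a difference is positive exactly when it is
  -- represented by an element of the cone.
  have hpos : ∀ x, 0 ≤ x ↔ ∃ y, x = j y := by
    intro x
    induction x using AddLocalization.ind with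
    | _ x =>
    obtain ⟨x, y⟩ := x
    rw [hmk, sub_nonneg, hle]
    constructor
    · rintro ⟨z, hz⟩
      exact ⟨z, by rw [← hz, map_add, add_sub_cancel_left]⟩
    · rintro ⟨z, hz⟩
      exact ⟨z, hinj (by rw [map_add, ← hz, add_sub_cancel])⟩
  have hcl : ∀ x, j x ∈ AddSubmonoid.closure (Set.range fun a : E => j (Cone.mk 0 a)) := by
    intro x
    obtain ⟨k, a, rfl⟩ := Cone.exists_mk x
    have := AddSubmonoid.mem_map_of_mem j (Cone.mk_mem_closure k a)
    rwa [AddMonoidHom.map_mclosure, ← Set.range_comp] at this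
  refine ⟨GrothendieckAddGroup (Cone E), inferInstance, inferInstance, inferInstance,
    j (Cone.mk 0 1), fun a => j (Cone.mk 0 a), ?_⟩
  refine ⟨⟨(hpos _).2 ⟨_, rfl⟩, ?_, ?_, ?_, rfl, ?_⟩, ?_, ?_⟩
  · intro g
    induction g using AddLocalization.ind with
    | _ x =>
    obtain ⟨x, y⟩ := x
    rw [hmk]
    obtain ⟨k, a, rfl⟩ := Cone.exists_mk x
    refine ⟨2 ^ k, (sub_le_self _ ((hpos _).2 ⟨_, rfl⟩)).trans ?_⟩
    rw [← map_nsmul, hle, Cone.two_pow_nsmul_mk, Cone.mk_le_mk]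
    exact ⟨_, oplus_compl a⟩
  · intro a b h
    exact Cone.mk_inj.1 (hinj h)
  · ext g
    constructor
    · rintro ⟨a, rfl⟩
      exact ⟨(hpos _).2 ⟨_, rfl⟩, (hle _ _).2 (Cone.mk_le_mk.2 ⟨_, oplus_compl a⟩)⟩
    · rintro ⟨h0, h1⟩
      obtain ⟨x, rfl⟩ := (hpos _).1 h0
      obtain ⟨a, rfl⟩ := Cone.exists_of_le_mk_zero ((hle _ _).1 h1)
      exact ⟨a, rfl⟩
  · intro a b c
    rw [← map_add, hinj.eq_iff, Cone.mk_add_mk_eq_iff]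
  · intro g
    rw [hpos]
    constructor
    · rintro ⟨x, rfl⟩
      exact hcl x
    · intro h
      rw [← hpos]
      induction h using AddSubmonoid.closure_induction with
      | mem z hz => obtain ⟨a, rfl⟩ := hz; exact (hpos _).2 ⟨_, rfl⟩
      | zero => exact le_rfl
      | add a b _ _ ha hb => exact add_nonneg ha hb
  · intro H _ φ hφ
    obtain ⟨f, hf⟩ := Cone.exists_lift φ hφ
    have hl : ∀ x, GrothendieckAddGroup.lift f (j x) = f x := fun x => by
      conv_rhs => rw [← GrothendieckAddGroup.lift.symm_apply_apply f]
      rfl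
    refine ⟨GrothendieckAddGroup.lift f, fun a => by simp only [hl, hf], fun g hg => ?_⟩
    -- Every element of the cone is a multiple 2^k of an element of E, which forces uniqueness of
    -- the extension.
    have hgj : ∀ x, g (j x) = f x := by
      intro x
      obtain ⟨k, a, rfl⟩ := Cone.exists_mk x
      rw [← Cone.two_pow_nsmul_mk, map_nsmul, map_nsmul, map_nsmul, hg, hf]
    ext x
    induction x using AddLocalization.ind with
    | _ x =>
    obtain ⟨x, y⟩ := x
    rw [hmk, map_sub, map_sub, hgj, hgj, hl, hl]

end Divisible

end EffectAlgebra

/-! ### Compressions and commutation in an ordered group -/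

namespace EffectAlgebra

/-- A compression base of an ordered group with order unit `u`, with the family of compressions
indexed by a set `P` of elements of the group. -/
structure CompressionSystem (G : Type*) [AddCommGroup G] [PartialOrder G] (u : G) where
  P : Set G
  J : G → G →+ G
  unit_mem : u ∈ P
  compl_mem : ∀ p ∈ P, u - p ∈ P
  add_mem : ∀ p ∈ P, ∀ q ∈ P, p + q ≤ u → p + q ∈ P
  map_nonneg : ∀ p ∈ P, ∀ g, 0 ≤ g → 0 ≤ J p g
  map_unit : ∀ p ∈ P, J p u = p
  idem : ∀ p ∈ P, ∀ g, J p (J p g) = J p g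
  compl_map : ∀ p ∈ P, ∀ g, J (u - p) (J p g) = 0
  map_compl_of_eq_zero : ∀ p ∈ P, ∀ g, 0 ≤ g → J p g = 0 → J (u - p) g = g
  unit_nonneg : 0 ≤ u
  order_unit : ∀ g : G, ∃ n : ℕ, g ≤ n • u
  comp : ∀ p ∈ P, ∀ q ∈ P, ∀ a b c : G, 0 ≤ a → 0 ≤ b → 0 ≤ c → p = a + c → q = b + c →
    a + b + c ≤ u → ∃ r ∈ P, ∀ g, J p (J q g) = J r g

namespace CompressionSystem

variable {G : Type*} [AddCommGroup G] [PartialOrder G] [IsOrderedAddMonoid G] {u : G}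
  (S : CompressionSystem G u)

/-- The projection `p` commutes with `g`. -/
def Com (p g : G) : Prop := S.J p g + S.J (u - p) g = g

variable {S} {p q r g h x y : G}

theorem mono (hp : p ∈ S.P) (h : x ≤ y) : S.J p x ≤ S.J p y := by
  rw [← sub_nonneg, ← map_sub]
  exact S.map_nonneg p hp _ (sub_nonneg.2 h)

theorem mem_nonneg (hp : p ∈ S.P) : 0 ≤ p := by
  rw [← S.map_unit p hp]
  exact S.map_nonneg p hp _ S.unit_nonneg

theorem mem_le (hp : p ∈ S.P) : p ≤ u := sub_nonneg.1 (mem_nonneg (S.compl_mem p hp))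

theorem zero_mem : (0 : G) ∈ S.P := by
  simpa using S.compl_mem u S.unit_mem

theorem map_compl (hp : p ∈ S.P) (g : G) : S.J p (S.J (u - p) g) = 0 := by
  simpa using S.compl_map _ (S.compl_mem p hp) g

theorem eq_of_compl_eq_zero (hp : p ∈ S.P) (hx : 0 ≤ x) (h : S.J (u - p) x = 0) :
    S.J p x = x := by
  simpa using S.map_compl_of_eq_zero _ (S.compl_mem p hp) x hx h

theorem map_self (hp : p ∈ S.P) : S.J p p = p := by
  have h := S.idem p hp u
  rwa [S.map_unit p hp] at h

theorem compl_map_self (hp : p ∈ S.P) : S.J (u - p) p = 0 := by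
  have h := S.compl_map p hp u
  rwa [S.map_unit p hp] at h

theorem compl_eq_zero_of_le (hp : p ∈ S.P) (hx : 0 ≤ x) {n : ℕ} (h : x ≤ n • p) :
    S.J (u - p) x = 0 := by
  refine le_antisymm ?_ (S.map_nonneg _ (S.compl_mem p hp) _ hx)
  have := mono (S.compl_mem p hp) h
  rwa [map_nsmul, compl_map_self hp, smul_zero] at this

theorem eq_of_le (hp : p ∈ S.P) (hx : 0 ≤ x) {n : ℕ} (h : x ≤ n • p) : S.J p x = x :=
  eq_of_compl_eq_zero hp hx (compl_eq_zero_of_le hp hx h)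

theorem eq_of_le' (hp : p ∈ S.P) (hx : 0 ≤ x) (h : x ≤ p) : S.J p x = x :=
  eq_of_le (n := 1) hp hx (by simpa)

theorem eq_zero_of_le (hp : p ∈ S.P) (hx : 0 ≤ x) {n : ℕ} (h : x ≤ n • (u - p)) :
    S.J p x = 0 := by
  simpa using compl_eq_zero_of_le (S.compl_mem p hp) hx h

theorem eq_zero_of_le' (hp : p ∈ S.P) (hx : 0 ≤ x) (h : x ≤ u - p) : S.J p x = 0 :=
  eq_zero_of_le (n := 1) hp hx (by simpa)

/-- Elements fixed by `J p` that lie below the unit are dominated by `p`. -/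
theorem le_of_map_eq (hp : p ∈ S.P) (hxu : x ≤ u) (h : S.J p x = x) : x ≤ p := by
  rw [← h]
  exact (mono hp hxu).trans_eq (S.map_unit p hp)

theorem le_of_compl_eq_zero (hp : p ∈ S.P) (hx : 0 ≤ x) (hxu : x ≤ u) (h : S.J (u - p) x = 0) :
    x ≤ p :=
  le_of_map_eq hp hxu (eq_of_compl_eq_zero hp hx h)

theorem le_iff_compl_eq_zero (hp : p ∈ S.P) (hx : 0 ≤ x) (hxu : x ≤ u) :
    x ≤ p ↔ S.J (u - p) x = 0 :=
  ⟨fun h => compl_eq_zero_of_le (n := 1) hp hx (by simpa), le_of_compl_eq_zero hp hx hxu⟩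

theorem com_iff : S.Com p g ↔ S.J p g + S.J (u - p) g = g := Iff.rfl

theorem Com.compl (h : S.Com p g) : S.Com (u - p) g := by
  rw [com_iff, sub_sub_cancel, add_comm]
  exact h

theorem Com.add (hg : S.Com p g) (hh : S.Com p h) : S.Com p (g + h) := by
  rw [com_iff] at *
  rw [map_add, map_add, add_add_add_comm, hg, hh]

theorem Com.neg (hg : S.Com p g) : S.Com p (-g) := by
  rw [com_iff] at *
  rw [map_neg, map_neg, ← neg_add, hg]

theorem Com.sub (hg : S.Com p g) (hh : S.Com p h) : S.Com p (g - h) := by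
  rw [sub_eq_add_neg]; exact hg.add hh.neg

theorem Com.rat_smul [Module ℚ G] (hg : S.Com p g) (t : ℚ) : S.Com p (t • g) := by
  rw [com_iff] at *
  rw [map_rat_smul, map_rat_smul, ← smul_add, hg]

theorem com_unit (hp : p ∈ S.P) : S.Com p u := by
  rw [com_iff, S.map_unit p hp, S.map_unit _ (S.compl_mem p hp), add_sub_cancel]

/-- The positive element x - J_p x is annihilated by J_p, hence fixed by J_{u-p}, which in turn
annihilates J_p x. A one-sided inequality therefore suffices for commutation. -/
theorem com_of_map_le (hp : p ∈ S.P) (h : S.J p x ≤ x) : S.Com p x := by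
  have h1 := S.map_compl_of_eq_zero p hp (x - S.J p x) (sub_nonneg.2 h)
    (by rw [map_sub, S.idem p hp, sub_self])
  rw [map_sub, S.compl_map p hp, sub_zero] at h1
  rw [com_iff, h1, add_sub_cancel]

theorem Com.map_le (hp : p ∈ S.P) (hx : 0 ≤ x) (h : S.Com p x) : S.J p x ≤ x := by
  conv_rhs => rw [← h]
  exact le_add_of_nonneg_right (S.map_nonneg _ (S.compl_mem p hp) _ hx)

theorem com_of_eq_zero (hp : p ∈ S.P) (hx : 0 ≤ x) (h : S.J p x = 0) : S.Com p x :=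
  com_of_map_le hp (h.trans_le hx)

theorem com_of_eq (hp : p ∈ S.P) (h : S.J p x = x) : S.Com p x := com_of_map_le hp h.le

/-- The product of the compressions of commuting projections is the compression of their meet. -/
theorem Com.comp (hp : p ∈ S.P) (hq : q ∈ S.P) (h : S.Com p q) :
    S.J p q ∈ S.P ∧ S.J q p = S.J p q ∧ (∀ g, S.J p (S.J q g) = S.J (S.J p q) g) ∧
      ∀ g, S.J q (S.J p g) = S.J (S.J p q) g := by
  -- With c = J_p q, the decompositions p = (p - c) + c and q = J_{u-p} q + c exhibit the
  -- compatibility required by `comp`.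
  have hc := S.map_nonneg p hp q (mem_nonneg hq)
  have hcp : S.J p q ≤ p := by
    conv_rhs => rw [← S.map_unit p hp]
    exact mono hp (mem_le hq)
  have ha : 0 ≤ p - S.J p q := sub_nonneg.2 hcp
  have hb := S.map_nonneg _ (S.compl_mem p hp) q (mem_nonneg hq)
  have hb' : S.J (u - p) q ≤ u - p := by
    conv_rhs => rw [← S.map_unit _ (S.compl_mem p hp)]
    exact mono (S.compl_mem p hp) (mem_le hq)
  have hqc : q = S.J (u - p) q + S.J p q := by rw [add_comm]; exact h.symm
  have hsum : p - S.J p q + S.J (u - p) q + S.J p q ≤ u :=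
    calc p - S.J p q + S.J (u - p) q + S.J p q = S.J (u - p) q + p := by abel
      _ ≤ (u - p) + p := by gcongr
      _ = u := by abel
  have hqp : S.J q p = S.J p q := by
    have e1 : S.J q (S.J p q) = S.J p q := eq_of_le' hq hc (h.map_le hp (mem_nonneg hq))
    have e2 : S.J q (p - S.J p q) = 0 := by
      refine eq_zero_of_le' hq ha ?_
      rw [le_sub_iff_add_le]
      calc p - S.J p q + q = p - S.J p q + (S.J (u - p) q + S.J p q) := by rw [← hqc]
        _ ≤ u := by rwa [← add_assoc]
    rwa [map_sub, e1, sub_eq_zero] at e2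
  obtain ⟨r, hr, hr'⟩ := S.comp p hp q hq _ _ _ ha hb hc (by abel) hqc hsum
  obtain ⟨s, hs, hs'⟩ := S.comp q hq p hp _ _ _ hb ha hc hqc (by abel)
    (by rwa [add_comm (S.J (u - p) q)])
  -- Evaluation at u identifies the index of the product compression as J_p q.
  have hrr := hr' u
  rw [S.map_unit q hq, S.map_unit r hr] at hrr
  have hss := hs' u
  rw [S.map_unit p hp, S.map_unit s hs, hqp] at hss
  subst hrr
  rw [← hss] at hs'
  exact ⟨hr, hqp, hr', hs'⟩

theorem Com.symm (hp : p ∈ S.P) (hq : q ∈ S.P) (h : S.Com p q) : S.Com q p := by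
  refine com_of_map_le hq ?_
  rw [(h.comp hp hq).2.1]
  conv_rhs => rw [← S.map_unit p hp]
  exact mono hp (mem_le hq)

theorem Com.map_comm (hp : p ∈ S.P) (hq : q ∈ S.P) (h : S.Com p q) (g : G) :
    S.J p (S.J q g) = S.J q (S.J p g) := by
  rw [(h.comp hp hq).2.2.1, (h.comp hp hq).2.2.2]

/-- A projection commuting with `p` and with `g` commutes with `J p g`. -/
theorem Com.map (hp : p ∈ S.P) (hq : q ∈ S.P) (h : S.Com q p) (hg : S.Com q g) :
    S.Com q (S.J p g) := by
  rw [com_iff, h.map_comm hq hp, h.compl.map_comm (S.compl_mem q hq) hp, ← map_add, hg]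

theorem le_meet (hp : p ∈ S.P) (hx : 0 ≤ x) (hxp : x ≤ p)
    (hxq : x ≤ q) : x ≤ S.J p q := by
  rw [← eq_of_le' hp hx hxp]
  exact mono hp hxq

theorem com_of_le (hp : p ∈ S.P) (hq : q ∈ S.P) (h : p ≤ q) : S.Com p q :=
  Com.symm hq hp (com_of_eq hq (eq_of_le' hq (mem_nonneg hp) h))

theorem map_of_le (hp : p ∈ S.P) (hq : q ∈ S.P) (h : p ≤ q) : S.J p q = p := by
  rw [← ((com_of_le hp hq h).comp hp hq).2.1]
  exact eq_of_le' hq (mem_nonneg hp) h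

theorem map_map_of_le (hp : p ∈ S.P) (hq : q ∈ S.P) (h : p ≤ q) (g : G) :
    S.J p (S.J q g) = S.J p g := by
  rw [((com_of_le hp hq h).comp hp hq).2.2.1, map_of_le hp hq h]

theorem map_map_of_le' (hp : p ∈ S.P) (hq : q ∈ S.P) (h : p ≤ q) (g : G) :
    S.J q (S.J p g) = S.J p g := by
  rw [((com_of_le hp hq h).comp hp hq).2.2.2, map_of_le hp hq h]

theorem map_map_of_orth (hp : p ∈ S.P) (hq : q ∈ S.P) (h : p + q ≤ u) (g : G) :
    S.J p (S.J q g) = 0 := by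
  rw [← map_map_of_le hp (S.compl_mem q hq) (le_sub_iff_add_le.2 h), S.compl_map q hq, map_zero]

theorem sub_mem (hp : p ∈ S.P) (hq : q ∈ S.P) (h : p ≤ q) : q - p ∈ S.P := by
  have h1 := S.compl_mem _ (S.add_mem p hp (u - q) (S.compl_mem q hq)
    (by rw [add_sub_left_comm]; exact add_le_of_nonpos_right (sub_nonpos.2 h)))
  rwa [show u - (p + (u - q)) = q - p by abel] at h1

theorem map_compl_of_le (hp : p ∈ S.P) (hq : q ∈ S.P) (h : p ≤ q) (g : G) :
    S.J q (S.J (u - p) g) = S.J (q - p) g := by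
  have hc := (com_of_le hp hq h).compl.symm (S.compl_mem p hp) hq
  rw [(hc.comp hq (S.compl_mem p hp)).2.2.1, map_sub, S.map_unit q hq,
    eq_of_le' hq (mem_nonneg hp) h]

theorem map_eq_add (hp : p ∈ S.P) (hq : q ∈ S.P) (h : p ≤ q) (hg : S.Com p g) :
    S.J q g = S.J p g + S.J (q - p) g := by
  conv_lhs => rw [← hg]
  rw [map_add, map_map_of_le' hp hq h, map_compl_of_le hp hq h]

theorem map_sub_eq (hp : p ∈ S.P) (hq : q ∈ S.P) (h : p ≤ q) (hg : S.Com p g) :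
    S.J (q - p) g = S.J q g - S.J p g := by
  rw [map_eq_add hp hq h hg, add_sub_cancel_left]

theorem Com.sub_left (hp : p ∈ S.P) (hq : q ∈ S.P) (h : p ≤ q) (hpg : S.Com p g)
    (hqg : S.Com q g) : S.Com (q - p) g := by
  have h1 : p ≤ u - (q - p) := by
    rw [le_sub_iff_add_le, add_sub_cancel]; exact mem_le hq
  rw [com_iff, map_sub_eq hp hq h hpg,
    map_eq_add hp (S.compl_mem _ (sub_mem hp hq h)) h1 hpg,
    show u - (q - p) - p = u - q by abel]
  rw [com_iff] at hqg
  conv_rhs => rw [← hqg]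
  abel

/-- The complement of the meet pq is (u - p) + (p - pq), and the compression along p - pq is J_p
J_{u-q}. Hence J_{pq} g + J_{u-pq} g = J_p(J_q g + J_{u-q} g) + J_{u-p} g = g. -/
theorem Com.meet (hp : p ∈ S.P) (hq : q ∈ S.P) (hpq : S.Com p q) (hpg : S.Com p g)
    (hqg : S.Com q g) : S.Com (S.J p q) g := by
  obtain ⟨hm, -, h1, -⟩ := hpq.comp hp hq
  have hmp : S.J p q ≤ p := (mono hp (mem_le hq)).trans_eq (S.map_unit p hp)
  have hpq' : S.Com p (u - q) := (com_unit hp).sub hpq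
  have h2 := (hpq'.comp hp (S.compl_mem q hq)).2.2.1
  rw [map_sub, S.map_unit p hp] at h2
  rw [com_iff, map_eq_add (S.compl_mem p hp) (S.compl_mem _ hm) (sub_le_sub_left hmp u) hpg.compl,
    show u - S.J p q - (u - p) = p - S.J p q by abel, ← h1, ← h2, add_left_comm, ← map_add]
  rw [com_iff] at hqg hpg
  rw [hqg, add_comm, hpg]

end CompressionSystem

end EffectAlgebra

namespace EffectAlgebra

namespace CompressionSystem

/-! ### Supports and positive parts in a spectral system -/

section Spectral

variable {G : Type*} [AddCommGroup G] [PartialOrder G] [IsOrderedAddMonoid G] {u : G}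
  (S : CompressionSystem G u)

/-- General comparability together with covers of positive elements. -/
structure Spectral : Prop where
  comparable : ∀ g, ∃ p ∈ S.P, S.Com p g ∧ (∀ q ∈ S.P, S.Com q g → S.Com q p) ∧
    S.J (u - p) g ≤ 0 ∧ 0 ≤ S.J p g
  cover : ∀ g, 0 ≤ g → ∃ c ∈ S.P, ∀ q ∈ S.P, c ≤ q ↔ S.J (u - q) g = 0

variable {S} {p q r g h x y a : G}

/-- Split x along q and let c ≤ q and d ≤ u - q be covers of the two pieces. The cover p of x is
caught between c and c + d, so J_q p ≤ c ≤ p, which gives commutation. -/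
theorem com_cover (hS : S.Spectral) (hx : 0 ≤ x) (hp : p ∈ S.P)
    (hpx : ∀ q ∈ S.P, p ≤ q ↔ S.J (u - q) x = 0) (hq : q ∈ S.P) (h : S.Com q x) : S.Com q p := by
  have hq' := S.compl_mem q hq
  have hy := S.map_nonneg q hq x hx
  have hz := S.map_nonneg _ hq' x hx
  obtain ⟨c, hc, hcy⟩ := hS.cover _ hy
  obtain ⟨d, hd, hdz⟩ := hS.cover _ hz
  have hcq : c ≤ q := (hcy q hq).2 (S.compl_map q hq x)
  have hdq : d ≤ u - q := (hdz _ hq').2 (S.compl_map _ hq' x)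
  have hcd : c + d ≤ u := by simpa using add_le_add hcq hdq
  have hs := S.add_mem c hc d hd hcd
  have hcp : c ≤ p := (hcy p hp).2 (le_antisymm
    ((mono (S.compl_mem p hp) (h.map_le hq hx)).trans_eq ((hpx p hp).1 le_rfl))
    (S.map_nonneg _ (S.compl_mem p hp) _ hy))
  have hps : p ≤ c + d := by
    rw [hpx _ hs, ← com_iff.1 h, map_add,
      (hcy _ hs).1 (le_add_of_nonneg_right (mem_nonneg hd)),
      (hdz _ hs).1 (le_add_of_nonneg_left (mem_nonneg hc)), add_zero]
  refine com_of_map_le hq ?_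
  calc S.J q p ≤ S.J q (c + d) := mono hq hps
    _ = c := by
      rw [map_add, eq_of_le' hq (mem_nonneg hc) hcq, eq_zero_of_le' hq (mem_nonneg hd) hdq,
        add_zero]
    _ ≤ p := hcp

/-- A projection comparing g with 0 is not canonical. Replacing it by the cover of J_p g changes
neither part of g, keeps the bicommutant property by `com_cover`, and adds the minimality that pins
the projection down. -/
theorem exists_supp (hS : S.Spectral) (g : G) : ∃ p ∈ S.P, S.Com p g ∧
    (∀ q ∈ S.P, S.Com q g → S.Com q p) ∧ S.J (u - p) g ≤ 0 ∧ 0 ≤ S.J p g ∧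
    ∀ q ∈ S.P, p ≤ q ↔ S.J (u - q) (S.J p g) = 0 := by
  obtain ⟨p, hp, hpg, hbi, hneg, hpos⟩ := hS.comparable g
  obtain ⟨c, hc, hcp⟩ := hS.cover _ hpos
  have hcle : c ≤ p := (hcp p hp).2 (S.compl_map p hp g)
  have h1 : S.J c g = S.J p g := by
    rw [← map_map_of_le hc hp hcle, eq_of_compl_eq_zero hc hpos ((hcp c hc).1 le_rfl)]
  have h2 : S.J (u - c) g = S.J (u - p) g := by
    have h3 : u - p ≤ u - c := sub_le_sub_left hcle u
    conv_lhs => rw [← com_iff.1 hpg]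
    rw [map_add, (hcp c hc).1 le_rfl, zero_add,
      map_map_of_le' (S.compl_mem p hp) (S.compl_mem c hc) h3]
  refine ⟨c, hc, ?_, ?_, ?_, ?_, ?_⟩
  · rw [com_iff, h1, h2]; exact hpg
  · exact fun q hq hqg => com_cover hS hpos hc hcp hq ((hbi q hq hqg).map hp hq hqg)
  · rwa [h2]
  · rwa [h1]
  · rwa [h1]

open Classical in
variable (S) in
/-- The support of the positive part of `g`. -/
noncomputable def supp (g : G) : G :=
  if h : S.Spectral then (exists_supp h g).choose else 0

variable (hS : S.Spectral)
include hS

theorem supp_spec (g : G) : S.supp g ∈ S.P ∧ S.Com (S.supp g) g ∧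
    (∀ q ∈ S.P, S.Com q g → S.Com q (S.supp g)) ∧ S.J (u - S.supp g) g ≤ 0 ∧
    0 ≤ S.J (S.supp g) g ∧
    ∀ q ∈ S.P, S.supp g ≤ q ↔ S.J (u - q) (S.J (S.supp g) g) = 0 := by
  rw [supp, dif_pos hS]
  exact (exists_supp hS g).choose_spec

theorem supp_mem (g : G) : S.supp g ∈ S.P := (supp_spec hS g).1

theorem com_supp_self (g : G) : S.Com (S.supp g) g := (supp_spec hS g).2.1

theorem com_supp (hq : q ∈ S.P) (h : S.Com q g) : S.Com q (S.supp g) :=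
  (supp_spec hS g).2.2.1 q hq h

theorem map_compl_supp_nonpos (g : G) : S.J (u - S.supp g) g ≤ 0 := (supp_spec hS g).2.2.2.1

theorem map_supp_nonneg (g : G) : 0 ≤ S.J (S.supp g) g := (supp_spec hS g).2.2.2.2.1

theorem supp_le_iff (hq : q ∈ S.P) : S.supp g ≤ q ↔ S.J (u - q) (S.J (S.supp g) g) = 0 :=
  (supp_spec hS g).2.2.2.2.2 q hq

/-- Uniqueness of the positive part. -/
theorem map_eq_map_supp (hp : p ∈ S.P) (hg : S.Com p g) (hneg : S.J (u - p) g ≤ 0)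
    (hpos : 0 ≤ S.J p g) : S.J p g = S.J (S.supp g) g := by
  have he := supp_mem hS g
  have he' := S.compl_mem _ he
  have hp' := S.compl_mem p hp
  have hc := com_supp hS hp hg
  have hc' : S.Com p (u - S.supp g) := (com_unit hp).sub hc
  have h1 : S.J p (S.J (u - S.supp g) g) = 0 := by
    refine le_antisymm ?_ ?_
    · simpa using mono hp (map_compl_supp_nonpos hS g)
    · rw [hc'.map_comm hp he']
      exact S.map_nonneg _ he' _ hpos
  have h2 : S.J (u - p) (S.J (S.supp g) g) = 0 := by
    refine le_antisymm ?_ (S.map_nonneg _ hp' _ (map_supp_nonneg hS g))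
    rw [hc.compl.map_comm hp' he]
    simpa using mono he hneg
  calc S.J p g = S.J p (S.J (S.supp g) g) := by
        conv_lhs => rw [← com_iff.1 (com_supp_self hS g)]
        rw [map_add, h1, add_zero]
    _ = S.J (S.supp g) g := eq_of_compl_eq_zero hp (map_supp_nonneg hS g) h2

theorem map_supp_of_nonneg (hx : 0 ≤ x) : S.J (S.supp x) x = x := by
  refine eq_of_compl_eq_zero (supp_mem hS x) hx (le_antisymm (map_compl_supp_nonpos hS x) ?_)
  exact S.map_nonneg _ (S.compl_mem _ (supp_mem hS x)) _ hx

theorem supp_le_iff_of_nonneg (hx : 0 ≤ x) (hq : q ∈ S.P) :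
    S.supp x ≤ q ↔ S.J (u - q) x = 0 := by
  rw [supp_le_iff hS hq, map_supp_of_nonneg hS hx]

theorem map_supp_neg (g : G) : S.J (S.supp (-g)) (-g) = -S.J (u - S.supp g) g := by
  have he := supp_mem hS g
  rw [← map_eq_map_supp hS (S.compl_mem _ he) (com_supp_self hS g).neg.compl, map_neg]
  · rw [sub_sub_cancel, map_neg]
    exact neg_nonpos.2 (map_supp_nonneg hS g)
  · rw [map_neg]
    exact neg_nonneg.2 (map_compl_supp_nonpos hS g)

theorem supp_eq_of_map_eq (h : ∀ q ∈ S.P,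
    S.J q (S.J (S.supp x) x) = 0 ↔ S.J q (S.J (S.supp y) y) = 0) : S.supp x = S.supp y := by
  have hx := supp_mem hS x
  have hy := supp_mem hS y
  apply le_antisymm
  · rw [supp_le_iff hS hy, h _ (S.compl_mem _ hy), ← supp_le_iff hS hy]
  · rw [supp_le_iff hS hx, ← h _ (S.compl_mem _ hx), ← supp_le_iff hS hx]

/-- Commutation lets the compression along u - supp h be moved past the one along supp g; there g ≤
h is nonpositive, so the positive part of g vanishes off supp h. -/
theorem supp_mono (hgh : g ≤ h) (hc : S.Com (S.supp h) g) : S.supp g ≤ S.supp h := by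
  have hp := supp_mem hS g
  have hf := supp_mem hS h
  have hf' := S.compl_mem _ hf
  rw [supp_le_iff hS hf]
  refine le_antisymm ?_ (S.map_nonneg _ hf' _ (map_supp_nonneg hS g))
  rw [(com_supp hS hf hc).compl.map_comm hf' hp, ← map_zero (S.J (S.supp g))]
  exact mono hp ((mono hf' hgh).trans (map_compl_supp_nonpos hS h))

theorem com_map_supp (hq : q ∈ S.P) (h : S.Com q g) : S.Com q (S.J (S.supp g) g) :=
  (com_supp hS hq h).map (supp_mem hS g) hq h

/-- Compressing by q discards a nonpositive contribution and shrinks the positive part, so the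
positive part is maximal among compressions by commuting projections. -/
theorem map_le_map_supp (hq : q ∈ S.P) (h : S.Com q g) : S.J q g ≤ S.J (S.supp g) g := by
  calc S.J q g = S.J q (S.J (S.supp g) g) + S.J q (S.J (u - S.supp g) g) := by
        rw [← map_add, com_iff.1 (com_supp_self hS g)]
    _ ≤ S.J q (S.J (S.supp g) g) := by
        apply add_le_of_nonpos_right
        simpa using mono hq (map_compl_supp_nonpos hS g)
    _ ≤ _ := (com_map_supp hS hq h).map_le hq (map_supp_nonneg hS g)

variable [Module ℚ G] [PosSMulMono ℚ G]

theorem supp_smul {t : ℚ} (ht : 0 < t) (g : G) : S.supp (t • g) = S.supp g := by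
  apply supp_eq_of_map_eq hS
  intro q hq
  rw [← map_eq_map_supp hS (supp_mem hS g) ((com_supp_self hS g).rat_smul t)]
  · rw [map_rat_smul, map_rat_smul, smul_eq_zero_iff_right ht.ne']
  · rw [map_rat_smul]
    simpa using smul_le_smul_of_nonneg_left (map_compl_supp_nonpos hS g) ht.le
  · rw [map_rat_smul]
    exact smul_nonneg ht.le (map_supp_nonneg hS g)

end Spectral

end CompressionSystem

end EffectAlgebra

namespace EffectAlgebra

namespace CompressionSystem

/-! ### Spectral projections with rational parameter -/

section Resolution

variable {G : Type*} [AddCommGroup G] [PartialOrder G] [IsOrderedAddMonoid G] {u : G}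
  [Module ℚ G] [PosSMulMono ℚ G] {S : CompressionSystem G u}

theorem smul_le_smul_rat {s t : ℚ} {x : G} (hx : 0 ≤ x) (h : s ≤ t) : s • x ≤ t • x := by
  rw [← sub_nonneg, ← sub_smul]
  exact smul_nonneg (sub_nonneg.2 h) hx

variable (S) in
/-- The spectral projection of `a` for the half-line `(t, ∞)`. -/
noncomputable def upper (a : G) (t : ℚ) : G := S.supp (a - t • u)

variable {p q r g h x y a : G} {s t : ℚ} (hS : S.Spectral)

section

omit [PosSMulMono ℚ G]

theorem Com.sub_smul_unit (hq : q ∈ S.P) (h : S.Com q a) (t : ℚ) : S.Com q (a - t • u) :=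
  h.sub ((com_unit hq).rat_smul t)

theorem com_of_sub_smul_unit (hq : q ∈ S.P) (h : S.Com q (a - t • u)) : S.Com q a := by
  simpa using h.add ((com_unit hq).rat_smul t)

include hS

theorem upper_mem (a : G) (t : ℚ) : S.upper a t ∈ S.P := supp_mem hS _

theorem com_upper_self (a : G) (t : ℚ) : S.Com (S.upper a t) a :=
  com_of_sub_smul_unit (upper_mem hS a t) (com_supp_self hS _)

theorem com_upper (hq : q ∈ S.P) (h : S.Com q a) (t : ℚ) : S.Com q (S.upper a t) :=
  com_supp hS hq (h.sub_smul_unit hq t)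

end

include hS

theorem upper_anti (a : G) (h : s ≤ t) : S.upper a t ≤ S.upper a s :=
  supp_mono hS (sub_le_sub_left (smul_le_smul_rat S.unit_nonneg h) a)
    ((com_upper_self hS a s).sub_smul_unit (upper_mem hS a s) t)

theorem upper_zero (a : G) : S.upper a 0 = S.supp a := by rw [upper, zero_smul, sub_zero]

theorem supp_eq_zero_of_nonpos (h : g ≤ 0) : S.supp g = 0 := by
  refine le_antisymm ?_ (mem_nonneg (supp_mem hS g))
  rw [supp_le_iff hS zero_mem]
  have h0 : S.J (S.supp g) g = 0 :=
    le_antisymm (by simpa using mono (supp_mem hS g) h) (map_supp_nonneg hS g)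
  rw [h0, map_zero]

theorem upper_one (ha : a ≤ u) : S.upper a 1 = 0 := by
  rw [upper, one_smul]
  exact supp_eq_zero_of_nonpos hS (sub_nonpos.2 ha)

variable (S) in
omit hS [IsOrderedAddMonoid G] [PosSMulMono ℚ G] in
/-- The spectral projection of `a` for the interval `(s, t]`. -/
noncomputable def band (a : G) (s t : ℚ) : G := S.upper a s - S.upper a t

theorem band_mem (a : G) (h : s ≤ t) : S.band a s t ∈ S.P :=
  sub_mem (upper_mem hS a t) (upper_mem hS a s) (upper_anti hS a h)

omit [PosSMulMono ℚ G] in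
theorem band_le_upper (a : G) : S.band a s t ≤ S.upper a s :=
  sub_le_self _ (mem_nonneg (upper_mem hS a t))

omit [PosSMulMono ℚ G] in
theorem band_le_compl_upper (a : G) : S.band a s t ≤ u - S.upper a t :=
  sub_le_sub_right (mem_le (upper_mem hS a s)) _

theorem com_band_self (a : G) (h : s ≤ t) : S.Com (S.band a s t) a :=
  Com.sub_left (upper_mem hS a t) (upper_mem hS a s) (upper_anti hS a h) (com_upper_self hS a t)
    (com_upper_self hS a s)

theorem map_band (a : G) (h : s ≤ t) (r : ℚ) : S.J (S.band a s t) (a - r • u) =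
    S.J (S.upper a s) (a - r • u) - S.J (S.upper a t) (a - r • u) :=
  map_sub_eq (upper_mem hS a t) (upper_mem hS a s) (upper_anti hS a h)
    ((com_upper_self hS a t).sub_smul_unit (upper_mem hS a t) r)

theorem map_nonneg_of_le_upper (a : G) (hp : p ∈ S.P) (h : p ≤ S.upper a s) :
    0 ≤ S.J p (a - s • u) := by
  rw [← map_map_of_le hp (upper_mem hS a s) h]
  exact S.map_nonneg p hp _ (map_supp_nonneg hS _)

theorem map_nonpos_of_le_compl_upper (a : G) (hp : p ∈ S.P) (h : p ≤ u - S.upper a s) :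
    S.J p (a - s • u) ≤ 0 := by
  rw [← map_map_of_le hp (S.compl_mem _ (upper_mem hS a s)) h]
  exact (mono hp (map_compl_supp_nonpos hS (a - s • u))).trans_eq (map_zero _)

theorem smul_band_le (a : G) (h : s ≤ t) : s • S.band a s t ≤ S.J (S.band a s t) a := by
  have h1 := map_nonneg_of_le_upper hS a (band_mem hS a h) (band_le_upper hS a)
  rwa [map_sub, map_rat_smul, S.map_unit _ (band_mem hS a h), sub_nonneg] at h1

theorem le_smul_band (a : G) (h : s ≤ t) : S.J (S.band a s t) a ≤ t • S.band a s t := by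
  have h1 := map_nonpos_of_le_compl_upper hS a (band_mem hS a h) (band_le_compl_upper hS a)
  rwa [map_sub, map_rat_smul, S.map_unit _ (band_mem hS a h), sub_nonpos] at h1

/-- Riemann sums for the spectral resolution. -/
theorem riemann_sum_bounds (ha : 0 ≤ a) (hau : a ≤ u) {m : ℕ} (hm : 0 < m) :
    0 ≤ a - ∑ k ∈ Finset.range m, ((k : ℚ) / m) • S.band a ((k : ℚ) / m) (((k + 1 : ℕ) : ℚ) / m) ∧
    a - ∑ k ∈ Finset.range m, ((k : ℚ) / m) • S.band a ((k : ℚ) / m) (((k + 1 : ℕ) : ℚ) / m) ≤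
      (1 / m : ℚ) • u := by
  have hm' : (0 : ℚ) < m := by exact_mod_cast hm
  have hlt : ∀ k : ℕ, (k : ℚ) / m ≤ ((k + 1 : ℕ) : ℚ) / m := fun k => by
    gcongr; simp
  -- The compressions to the bands telescope: the first endpoint contributes a, since supp a carries
  -- a, and the last contributes 0, since a ≤ u.
  have hsum : a = ∑ k ∈ Finset.range m, S.J (S.band a ((k : ℚ) / m) (((k + 1 : ℕ) : ℚ) / m)) a := by
    have h1 : ∀ k : ℕ, S.J (S.band a ((k : ℚ) / m) (((k + 1 : ℕ) : ℚ) / m)) a =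
        S.J (S.upper a ((k : ℚ) / m)) a - S.J (S.upper a (((k + 1 : ℕ) : ℚ) / m)) a := fun k => by
      simpa using map_band hS a (hlt k) 0
    rw [Finset.sum_congr rfl fun k _ => h1 k,
      Finset.sum_range_sub' (fun k : ℕ => S.J (S.upper a ((k : ℚ) / m)) a), Nat.cast_zero,
      zero_div, upper_zero hS, map_supp_of_nonneg hS ha, div_self hm'.ne', upper_one hS hau,
      eq_zero_of_le' zero_mem ha (by simpa), sub_zero]
  have hband : ∑ k ∈ Finset.range m, S.band a ((k : ℚ) / m) (((k + 1 : ℕ) : ℚ) / m) ≤ u := by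
    unfold band
    rw [Finset.sum_range_sub' (fun k : ℕ => S.upper a ((k : ℚ) / m))]
    exact (sub_le_self _ (mem_nonneg (upper_mem hS _ _))).trans (mem_le (upper_mem hS _ _))
  constructor
  · rw [sub_nonneg]
    conv_rhs => rw [hsum]
    exact Finset.sum_le_sum fun k _ => smul_band_le hS a (hlt k)
  · rw [sub_le_iff_le_add]
    calc a ≤ ∑ k ∈ Finset.range m, (((k + 1 : ℕ) : ℚ) / m) •
          S.band a ((k : ℚ) / m) (((k + 1 : ℕ) : ℚ) / m) := by
          conv_lhs => rw [hsum]
          exact Finset.sum_le_sum fun k _ => le_smul_band hS a (hlt k)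
      _ = (1 / m : ℚ) • ∑ k ∈ Finset.range m, S.band a ((k : ℚ) / m) (((k + 1 : ℕ) : ℚ) / m) +
          ∑ k ∈ Finset.range m, ((k : ℚ) / m) •
            S.band a ((k : ℚ) / m) (((k + 1 : ℕ) : ℚ) / m) := by
          rw [Finset.smul_sum, ← Finset.sum_add_distrib]
          refine Finset.sum_congr rfl fun k _ => ?_
          rw [← add_smul]
          congr 1
          push_cast; ring
      _ ≤ _ := by
          gcongr

/-- Archimedeanity concerns positive elements only. Compressing g ≤ ε u to the support of g shows
that every multiple of its positive part is below u, so this part vanishes; the same for -g kills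
the negative part. -/
theorem eq_zero_of_small (harch : ∀ x : G, 0 ≤ x → (∀ k : ℕ, k • x ≤ u) → x = 0)
    (h : ∀ ε : ℚ, 0 < ε → -(ε • u) ≤ g ∧ g ≤ ε • u) : g = 0 := by
  have key : ∀ g : G, (∀ ε : ℚ, 0 < ε → g ≤ ε • u) → S.J (S.supp g) g = 0 := by
    intro g hg
    refine harch _ (map_supp_nonneg hS g) fun k => ?_
    -- ε = 1/(k+1) also covers k = 0; the surplus summand is positive and is dropped at the end.
    have hk : (0 : ℚ) < k + 1 := by positivity
    have h1 := mono (supp_mem hS g) (hg (1 / (k + 1)) (by positivity))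
    rw [map_rat_smul, S.map_unit _ (supp_mem hS g)] at h1
    have h2 := smul_le_smul_of_nonneg_left h1 hk.le
    rw [smul_smul, mul_one_div_cancel hk.ne', one_smul, add_smul, one_smul,
      Nat.cast_smul_eq_nsmul] at h2
    exact (le_add_of_nonneg_right (map_supp_nonneg hS g)).trans (h2.trans (mem_le (supp_mem hS g)))
  have h1 := key g fun ε hε => (h ε hε).2
  have h2 := key (-g) fun ε hε => neg_le.1 (h ε hε).1
  rw [map_supp_neg hS, neg_eq_zero] at h2
  rw [← com_iff.1 (com_supp_self hS g), h1, h2, add_zero]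

/-- An element commutes with a projection if its spectral projections do. -/
theorem com_of_com_upper (harch : ∀ x : G, 0 ≤ x → (∀ k : ℕ, k • x ≤ u) → x = 0)
    (ha : 0 ≤ a) (hau : a ≤ u) (hq : q ∈ S.P)
    (h : ∀ n k : ℕ, k ≤ 2 ^ n → S.Com q (S.upper a ((k : ℚ) / (2 ^ n : ℕ)))) : S.Com q a := by
  rw [com_iff, ← sub_eq_zero]
  refine eq_zero_of_small hS harch fun ε hε => ?_
  obtain ⟨n, hn⟩ := exists_pow_lt_of_lt_one hε (by norm_num : (1 / 2 : ℚ) < 1)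
  obtain ⟨h0, h1⟩ := riemann_sum_bounds hS ha hau (m := 2 ^ n) (by positivity)
  set s := ∑ k ∈ Finset.range (2 ^ n), ((k : ℚ) / (2 ^ n : ℕ)) •
    S.band a ((k : ℚ) / (2 ^ n : ℕ)) (((k + 1 : ℕ) : ℚ) / (2 ^ n : ℕ)) with hs
  have hcs : S.Com q s := by
    refine Finset.sum_induction _ (S.Com q) (fun _ _ => Com.add) (by simp [com_iff]) ?_
    intro k hk
    have hk := Finset.mem_range.1 hk
    exact ((h n k hk.le).sub (h n (k + 1) hk)).rat_smul _
  have hε' : ((1 : ℚ) / (2 ^ n : ℕ)) • u ≤ ε • u := by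
    refine smul_le_smul_rat S.unit_nonneg (le_trans (le_of_eq ?_) hn.le)
    push_cast; rw [one_div_pow]
  have hq' := S.compl_mem q hq
  -- The Riemann sum s commutes with q, so the commutation defect of a is that of the remainder a -
  -- s, which lies between 0 and 2^{-n} u.
  have e : S.J q a + S.J (u - q) a - a = S.J q (a - s) + S.J (u - q) (a - s) - (a - s) := by
    rw [map_sub, map_sub]
    calc _ = S.J q a + S.J (u - q) a - a + (s - (S.J q s + S.J (u - q) s)) := by
          rw [com_iff.1 hcs, sub_self, add_zero]
      _ = _ := by abel
  rw [e]
  have hle : ∀ p ∈ S.P, S.J p (a - s) ≤ ((1 : ℚ) / (2 ^ n : ℕ)) • p := fun p hp => by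
    have := mono hp h1
    rwa [map_rat_smul, S.map_unit p hp] at this
  constructor
  · calc -(ε • u) ≤ -(((1 : ℚ) / (2 ^ n : ℕ)) • u) := neg_le_neg hε'
      _ ≤ -(a - s) := neg_le_neg h1
      _ ≤ _ := by
        rw [sub_eq_add_neg _ (a - s)]
        exact le_add_of_nonneg_left (add_nonneg (S.map_nonneg q hq _ h0) (S.map_nonneg _ hq' _ h0))
  · calc _ ≤ S.J q (a - s) + S.J (u - q) (a - s) := sub_le_self _ h0
      _ ≤ ((1 : ℚ) / (2 ^ n : ℕ)) • q + ((1 : ℚ) / (2 ^ n : ℕ)) • (u - q) :=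
        add_le_add (hle q hq) (hle _ hq')
      _ = ((1 : ℚ) / (2 ^ n : ℕ)) • u := by rw [← smul_add, add_sub_cancel]
      _ ≤ ε • u := hε'

/-- An element is determined by its spectral projections. -/
theorem eq_of_upper_eq (harch : ∀ x : G, 0 ≤ x → (∀ k : ℕ, k • x ≤ u) → x = 0) {b : G}
    (ha : 0 ≤ a) (hau : a ≤ u) (hb : 0 ≤ b) (hbu : b ≤ u)
    (h : ∀ n k : ℕ, k ≤ 2 ^ n →
      S.upper a ((k : ℚ) / (2 ^ n : ℕ)) = S.upper b ((k : ℚ) / (2 ^ n : ℕ))) : a = b := by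
  rw [← sub_eq_zero]
  refine eq_zero_of_small hS harch fun ε hε => ?_
  obtain ⟨n, hn⟩ := exists_pow_lt_of_lt_one hε (by norm_num : (1 / 2 : ℚ) < 1)
  obtain ⟨h0, h1⟩ := riemann_sum_bounds hS ha hau (m := 2 ^ n) (by positivity)
  obtain ⟨h2, h3⟩ := riemann_sum_bounds hS hb hbu (m := 2 ^ n) (by positivity)
  have e : ∑ k ∈ Finset.range (2 ^ n), ((k : ℚ) / (2 ^ n : ℕ)) •
        S.band a ((k : ℚ) / (2 ^ n : ℕ)) (((k + 1 : ℕ) : ℚ) / (2 ^ n : ℕ)) =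
      ∑ k ∈ Finset.range (2 ^ n), ((k : ℚ) / (2 ^ n : ℕ)) •
        S.band b ((k : ℚ) / (2 ^ n : ℕ)) (((k + 1 : ℕ) : ℚ) / (2 ^ n : ℕ)) := by
    refine Finset.sum_congr rfl fun k hk => ?_
    have hk := Finset.mem_range.1 hk
    rw [band, band, h n k hk.le, h n (k + 1) hk]
  rw [← e] at h2 h3
  have hε' : ((1 : ℚ) / (2 ^ n : ℕ)) • u ≤ ε • u := by
    refine smul_le_smul_rat S.unit_nonneg (le_trans (le_of_eq ?_) hn.le)
    push_cast; rw [one_div_pow]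
  constructor
  · rw [neg_le, neg_sub, ← sub_sub_sub_cancel_right b a
      (∑ k ∈ Finset.range (2 ^ n), ((k : ℚ) / (2 ^ n : ℕ)) •
        S.band a ((k : ℚ) / (2 ^ n : ℕ)) (((k + 1 : ℕ) : ℚ) / (2 ^ n : ℕ)))]
    exact (sub_le_self _ h0).trans (h3.trans hε')
  · rw [← sub_sub_sub_cancel_right a b
      (∑ k ∈ Finset.range (2 ^ n), ((k : ℚ) / (2 ^ n : ℕ)) •
        S.band a ((k : ℚ) / (2 ^ n : ℕ)) (((k + 1 : ℕ) : ℚ) / (2 ^ n : ℕ)))]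
    exact (sub_le_self _ h2).trans (h1.trans hε')

/-- Right continuity of the spectral resolution. -/
theorem le_compl_upper_of_forall (harch : ∀ x : G, 0 ≤ x → (∀ k : ℕ, k • x ≤ u) → x = 0)
    (hq : q ∈ S.P)
    (h : ∀ ε : ℚ, 0 < ε → ∃ t, s < t ∧ t < s + ε ∧ q ≤ u - S.upper a t) :
    q ≤ u - S.upper a s := by
  have hE := upper_mem hS a s
  have hx := map_supp_nonneg hS (a - s • u)
  have h0 : S.J q (S.J (S.upper a s) (a - s • u)) = 0 := by
    refine eq_zero_of_small hS harch fun ε hε => ?_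
    refine ⟨(neg_nonpos.2 (smul_nonneg hε.le S.unit_nonneg)).trans (S.map_nonneg q hq _ hx), ?_⟩
    obtain ⟨t, hst, hts, hqt⟩ := h ε hε
    -- Moving the threshold from s to t < s + ε costs at most ε u in the positive part, by
    -- maximality of the positive part at t. As q annihilates the part at t, only ε u remains.
    have h1 : S.J (S.upper a s) (a - s • u) ≤ S.J (S.upper a t) (a - t • u) + ε • u := by
      have h2 := map_le_map_supp hS hE ((com_upper_self hS a s).sub_smul_unit hE t)
      calc S.J (S.upper a s) (a - s • u)
          = S.J (S.upper a s) (a - t • u) + (t - s) • S.upper a s := by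
            simp only [map_sub, map_rat_smul, S.map_unit _ hE]; module
        _ ≤ _ := add_le_add h2 ((smul_le_smul_of_nonneg_left (mem_le hE) (by linarith)).trans
            (smul_le_smul_rat S.unit_nonneg (by linarith)))
    refine (mono hq h1).trans ?_
    rw [map_add, map_map_of_orth hq (upper_mem hS a t) (le_sub_iff_add_le.1 hqt), zero_add,
      map_rat_smul, S.map_unit q hq]
    exact smul_le_smul_of_nonneg_left (mem_le hq) hε.le
  have h3 : S.upper a s ≤ u - q := by
    rw [upper, supp_le_iff hS (S.compl_mem q hq), sub_sub_cancel]
    exact h0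
  rwa [le_sub_comm] at h3

/-- The positive part of the rescaled element of a band, in terms of the halves of the band. -/
theorem map_supp_split (a : G) {s t N : ℚ} (hN : 0 < N) (ht : t = s + 1 / N) {m : ℚ}
    (hm : m = s + 1 / (2 * N)) {c : G} (hc : c = N • S.J (S.band a s t) (a - s • u)) :
    S.J (S.supp (2 • c - u)) (2 • c - u) = (2 * N) • S.J (S.band a m t) (a - m • u) ∧
    S.supp (2 • c - u) = S.band a m t ∧
    S.J (S.band a s t) (S.J (S.supp (u - 2 • c)) (u - 2 • c)) =
      -((2 * N) • S.J (S.band a s m) (a - m • u)) := by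
  have hmt : m ≤ t := by
    rw [hm, ht]
    have : 1 / (2 * N) ≤ 1 / N := one_div_le_one_div_of_le hN (by linarith)
    linarith
  have hsm : s ≤ m := by rw [hm]; exact le_add_of_nonneg_right (by positivity)
  set g := a - m • u with hg
  set v := S.band a s t with hv
  set p := S.band a m t with hp
  set v₀ := S.band a s m with hv₀
  have hvP : v ∈ S.P := band_mem hS a (hsm.trans hmt)
  have hpP : p ∈ S.P := band_mem hS a hmt
  have hv₀P : v₀ ∈ S.P := band_mem hS a hsm
  have hvp : v = p + v₀ := by simp only [hv, hp, hv₀, band]; abel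
  have hpv : p ≤ v := by rw [hvp]; exact le_add_of_nonneg_right (mem_nonneg hv₀P)
  have hv₀v : v₀ ≤ v := by rw [hvp]; exact le_add_of_nonneg_left (mem_nonneg hpP)
  have hvu : v ≤ u := mem_le hvP
  have hJv : S.J v g = S.J p g + S.J v₀ g := by
    rw [map_eq_add hpP hvP hpv ((com_band_self hS a hmt).sub_smul_unit hpP m), hvp,
      add_sub_cancel_left]
  -- The threshold 1/2 for c corresponds to the midpoint m for a: on v the element 2c - u is 2N(a -
  -- m u), while off v it is -u.
  have hw : 2 • c - u = (2 * N) • S.J p g + (2 * N) • S.J v₀ g - (u - v) := by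
    have h1 : a - s • u = g + (1 / (2 * N)) • u := by rw [hg, hm]; module
    rw [hc, h1, map_add, map_rat_smul, S.map_unit v hvP, hJv, ← Nat.cast_smul_eq_nsmul ℚ, smul_smul,
      smul_add, smul_add, smul_smul, Nat.cast_ofNat, mul_one_div_cancel (by positivity), one_smul]
    abel
  have hpos : 0 ≤ S.J p g := map_nonneg_of_le_upper hS a hpP (band_le_upper hS a)
  have hneg : S.J v₀ g ≤ 0 := map_nonpos_of_le_compl_upper hS a hv₀P (band_le_compl_upper hS a)
  have hpv₀ : p + v₀ ≤ u := hvp ▸ hvu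
  have hJp : S.J p (2 • c - u) = (2 * N) • S.J p g := by
    rw [hw, map_sub, map_add, map_rat_smul, map_rat_smul, S.idem p hpP,
      map_map_of_orth hpP hv₀P hpv₀, map_sub (S.J p) u v, S.map_unit p hpP, map_of_le hpP hvP hpv]
    simp
  have hJp' : S.J (u - p) (2 • c - u) = (2 * N) • S.J v₀ g - (u - v) := by
    have hp' := S.compl_mem p hpP
    rw [hw, map_sub, map_add, map_rat_smul, map_rat_smul, S.compl_map p hpP,
      map_map_of_le' hv₀P hp' (le_sub_iff_add_le'.2 hpv₀),
      eq_of_le' hp' (sub_nonneg.2 hvu) (sub_le_sub_left hpv u), smul_zero, zero_add]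
  have h2N : (0 : ℚ) < 2 * N := by positivity
  have hpos' : 0 ≤ S.J p (2 • c - u) := hJp ▸ smul_nonneg h2N.le hpos
  have hmain := map_eq_map_supp hS hpP
    (show S.J p (2 • c - u) + S.J (u - p) (2 • c - u) = _ by
      rw [hJp, hJp']; conv_rhs => rw [hw]
      abel)
    (by
      rw [hJp']
      exact sub_nonpos.2 ((smul_nonpos_of_nonneg_of_nonpos h2N.le hneg).trans
        (sub_nonneg.2 hvu))) hpos'
  rw [hJp] at hmain
  -- The nontrivial inclusion: if f carries the positive part on p, then f + e_t carries the
  -- positive part of a - m u and so dominates e_m, where p = e_m - e_t.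
  have hsupp : S.supp (2 • c - u) = p := by
    set f := S.supp (2 • c - u) with hf
    have hfP : f ∈ S.P := supp_mem hS _
    have hfp : f ≤ p := by
      rw [hf, supp_le_iff hS hpP, ← hf, ← hmain, map_rat_smul, S.compl_map p hpP, smul_zero]
    refine le_antisymm hfp ?_
    have h1 := (supp_le_iff hS hfP).1 (show S.supp (2 • c - u) ≤ f from le_rfl)
    rw [← hf, ← hmain, map_rat_smul, smul_eq_zero_iff_right h2N.ne'] at h1
    have hE := upper_mem hS a t
    have hsum : f + S.upper a t ≤ S.upper a m := le_sub_iff_add_le.1 hfp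
    have hF := S.add_mem f hfP _ hE (hsum.trans (mem_le (upper_mem hS a m)))
    have h2 : S.upper a m ≤ f + S.upper a t := by
      rw [upper, supp_le_iff hS hF]
      have h3 : S.J (S.upper a m) g = S.J p g + S.J (S.upper a t) g := by
        rw [hp, hg, map_band hS a hmt, sub_add_cancel]
      have h4 := S.compl_mem _ hF
      rw [← upper, ← hg, h3, map_add, ← eq_of_compl_eq_zero hfP hpos h1,
        map_map_of_orth h4 hfP (by
          rw [sub_add_eq_add_sub, sub_le_iff_le_add]
          exact add_le_add_right (le_add_of_nonneg_right (mem_nonneg hE)) u),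
        map_map_of_orth h4 hE (by
          rw [sub_add_eq_add_sub, sub_le_iff_le_add]
          exact add_le_add_right (le_add_of_nonneg_left (mem_nonneg hfP)) u), add_zero]
    exact sub_le_iff_le_add.2 h2
  refine ⟨hmain.symm, hsupp, ?_⟩
  rw [← neg_sub (2 • c) u, map_supp_neg hS, hsupp, hJp', map_neg, map_sub, map_rat_smul,
    map_map_of_le' hv₀P hvP hv₀v, map_sub (S.J v) u v, S.map_unit v hvP, map_self hvP, sub_self,
    sub_zero]

end Resolution

end CompressionSystem

end EffectAlgebra

namespace EffectAlgebra

/-! ### Arithmetic of the unit interval and rational scalars -/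

section UnitInterval

variable {E : Type v} [EffectAlgebra E] {G : Type v} [AddCommGroup G] [PartialOrder G]
  {ι : E → G} {u : G}

namespace IsUnitInterval

variable (hG : IsUnitInterval ι u) {a b c : E} {g : G}
include hG

theorem map_nonneg (a : E) : 0 ≤ ι a := (hG.range_eq ▸ Set.mem_range_self a : ι a ∈ Set.Icc 0 u).1

theorem map_le (a : E) : ι a ≤ u := (hG.range_eq ▸ Set.mem_range_self a : ι a ∈ Set.Icc 0 u).2

theorem exists_eq (h0 : 0 ≤ g) (hu : g ≤ u) : ∃ a, ι a = g := by
  have : g ∈ Set.range ι := by rw [hG.range_eq]; exact ⟨h0, hu⟩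
  exact this

theorem map_zero : ι 0 = 0 := by
  simpa using (hG.oplus_iff 0 0 0).1 (oplus_zero 0)

theorem map_compl (a : E) : ι (compl a) = u - ι a := by
  rw [eq_sub_iff_add_eq', (hG.oplus_iff _ _ _).1 (oplus_compl a), hG.map_one]

variable [IsOrderedAddMonoid G]

theorem map_le_map_iff : ι a ≤ ι b ↔ a ≤ b := by
  constructor
  · intro h
    obtain ⟨c, hc⟩ := hG.exists_eq (sub_nonneg.2 h) ((sub_le_self _ (hG.map_nonneg a)).trans
      (hG.map_le b))
    exact ⟨c, (hG.oplus_iff _ _ _).2 (by rw [hc, add_sub_cancel])⟩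
  · rintro ⟨c, hc⟩
    rw [← (hG.oplus_iff _ _ _).1 hc]
    exact le_add_of_nonneg_right (hG.map_nonneg c)

theorem map_osub (h : a ≤ b) : ι (osub b a) = ι b - ι a := by
  have h' : ∃ c, oplus a c = some b := h
  rw [osub, dif_pos h', eq_sub_iff_add_eq', (hG.oplus_iff _ _ _).1 h'.choose_spec]

theorem osum_eq_some_iff (l : List E) (c : E) : osum l = some c ↔ (l.map ι).sum = ι c := by
  induction l generalizing c with
  | nil => simp [osum, ← hG.map_zero, hG.injective.eq_iff]
  | cons a l ih =>
    rw [osum, Option.bind_eq_some_iff, List.map_cons, List.sum_cons]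
    constructor
    · rintro ⟨d, hd, hc⟩
      rw [(ih d).1 hd, (hG.oplus_iff _ _ _).1 hc]
    · intro h
      have h0 : 0 ≤ (l.map ι).sum := List.sum_nonneg (by simp [hG.map_nonneg])
      obtain ⟨d, hd⟩ := hG.exists_eq h0
        (((le_add_of_nonneg_left (hG.map_nonneg a)).trans_eq h).trans (hG.map_le c))
      exact ⟨d, (ih d).2 hd.symm, (hG.oplus_iff _ _ _).2 (by rw [hd, h])⟩

theorem nmul_eq_some_iff (n : ℕ) : nmul n a = some c ↔ n • ι a = ι c := by
  rw [nmul, hG.osum_eq_some_iff]; simp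

theorem eq_zero_of_forall_nsmul_le (harch : IsArchimedean E) (h0 : 0 ≤ g)
    (h : ∀ k : ℕ, k • g ≤ u) : g = 0 := by
  obtain ⟨a, rfl⟩ := hG.exists_eq h0 (by simpa using h 1)
  rw [harch a fun n => ?_, hG.map_zero]
  obtain ⟨c, hc⟩ := hG.exists_eq (nsmul_nonneg h0 n) (h n)
  rw [(hG.nmul_eq_some_iff n).2 hc.symm]
  rfl

end IsUnitInterval

namespace IsUniversalGroup

variable (hG : IsUniversalGroup ι u)
include hG

theorem hom_ext {f f' : G →+ G} (h : ∀ a, f (ι a) = f' (ι a)) : f = f' := by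
  obtain ⟨k, -, hk⟩ := hG.existsUnique_lift G (fun a => f (ι a)) fun a b c habc => by
    rw [← (hG.oplus_iff _ _ _).1 habc, map_add]
  rw [hk f fun _ => rfl, hk f' fun a => (h a).symm]

theorem nonneg_induction {Q : (g : G) → Prop} (hι : ∀ a, Q (ι a))
    (hadd : ∀ x y, 0 ≤ x → 0 ≤ y → Q x → Q y → Q (x + y)) {g : G} (hg : 0 ≤ g) : Q g := by
  rw [hG.nonneg_iff] at hg
  induction hg using AddSubmonoid.closure_induction with
  | mem z hz => obtain ⟨a, rfl⟩ := hz; exact hι a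
  | zero => rw [← hG.map_zero]; exact hι 0
  | add x y hx hy h1 h2 => exact hadd x y ((hG.nonneg_iff x).2 hx) ((hG.nonneg_iff y).2 hy) h1 h2

variable [IsOrderedAddMonoid G]

/-- Division by a positive integer in the universal group of a divisible effect algebra. -/
theorem exists_div (hdiv : IsDivisible E) {n : ℕ} (hn : 0 < n) :
    ∃ d : G →+ G, (∀ g, n • d g = g) ∧ ∀ g, 0 ≤ g → 0 ≤ d g := by
  choose x hx hx' using fun a => hdiv a n hn
  have hx1 : ∀ a, n • ι (x a) = ι a := fun a => (hG.nmul_eq_some_iff n).1 (hx a)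
  obtain ⟨d, hd, -⟩ := hG.existsUnique_lift G (fun a => ι (x a)) fun a b c h => by
    have h1 : n • (ι (x a) + ι (x b)) = ι c := by
      rw [smul_add, hx1, hx1, (hG.oplus_iff _ _ _).1 h]
    have h0 := add_nonneg (hG.map_nonneg (x a)) (hG.map_nonneg (x b))
    -- The sum of the n-th parts of a and b lies below its own n-fold multiple ι c, hence comes from
    -- E; uniqueness of division identifies it with the n-th part of c.
    obtain ⟨y, hy⟩ := hG.exists_eq h0
      (((le_self_nsmul h0 hn.ne').trans_eq h1).trans (hG.map_le c))
    rw [← hy, ← hx' c y ((hG.nmul_eq_some_iff n).2 (by rw [hy, h1]))]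
  refine ⟨d, fun g => ?_, fun g hg => ?_⟩
  · have : n • d = AddMonoidHom.id G := hG.hom_ext fun a => by
      rw [AddMonoidHom.nsmul_apply, hd, hx1, AddMonoidHom.id_apply]
    exact DFunLike.congr_fun this g
  · refine hG.nonneg_induction (Q := fun g => 0 ≤ d g) (fun a => ?_) (fun x y _ _ h1 h2 => ?_) hg
    · rw [hd]; exact hG.map_nonneg _
    · rw [map_add]; exact add_nonneg h1 h2

theorem nsmul_right_injective (hdiv : IsDivisible E) {n : ℕ} (hn : 0 < n) :
    Function.Injective fun g : G => n • g := by
  obtain ⟨d, hd, -⟩ := hG.exists_div hdiv hn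
  intro x y h
  rw [← hd x, ← hd y, ← map_nsmul, ← map_nsmul]
  exact congrArg d h

/-- The universal group of a divisible effect algebra is a rational vector space. -/
noncomputable abbrev ratModule (hdiv : IsDivisible E) : Module ℚ G :=
  let d := fun q : ℚ => (hG.exists_div hdiv q.den_pos).choose
  have hd : ∀ (q : ℚ) g, (q.den : ℤ) • d q g = g := fun q g => by
    rw [natCast_zsmul]; exact (hG.exists_div hdiv q.den_pos).choose_spec.1 g
  -- The axioms mixing several denominators are verified after clearing them, which loses nothing
  -- because multiplication by a positive integer is injective.
  have inj : ∀ {n : ℤ} (_ : 0 < n) {x y : G}, n • x = n • y → x = y := by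
    intro n hn x y h
    lift n to ℕ using hn.le
    rw [natCast_zsmul, natCast_zsmul] at h
    exact hG.nsmul_right_injective hdiv (by exact_mod_cast hn) h
  have pos : ∀ q : ℚ, 0 < (q.den : ℤ) := fun q => by exact_mod_cast q.den_pos
  have hden : ∀ (q : ℚ) (m : ℤ) g, (m * q.den) • q.num • d q g = (m * q.num) • g := fun q m g => by
    conv_rhs => rw [← hd q g]
    rw [smul_smul, smul_smul]
    congr 1; ring
  { smul := fun q g => q.num • d q g
    one_smul := fun g => inj (pos 1) (by
      change _ • (1 : ℚ).num • d 1 g = _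
      simpa using hden 1 1 g)
    mul_smul := fun q r g => inj (mul_pos (mul_pos (pos q) (pos r)) (pos (q * r))) (by
      change _ • (q * r).num • d (q * r) g = _ • q.num • d q (r.num • d r g)
      have h1 := hden q (r.den * (q * r).den) (r.num • d r g)
      have h2 := hden r (q.num * (q * r).den) g
      rw [hden, show (q.den * r.den * (q * r).den : ℤ) = r.den * (q * r).den * q.den by ring, h1,
        show (r.den * (q * r).den * q.num : ℤ) = q.num * (q * r).den * r.den by ring, h2]
      congr 1
      have := Rat.mul_num_den' q r
      linear_combination this)
    smul_zero := fun q => by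
      change q.num • d q 0 = 0
      rw [_root_.map_zero, smul_zero]
    smul_add := fun q x y => by
      change q.num • d q (x + y) = q.num • d q x + q.num • d q y
      rw [map_add, smul_add]
    add_smul := fun q r g => inj (mul_pos (mul_pos (pos q) (pos r)) (pos (q + r))) (by
      change _ • (q + r).num • d (q + r) g = _ • (q.num • d q g + r.num • d r g)
      have h1 := hden q (r.den * (q + r).den) g
      have h2 := hden r (q.den * (q + r).den) g
      rw [hden, smul_add,
        show (q.den * r.den * (q + r).den : ℤ) = r.den * (q + r).den * q.den by ring, h1,
        show (r.den * (q + r).den * q.den : ℤ) = q.den * (q + r).den * r.den by ring, h2,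
        ← add_smul]
      congr 1
      have := Rat.add_num_den' q r
      linear_combination this)
    zero_smul := fun g => by
      change (0 : ℚ).num • d 0 g = 0
      simp }

theorem posSMulMono (hdiv : IsDivisible E) [Module ℚ G] : PosSMulMono ℚ G := by
  refine PosSMulMono.of_smul_nonneg fun q hq g hg => ?_
  obtain ⟨d, hd, hd'⟩ := hG.exists_div hdiv q.den_pos
  have : q • g = q.num.toNat • d g := by
    have hqn : ((q.num.toNat : ℕ) : ℤ) = q.num := Int.toNat_of_nonneg (Rat.num_nonneg.2 hq)
    have hq' : q = q.num.toNat / q.den := by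
      conv_lhs => rw [← Rat.num_div_den q, ← hqn, Int.cast_natCast]
    calc q • g = (q.num.toNat / q.den : ℚ) • q.den • d g := by rw [← hq', hd]
      _ = _ := ?_
    rw [← Nat.cast_smul_eq_nsmul ℚ q.den, smul_smul,
      div_mul_cancel₀ _ (by exact_mod_cast q.den_ne_zero), Nat.cast_smul_eq_nsmul]
  rw [this]
  exact nsmul_nonneg (hd' g hg) _

end IsUniversalGroup

end UnitInterval

end EffectAlgebra

/-! ### From a compression base on E to a compression system on G -/

namespace EffectAlgebra

variable {E : Type v} [EffectAlgebra E] {G : Type v} [AddCommGroup G] [PartialOrder G]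
  [IsOrderedAddMonoid G] {ι : E → G} {u : G}

theorem IsMeetIn.unique {P : Set E} {p q m n : E} (hm : IsMeetIn P p q m)
    (hn : IsMeetIn P p q n) : m = n :=
  le_antisymm (hn.2.2.2 m hm.1 hm.2.1 hm.2.2.1) (hm.2.2.2 n hn.1 hn.2.1 hn.2.2.1)

theorem IsJoinIn.unique {P : Set E} {p q m n : E} (hm : IsJoinIn P p q m)
    (hn : IsJoinIn P p q n) : m = n :=
  le_antisymm (hm.2.2.2 n hn.1 hn.2.1 hn.2.2.1) (hn.2.2.2 m hm.1 hm.2.1 hm.2.2.1)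

theorem IsUnitInterval.compl_le_compl_iff (hG : IsUnitInterval ι u) {a b : E} :
    compl a ≤ compl b ↔ b ≤ a := by
  rw [← hG.map_le_map_iff, hG.map_compl, hG.map_compl, sub_le_sub_iff_left, hG.map_le_map_iff]

namespace CompressionBase

theorem extend_restrict (cb : CompressionBase E) (hG : IsUniversalGroup ι u) {p : E}
    (hp : p ∈ cb.P) (a : E) : (cb.extend hG).J p (ι a) = ι (cb.J p a) :=
  (cb.extend hG).restrict p hp a

theorem extend_nonneg (cb : CompressionBase E) (hG : IsUniversalGroup ι u) {p : E}
    (hp : p ∈ cb.P) {g : G} (hg : 0 ≤ g) : 0 ≤ (cb.extend hG).J p g := by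
  simpa using (cb.extend hG).mono p hp hg

theorem map_le_focus (cb : CompressionBase E) {p : E} (hp : p ∈ cb.P) (a : E) : cb.J p a ≤ p := by
  obtain ⟨c, hc⟩ : ∃ c, oplus a c = some 1 := ⟨_, oplus_compl a⟩
  exact ⟨cb.J p c, by rw [(cb.isCompression p hp).additive _ _ _ hc, cb.focus p hp]⟩

theorem map_eq_self (cb : CompressionBase E) {p : E} (hp : p ∈ cb.P) {a : E} (h : a ≤ p) :
    cb.J p a = a :=
  (cb.isCompression p hp).eq_self a (by rwa [cb.focus p hp])

theorem map_eq_zero_iff (cb : CompressionBase E) {p : E} (hp : p ∈ cb.P) {a : E} :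
    cb.J p a = 0 ↔ a ≤ compl p := by
  rw [(cb.isCompression p hp).eq_zero_iff, cb.focus p hp]

/-- The compression system on the universal group that extends a compression base. -/
noncomputable def system (cb : CompressionBase E) (hG : IsUniversalGroup ι u) :
    CompressionSystem G u :=
  have hJ : ∀ p, Function.extend ι (cb.extend hG).J 0 (ι p) = (cb.extend hG).J p := fun p =>
    hG.injective.extend_apply _ _ p
  { P := ι '' cb.P
    J := Function.extend ι (cb.extend hG).J 0
    unit_mem := ⟨1, cb.isSub.one_mem, hG.map_one⟩
    compl_mem := by
      rintro _ ⟨p, hp, rfl⟩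
      exact ⟨compl p, cb.isSub.compl_mem p hp, hG.map_compl p⟩
    add_mem := by
      rintro _ ⟨p, hp, rfl⟩ _ ⟨q, hq, rfl⟩ h
      obtain ⟨r, hr⟩ := hG.exists_eq (add_nonneg (hG.map_nonneg p) (hG.map_nonneg q)) h
      exact ⟨r, cb.isSub.oplus_mem p hp q hq r ((hG.oplus_iff _ _ _).2 hr.symm), hr⟩
    map_nonneg := by
      rintro _ ⟨p, hp, rfl⟩ g hg
      rw [hJ]
      exact cb.extend_nonneg hG hp hg
    map_unit := by
      rintro _ ⟨p, hp, rfl⟩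
      have h := cb.extend_restrict hG hp 1
      rwa [hG.map_one, cb.focus p hp, ← hJ] at h
    idem := by
      rintro _ ⟨p, hp, rfl⟩ g
      have : ((cb.extend hG).J p).comp ((cb.extend hG).J p) = (cb.extend hG).J p :=
        hG.hom_ext fun a => by
          rw [AddMonoidHom.comp_apply, cb.extend_restrict hG hp, cb.extend_restrict hG hp,
            cb.map_eq_self hp (cb.map_le_focus hp a)]
      rw [hJ]
      exact DFunLike.congr_fun this g
    compl_map := by
      rintro _ ⟨p, hp, rfl⟩ g
      have hp' := cb.isSub.compl_mem p hp
      have : ((cb.extend hG).J (compl p)).comp ((cb.extend hG).J p) = 0 :=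
        hG.hom_ext fun a => by
          rw [AddMonoidHom.comp_apply, cb.extend_restrict hG hp, cb.extend_restrict hG hp',
            (cb.map_eq_zero_iff hp').2 (by rw [compl_compl]; exact cb.map_le_focus hp a),
            hG.map_zero, AddMonoidHom.zero_apply]
      rw [← hG.map_compl, hJ, hJ]
      exact DFunLike.congr_fun this g
    map_compl_of_eq_zero := by
      rintro _ ⟨p, hp, rfl⟩ g hg
      have hp' := cb.isSub.compl_mem p hp
      rw [← hG.map_compl, hJ, hJ]
      -- The implication passes to sums because J_p x and J_p y are both positive, so J_p(x + y) = 0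
      -- makes each of them vanish.
      refine hG.nonneg_induction (Q := fun g => (cb.extend hG).J p g = 0 →
        (cb.extend hG).J (compl p) g = g) (fun a h => ?_) (fun x y hx hy h1 h2 h => ?_) hg
      · rw [cb.extend_restrict hG hp, ← hG.map_zero, hG.injective.eq_iff,
          cb.map_eq_zero_iff hp] at h
        rw [cb.extend_restrict hG hp', cb.map_eq_self hp' h]
      · rw [map_add] at h ⊢
        have hx' := cb.extend_nonneg hG hp hx
        have hy' := cb.extend_nonneg hG hp hy
        obtain ⟨e1, e2⟩ := (add_eq_zero_iff_of_nonneg hx' hy').1 h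
        rw [h1 e1, h2 e2]
    unit_nonneg := hG.zero_le
    order_unit := hG.order_unit
    comp := by
      rintro _ ⟨p, hp, rfl⟩ _ ⟨q, hq, rfl⟩ a b c ha hb hc hpac hqbc h
      obtain ⟨a, rfl⟩ := hG.exists_eq ha
        ((le_add_of_nonneg_right hc).trans (hpac.symm.trans_le (hG.map_le p)))
      obtain ⟨b, rfl⟩ := hG.exists_eq hb
        ((le_add_of_nonneg_right hc).trans (hqbc.symm.trans_le (hG.map_le q)))
      obtain ⟨c, rfl⟩ := hG.exists_eq hc
        ((le_add_of_nonneg_left ha).trans (hpac.symm.trans_le (hG.map_le p)))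
      obtain ⟨s, hs⟩ := hG.exists_eq (add_nonneg (add_nonneg ha hb) hc) h
      obtain ⟨d, hd⟩ := hG.exists_eq (add_nonneg ha hb) ((le_add_of_nonneg_right hc).trans h)
      obtain ⟨r, hr, hpq⟩ := cb.comp p hp q hq ⟨a, b, c, (hG.oplus_iff _ _ _).2 hpac.symm,
        (hG.oplus_iff _ _ _).2 hqbc.symm, d, (hG.oplus_iff _ _ _).2 hd.symm, by
          rw [(hG.oplus_iff d c s).2 (by rw [hd, hs])]; rfl⟩
      refine ⟨ι r, ⟨r, hr, rfl⟩, fun g => ?_⟩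
      have : ((cb.extend hG).J p).comp ((cb.extend hG).J q) = (cb.extend hG).J r :=
        hG.hom_ext fun a => by
          rw [AddMonoidHom.comp_apply, cb.extend_restrict hG hq, cb.extend_restrict hG hp,
            cb.extend_restrict hG hr, hpq]
      rw [hJ, hJ, hJ]
      exact DFunLike.congr_fun this g }

variable (cb : CompressionBase E) (hG : IsUniversalGroup ι u) {p q r a b : E} {g x : G}

theorem system_J (p : E) : (cb.system hG).J (ι p) = (cb.extend hG).J p :=
  hG.injective.extend_apply _ _ p

theorem system_J_apply (hp : p ∈ cb.P) (a : E) : (cb.system hG).J (ι p) (ι a) = ι (cb.J p a) := by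
  rw [system_J, cb.extend_restrict hG hp]

theorem system_J_compl_apply (hp : p ∈ cb.P) (a : E) :
    (cb.system hG).J (u - ι p) (ι a) = ι (cb.J (compl p) a) := by
  rw [← hG.map_compl, system_J_apply cb hG (cb.isSub.compl_mem p hp)]

theorem map_mem_system (hp : p ∈ cb.P) : ι p ∈ (cb.system hG).P := ⟨p, hp, rfl⟩

theorem map_mem_system_iff : ι p ∈ (cb.system hG).P ↔ p ∈ cb.P := hG.injective.mem_set_image

theorem mem_C_iff (hp : p ∈ cb.P) : a ∈ cb.C p ↔ (cb.system hG).Com (ι p) (ι a) := by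
  rw [CompressionSystem.com_iff, system_J_apply cb hG hp, system_J_compl_apply cb hG hp,
    ← hG.oplus_iff]
  rfl

theorem mem_extend_C_iff (p : E) : g ∈ (cb.extend hG).C p ↔ (cb.system hG).Com (ι p) g := by
  rw [CompressionSystem.com_iff, ← hG.map_compl, system_J, system_J, eq_comm]
  rfl

/-- If p = a + c and q = b + c, then J_q kills a ≤ u - q and fixes c ≤ q, so J_q p = c ≤ p.
Conversely, commutation provides the decomposition with common part J_p q. -/
theorem mackey_iff (hp : p ∈ cb.P) (hq : q ∈ cb.P) :
    Mackey p q ↔ (cb.system hG).Com (ι p) (ι q) := by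
  have hp' := map_mem_system cb hG hp
  have hq' := map_mem_system cb hG hq
  constructor
  · rintro ⟨a, b, c, hac, hbc, d, hab, hdc⟩
    obtain ⟨s, hs⟩ := Option.isSome_iff_exists.1 hdc
    rw [hG.oplus_iff] at hac hbc hab hs
    apply CompressionSystem.Com.symm hq' hp'
    have hcq : ι c ≤ ι q := by rw [← hbc]; exact le_add_of_nonneg_left (hG.map_nonneg b)
    have hcp : ι c ≤ ι p := by rw [← hac]; exact le_add_of_nonneg_left (hG.map_nonneg a)
    have haq : ι a ≤ u - ι q := by
      rw [le_sub_iff_add_le, ← hbc, ← add_assoc, hab, hs]; exact hG.map_le s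
    refine CompressionSystem.com_of_map_le hq' ?_
    conv_lhs => rw [← hac]
    rw [map_add, CompressionSystem.eq_zero_of_le' hq' (hG.map_nonneg a) haq,
      CompressionSystem.eq_of_le' hq' (hG.map_nonneg c) hcq, zero_add]
    exact hcp
  · intro h
    have hpc := cb.isSub.compl_mem p hp
    have h1 : ι (cb.J p q) + ι (cb.J (compl p) q) = ι q := by
      rw [← system_J_apply cb hG hp, ← system_J_compl_apply cb hG hp]; exact h
    have hle : cb.J p q ≤ p := cb.map_le_focus hp q
    have hle' : ι (cb.J (compl p) q) ≤ u - ι p := by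
      rw [← hG.map_compl, hG.map_le_map_iff]; exact cb.map_le_focus hpc q
    have hsum : ι (osub p (cb.J p q)) + ι (cb.J (compl p) q) ≤ u := by
      rw [hG.map_osub hle]
      calc _ ≤ ι p + (u - ι p) := add_le_add (sub_le_self _ (hG.map_nonneg _)) hle'
        _ = u := add_sub_cancel _ _
    obtain ⟨d, hd⟩ := hG.exists_eq (add_nonneg (hG.map_nonneg _) (hG.map_nonneg _)) hsum
    have hds : ι d + ι (cb.J p q) ≤ u := by
      rw [hd, hG.map_osub hle]
      calc _ = ι p + ι (cb.J (compl p) q) := by abel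
        _ ≤ ι p + (u - ι p) := by gcongr
        _ = u := add_sub_cancel _ _
    obtain ⟨s, hs⟩ := hG.exists_eq (add_nonneg (hG.map_nonneg _) (hG.map_nonneg _)) hds
    refine ⟨osub p (cb.J p q), cb.J (compl p) q, cb.J p q, ?_, ?_, d, ?_, ?_⟩
    · rw [hG.oplus_iff, hG.map_osub hle, sub_add_cancel]
    · rw [hG.oplus_iff, add_comm, h1]
    · rw [hG.oplus_iff, hd]
    · rw [(hG.oplus_iff _ _ s).2 hs.symm]; rfl

/-- Symmetry of commutation between projections brings the bicommutant into the form in which it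
occurs in comparability on G. -/
theorem mem_bicomm_iff (A : Set E) : p ∈ cb.bicomm A ↔ p ∈ cb.P ∧
    (∀ a ∈ A, (cb.system hG).Com (ι p) (ι a)) ∧
    ∀ q ∈ cb.P, (∀ a ∈ A, (cb.system hG).Com (ι q) (ι a)) → (cb.system hG).Com (ι q) (ι p) := by
  constructor
  · rintro ⟨hp, h⟩
    refine ⟨hp, fun a ha => (mem_C_iff cb hG hp).1 (h a (Or.inr ha)), fun q hq hqA => ?_⟩
    have := (mem_C_iff cb hG hp).1
      (h q (Or.inl ⟨hq, fun a ha => (mem_C_iff cb hG hq).2 (hqA a ha)⟩))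
    exact this.symm (map_mem_system cb hG hp) (map_mem_system cb hG hq)
  · rintro ⟨hp, h1, h2⟩
    refine ⟨hp, ?_⟩
    rintro x (⟨hx, hxA⟩ | hx)
    · rw [mem_C_iff cb hG hp]
      exact (h2 x hx fun a ha => (mem_C_iff cb hG hx).1 (hxA a ha)).symm
        (map_mem_system cb hG hx) (map_mem_system cb hG hp)
    · exact (mem_C_iff cb hG hp).2 (h1 x hx)

/-- The meet of commuting projections. -/
theorem isMeetIn_of_com (hp : p ∈ cb.P) (hq : q ∈ cb.P)
    (h : (cb.system hG).Com (ι p) (ι q)) : IsMeetIn cb.P p q (cb.J p q) := by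
  have hp' := map_mem_system cb hG hp
  have hq' := map_mem_system cb hG hq
  refine ⟨?_, cb.map_le_focus hp q, ?_, fun x _ hxp hxq => ?_⟩
  · rw [← map_mem_system_iff cb hG, ← system_J_apply cb hG hp]
    exact (h.comp hp' hq').1
  · rw [← hG.map_le_map_iff, ← system_J_apply cb hG hp]
    exact h.map_le hp' (hG.map_nonneg q)
  · rw [← hG.map_le_map_iff, ← system_J_apply cb hG hp]
    exact CompressionSystem.le_meet hp' (hG.map_nonneg x) (hG.map_le_map_iff.2 hxp)
      (hG.map_le_map_iff.2 hxq)

/-- The join of commuting projections. -/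
theorem isJoinIn_of_com (hp : p ∈ cb.P) (hq : q ∈ cb.P)
    (h : (cb.system hG).Com (ι p) (ι q)) :
    IsJoinIn cb.P p q (compl (cb.J (compl p) (compl q))) := by
  have hp' := cb.isSub.compl_mem p hp
  have hq' := cb.isSub.compl_mem q hq
  have hc : (cb.system hG).Com (ι (compl p)) (ι (compl q)) := by
    rw [hG.map_compl, hG.map_compl]
    exact ((CompressionSystem.com_unit (map_mem_system cb hG hp)).sub h).compl
  obtain ⟨h1, h2, h3, h4⟩ := isMeetIn_of_com cb hG hp' hq' hc
  refine ⟨cb.isSub.compl_mem _ h1, ?_, ?_, fun x hx hpx hqx => ?_⟩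
  · rwa [← hG.compl_le_compl_iff, compl_compl]
  · rwa [← hG.compl_le_compl_iff, compl_compl]
  · rw [← hG.compl_le_compl_iff, compl_compl]
    exact h4 _ (cb.isSub.compl_mem x hx) (hG.compl_le_compl_iff.2 hpx)
      (hG.compl_le_compl_iff.2 hqx)

/-- The upper bound property is formal. For minimality, m = m₁ + J_{u-q} m₂ with second summand
below m₂; a projection x above m₁ and m₂ then has J_{u-x} m = 0, and no commutation of x is needed.
-/
theorem distrib_of_com (hp : p ∈ cb.P) (hq : q ∈ cb.P) (hr : r ∈ cb.P)
    (hpq : (cb.system hG).Com (ι p) (ι q)) (hpr : (cb.system hG).Com (ι p) (ι r))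
    (hqr : (cb.system hG).Com (ι q) (ι r)) {j m m₁ m₂ : E} (hj : IsJoinIn cb.P q r j)
    (hm : IsMeetIn cb.P p j m) (h₁ : IsMeetIn cb.P p q m₁) (h₂ : IsMeetIn cb.P p r m₂) :
    IsJoinIn cb.P m₁ m₂ m := by
  refine ⟨hm.1, hm.2.2.2 _ h₁.1 h₁.2.1 (h₁.2.2.1.trans hj.2.1),
    hm.2.2.2 _ h₂.1 h₂.2.1 (h₂.2.2.1.trans hj.2.2.1), fun x hx h1x h2x => ?_⟩
  set S := cb.system hG with hS
  have hp' := map_mem_system cb hG hp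
  have hq' := map_mem_system cb hG hq
  have hr' := map_mem_system cb hG hr
  have hx' := map_mem_system cb hG hx
  have hqc := S.compl_mem _ hq'
  have e1 : ι m₁ = S.J (ι p) (ι q) := by
    rw [h₁.unique (isMeetIn_of_com cb hG hp hq hpq), ← system_J_apply cb hG hp]
  have e2 : ι m₂ = S.J (ι p) (ι r) := by
    rw [h₂.unique (isMeetIn_of_com cb hG hp hr hpr), ← system_J_apply cb hG hp]
  have ej : ι j = ι q + S.J (u - ι q) (ι r) := by
    rw [hj.unique (isJoinIn_of_com cb hG hq hr hqr), hG.map_compl,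
      ← system_J_compl_apply cb hG hq, hG.map_compl, map_sub, S.map_unit _ hqc]
    abel
  have hpqc : S.Com (ι p) (u - ι q) := (CompressionSystem.com_unit hp').sub hpq
  have hrqc : S.Com (u - ι q) (ι r) := hqr.compl
  have hqcp := hpqc.symm hp' hqc
  have hpj : S.Com (ι p) (ι j) := by
    rw [ej]
    exact hpq.add (hpqc.map hqc hp' hpr)
  have em : ι m = ι m₁ + S.J (u - ι q) (ι m₂) := by
    rw [hm.unique (isMeetIn_of_com cb hG hp hj.1 hpj), ← system_J_apply cb hG hp, ← hS, ej,
      map_add, e1, e2, hpqc.map_comm hp' hqc]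
  have hle : S.J (u - ι q) (ι m₂) ≤ ι m₂ := by
    refine CompressionSystem.Com.map_le hqc (hG.map_nonneg _) ?_
    rw [e2]
    exact hqcp.map hp' hqc hrqc
  rw [← hG.map_le_map_iff, CompressionSystem.le_iff_compl_eq_zero hx' (hG.map_nonneg _)
    (hG.map_le _), em, map_add,
    (CompressionSystem.le_iff_compl_eq_zero hx' (hG.map_nonneg _) (hG.map_le _)).1
      (hG.map_le_map_iff.2 h1x), zero_add]
  exact CompressionSystem.compl_eq_zero_of_le (n := 1) hx' (S.map_nonneg _ hqc _ (hG.map_nonneg _))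
    (by rw [one_smul]; exact hle.trans (hG.map_le_map_iff.2 h2x))

include hG in
/-- Bicommutants are Boolean subalgebras. -/
theorem isBooleanSubalgebra_bicomm (a : E) : IsBooleanSubalgebra cb.P (cb.bicomm {a}) := by
  set S := cb.system hG with hS
  have hmem : ∀ p, p ∈ cb.bicomm {a} ↔ p ∈ cb.P ∧ S.Com (ι p) (ι a) ∧
      ∀ q ∈ cb.P, S.Com (ι q) (ι a) → S.Com (ι q) (ι p) := fun p => by
    simpa using mem_bicomm_iff cb hG (p := p) {a}
  have hcom : ∀ p ∈ cb.bicomm {a}, ∀ q ∈ cb.bicomm {a}, S.Com (ι p) (ι q) := fun p hp q hq =>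
    ((hmem q).1 hq).2.2 p ((hmem p).1 hp).1 ((hmem p).1 hp).2.1
  have hcompl : ∀ p ∈ cb.bicomm {a}, compl p ∈ cb.bicomm {a} := by
    intro p hp
    rw [hmem] at hp ⊢
    rw [hG.map_compl]
    exact ⟨cb.isSub.compl_mem p hp.1, hp.2.1.compl, fun q hq hqa =>
      (CompressionSystem.com_unit (map_mem_system cb hG hq)).sub (hp.2.2 q hq hqa)⟩
  have hmeet : ∀ p ∈ cb.bicomm {a}, ∀ q ∈ cb.bicomm {a}, cb.J p q ∈ cb.bicomm {a} := by
    intro p hp q hq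
    have hpq := hcom p hp q hq
    rw [hmem] at hp hq ⊢
    have hp' := map_mem_system cb hG hp.1
    have hq' := map_mem_system cb hG hq.1
    refine ⟨(isMeetIn_of_com cb hG hp.1 hq.1 hpq).1, ?_, fun r hr hra => ?_⟩
    · rw [← system_J_apply cb hG hp.1]
      exact hpq.meet hp' hq' hp.2.1 hq.2.1
    · rw [← system_J_apply cb hG hp.1]
      exact (hp.2.2 r hr hra).map hp' (map_mem_system cb hG hr) (hq.2.2 r hr hra)
  have hone : (1 : E) ∈ cb.bicomm {a} := by
    rw [hmem, hG.map_one]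
    refine ⟨cb.isSub.one_mem, ?_, fun q hq _ =>
      CompressionSystem.com_unit (map_mem_system cb hG hq)⟩
    exact CompressionSystem.com_of_eq S.unit_mem
      (CompressionSystem.eq_of_le' S.unit_mem (hG.map_nonneg a) (hG.map_le a))
  refine { subset := fun p hp => hp.1, zero_mem := ?_, one_mem := hone, compl_mem := hcompl,
           meet_mem := ?_, join_mem := ?_, distrib := ?_ }
  · have h0 := hcompl 1 hone
    have : compl (1 : E) = 0 :=
      hG.injective (by rw [hG.map_compl, hG.map_one, hG.map_zero, sub_self])
    rwa [this] at h0
  · intro p hp q hq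
    exact ⟨_, hmeet p hp q hq, isMeetIn_of_com cb hG hp.1 hq.1 (hcom p hp q hq)⟩
  · intro p hp q hq
    exact ⟨_, hcompl _ (hmeet _ (hcompl p hp) _ (hcompl q hq)),
      isJoinIn_of_com cb hG hp.1 hq.1 (hcom p hp q hq)⟩
  · intro p hp q hq r hr j m m₁ m₂ hj hm h₁ h₂
    exact distrib_of_com cb hG hp.1 hq.1 hr.1 (hcom p hp q hq) (hcom p hp r hr) (hcom q hq r hr)
      hj hm h₁ h₂

end CompressionBase

end EffectAlgebra

/-! ### Equivalence of the notions of spectrality -/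

namespace EffectAlgebra

namespace CompressionSystem

variable {G : Type*} [AddCommGroup G] [PartialOrder G] [IsOrderedAddMonoid G] {u : G}
  {S : CompressionSystem G u} {p g : G}

theorem supp_add_supp_neg_le (hS : S.Spectral) (g : G) : S.supp g + S.supp (-g) ≤ u := by
  have h1 := supp_mem hS g
  rw [← le_sub_iff_add_le', supp_le_iff hS (S.compl_mem _ h1), map_supp_neg hS, sub_sub_cancel,
    map_neg, map_compl h1, neg_zero]

/-- The Rickart mapping in terms of the supports of the positive and negative parts. -/
theorem le_compl_supp_iff (hS : S.Spectral) (g : G) (hp : p ∈ S.P) :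
    p ≤ u - (S.supp g + S.supp (-g)) ↔ S.Com p g ∧ S.J p g = 0 := by
  have h1 := supp_mem hS g
  have h2 := supp_mem hS (-g)
  have hp' := S.compl_mem p hp
  constructor
  · intro h
    rw [le_sub_iff_add_le, ← add_assoc] at h
    have hp1 : p + S.supp g ≤ u := (le_add_of_nonneg_right (mem_nonneg h2)).trans h
    have hp2 : p + S.supp (-g) ≤ u := by
      rw [add_right_comm] at h
      exact (le_add_of_nonneg_right (mem_nonneg h1)).trans h
    have hg : S.J (S.supp g) g - S.J (S.supp (-g)) (-g) = g := by
      rw [map_supp_neg hS, sub_neg_eq_add]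
      exact com_supp_self hS g
    have h0 : S.J p g = 0 := by
      rw [← hg, map_sub, map_map_of_orth hp h1 hp1, map_map_of_orth hp h2 hp2, sub_zero]
    refine ⟨?_, h0⟩
    rw [com_iff, h0, zero_add]
    conv_lhs => rw [← hg]
    rw [map_sub, map_map_of_le' h1 hp' (le_sub_iff_add_le'.2 hp1),
      map_map_of_le' h2 hp' (le_sub_iff_add_le'.2 hp2), hg]
  · rintro ⟨hc, h0⟩
    have key : ∀ g, S.Com p g → S.J p g = 0 → S.supp g ≤ u - p := by
      intro g hc h0
      rw [supp_le_iff hS hp', sub_sub_cancel, (com_supp hS hp hc).map_comm hp (supp_mem hS g), h0,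
        map_zero]
    have k1 := key g hc h0
    have k2 := key (-g) hc.neg (by rw [map_neg, h0, neg_zero])
    -- Both supports are fixed by J_{u-p}, hence so is their sum, which is at most u and therefore
    -- below u - p.
    rw [le_sub_comm]
    refine le_of_map_eq hp' (supp_add_supp_neg_le hS g) ?_
    rw [map_add, eq_of_le' hp' (mem_nonneg h1) k1, eq_of_le' hp' (mem_nonneg h2) k2]

end CompressionSystem

variable {E : Type v} [EffectAlgebra E] {G : Type v} [AddCommGroup G] [PartialOrder G]
  [IsOrderedAddMonoid G] {ι : E → G} {u : G}

namespace CompressionBase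

open CompressionSystem

variable (cb : CompressionBase E) (hG : IsUniversalGroup ι u)

/-- The cover of g ≥ 0 is the complement of g^*: for positive g, being annihilated by J_p already
implies commuting with p. -/
theorem spectral_of_extend (h : (cb.extend hG).IsSpectral) : (cb.system hG).Spectral := by
  obtain ⟨hgc, star, hstar⟩ := h
  constructor
  · intro g
    obtain ⟨p, ⟨⟨hp, hpg⟩, hbi⟩, hneg, hpos⟩ := hgc g
    have hpP : p ∈ cb.P := hp
    refine ⟨ι p, map_mem_system cb hG hp, (mem_extend_C_iff cb hG p).1 hpg, ?_, ?_, ?_⟩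
    · rintro _ ⟨q, hq, rfl⟩ hqg
      exact (mem_extend_C_iff cb hG q).1 (hbi q ⟨hq, (mem_extend_C_iff cb hG q).2 hqg⟩)
    · rwa [← hG.map_compl, system_J]
    · rwa [system_J]
  · intro g hg
    obtain ⟨hr, hr'⟩ := hstar g
    refine ⟨u - ι (star g), (cb.system hG).compl_mem _ (map_mem_system cb hG hr), ?_⟩
    rintro _ ⟨q, hq, rfl⟩
    have hq' := cb.isSub.compl_mem q hq
    rw [sub_le_comm, ← hG.map_compl, hG.map_le_map_iff, hr' _ hq', mem_extend_C_iff, ← system_J]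
    refine and_iff_right_of_imp fun h => ?_
    exact com_of_eq_zero (map_mem_system cb hG hq') hg h

theorem extend_isSpectral_of (hS : (cb.system hG).Spectral) : (cb.extend hG).IsSpectral := by
  constructor
  · intro g
    obtain ⟨_, ⟨p, hp, rfl⟩, hpg, hbi, hneg, hpos⟩ := hS.comparable g
    refine ⟨p, ⟨⟨hp, (mem_extend_C_iff cb hG p).2 hpg⟩, ?_⟩, ?_, ?_⟩
    · rintro q ⟨hq, hqg⟩
      exact (mem_extend_C_iff cb hG q).2
        (hbi _ (map_mem_system cb hG hq) ((mem_extend_C_iff cb hG q).1 hqg))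
    · rwa [← system_J, hG.map_compl]
    · rwa [← system_J]
  · have key : ∀ g, ∃ r, (cb.extend hG).IsRickart g r := by
      intro g
      obtain ⟨r, hr, hre⟩ := (cb.system hG).compl_mem _ ((cb.system hG).add_mem _ (supp_mem hS g) _
        (supp_mem hS (-g)) (supp_add_supp_neg_le hS g))
      refine ⟨r, hr, fun p hp => ?_⟩
      rw [← hG.map_le_map_iff, hre, le_compl_supp_iff hS g (map_mem_system cb hG hp),
        mem_extend_C_iff, system_J]
    choose star hstar using key
    exact ⟨star, hstar⟩

theorem isProjCover_of_supp (hS : (cb.system hG).Spectral) (a : E) {c : E}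
    (hc : ι c = (cb.system hG).supp (ι a)) : cb.IsProjCover c a := by
  have hcP : c ∈ cb.P := by
    rw [← map_mem_system_iff cb hG, hc]; exact supp_mem hS _
  refine ⟨hcP, fun q hq => ?_⟩
  have hq' := map_mem_system cb hG hq
  rw [← hG.map_le_map_iff, ← hG.map_le_map_iff, hc,
    supp_le_iff_of_nonneg hS (hG.map_nonneg a) hq',
    le_iff_compl_eq_zero hq' (hG.map_nonneg a) (hG.map_le a)]

section Rat

variable [Module ℚ G] [PosSMulMono ℚ G]

/-- An affine rescaling puts b = (g + N u)/(2N) in the unit interval, and b - c = g/(2N) for c =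
u/2. Comparing c and b in E thus compares 0 and g. Covers only need positive rescaling. -/
theorem spectral_of_isSpectral (h : cb.IsSpectral) : (cb.system hG).Spectral := by
  obtain ⟨⟨-, hle⟩, hcov⟩ := h
  set S := cb.system hG with hS
  have hscale : ∀ g : G, ∃ N : ℚ, 0 < N ∧ g ≤ N • u := fun g => by
    obtain ⟨n, hn⟩ := hG.order_unit g
    refine ⟨n + 1, by positivity, ?_⟩
    rw [add_smul, one_smul, Nat.cast_smul_eq_nsmul]
    exact hn.trans (le_add_of_nonneg_right hG.zero_le)
  constructor
  · intro g
    obtain ⟨N₁, hN₁, h1⟩ := hscale g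
    obtain ⟨N₂, hN₂, h2⟩ := hscale (-g)
    set N := N₁ + N₂ with hN
    have hNpos : 0 < N := by positivity
    have h1' : g ≤ N • u := h1.trans (smul_le_smul_rat hG.zero_le (by linarith))
    have h2' : -g ≤ N • u := h2.trans (smul_le_smul_rat hG.zero_le (by linarith))
    have hinv : (0 : ℚ) ≤ 1 / (2 * N) := by positivity
    obtain ⟨b, hb⟩ := hG.exists_eq (g := (1 / (2 * N)) • (g + N • u))
      (smul_nonneg hinv (by rw [add_comm]; exact neg_le_iff_add_nonneg.1 h2'))
      (by
        have := smul_le_smul_of_nonneg_left (add_le_add_left h1' (N • u)) hinv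
        rwa [← add_smul, smul_smul, ← two_mul, one_div_mul_cancel (by positivity), one_smul]
          at this)
    obtain ⟨c, hc⟩ := hG.exists_eq (g := (1 / 2 : ℚ) • u) (smul_nonneg (by norm_num) hG.zero_le)
      (by simpa using smul_le_smul_rat hG.zero_le (show (1 / 2 : ℚ) ≤ 1 by norm_num))
    have hbc : ι b - ι c = (1 / (2 * N)) • g := by
      rw [hb, hc, smul_add, smul_smul, show 1 / (2 * N) * N = 1 / 2 by field_simp,
        add_sub_cancel_right]
    have hgb : g = (2 * N) • (ι b - ι c) := by
      rw [hbc, smul_smul, mul_one_div_cancel (by positivity), one_smul]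
    have hcc : ∀ q ∈ S.P, S.Com q (ι c) := fun q hq => by
      rw [hc]; exact (com_unit hq).rat_smul _
    -- Every projection commutes with the scalar c, so each member of the bicommutant of c commutes
    -- with all projections.
    have hcom : cb.Commute c b := by
      intro p hp q hq
      rw [mem_bicomm_iff cb hG] at hp hq
      rw [mackey_iff cb hG hp.1 hq.1]
      exact (hp.2.2 q hq.1 fun x hx => by
          rw [Set.mem_singleton_iff.1 hx]; exact hcc _ ⟨q, hq.1, rfl⟩).symm
        ⟨q, hq.1, rfl⟩ ⟨p, hp.1, rfl⟩
    obtain ⟨p, hp, hp1, hp2⟩ := hle c b hcom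
    rw [mem_bicomm_iff cb hG] at hp
    obtain ⟨hpP, hpa, hbi⟩ := hp
    have hp' := map_mem_system cb hG hpP
    have h2N : (0 : ℚ) < 2 * N := by positivity
    refine ⟨ι p, hp', ?_, ?_, ?_, ?_⟩
    · rw [hgb]
      exact ((hpa b (by simp)).sub (hpa c (by simp))).rat_smul _
    · rintro _ ⟨q, hq, rfl⟩ hqg
      refine hbi q hq ?_
      have hqb : S.Com (ι q) (ι b) := by
        have h := (hqg.rat_smul (1 / (2 * N))).add (hcc _ ⟨q, hq, rfl⟩)
        rwa [← hbc, sub_add_cancel] at h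
      simpa using ⟨hcc _ ⟨q, hq, rfl⟩, hqb⟩
    · rw [hgb, map_rat_smul]
      refine smul_nonpos_of_nonneg_of_nonpos h2N.le ?_
      rw [map_sub, system_J_compl_apply cb hG hpP, system_J_compl_apply cb hG hpP]
      exact sub_nonpos.2 (hG.map_le_map_iff.2 hp2)
    · rw [hgb, map_rat_smul]
      refine smul_nonneg h2N.le ?_
      rw [map_sub, system_J_apply cb hG hpP, system_J_apply cb hG hpP]
      exact sub_nonneg.2 (hG.map_le_map_iff.2 hp1)
  · intro g hg
    obtain ⟨N, hN, h1⟩ := hscale g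
    have hinv : (0 : ℚ) < 1 / N := by positivity
    obtain ⟨a, ha⟩ := hG.exists_eq (g := (1 / N) • g) (smul_nonneg hinv.le hg) (by
      have := smul_le_smul_of_nonneg_left h1 hinv.le
      rwa [smul_smul, one_div_mul_cancel hN.ne', one_smul] at this)
    obtain ⟨c, hcP, hc⟩ := hcov a
    refine ⟨ι c, map_mem_system cb hG hcP, ?_⟩
    rintro _ ⟨q, hq, rfl⟩
    rw [hG.map_le_map_iff, ← hc q hq, ← hG.map_le_map_iff,
      le_iff_compl_eq_zero (map_mem_system cb hG hq) (hG.map_nonneg a) (hG.map_le a), ha,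
      map_rat_smul, smul_eq_zero_iff_right hinv.ne']

theorem upper_mem_bicomm (hS : (cb.system hG).Spectral) (a : E) (t : ℚ) :
    ∃ r ∈ cb.bicomm {a}, ι r = (cb.system hG).upper (ι a) t := by
  obtain ⟨r, hr, hre⟩ := upper_mem hS (ι a) t
  refine ⟨r, ?_, hre⟩
  rw [mem_bicomm_iff cb hG, hre]
  refine ⟨hr, fun x hx => ?_, fun q hq hqa => ?_⟩
  · rw [Set.mem_singleton_iff.1 hx]
    exact com_upper_self hS _ t
  · exact com_upper hS (map_mem_system cb hG hq) (hqa a rfl) t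

/-- The Boolean subalgebra attached to a is its bicommutant: it contains the spectral projections of
a, so commuting with it implies commuting with a. For comparability, the projection p splitting b -
a must commute with a and b separately: members of the bicommutant of a commute with b, hence with b
- a, hence with p. -/
theorem isSpectral_of_spectral (harch : IsArchimedean E) (hS : (cb.system hG).Spectral) :
    cb.IsSpectral := by
  have harch' := fun x => hG.eq_zero_of_forall_nsmul_le harch (g := x)
  have key : ∀ a : E, ∀ p ∈ (cb.system hG).P, (∀ q ∈ cb.bicomm {a}, (cb.system hG).Com p (ι q)) →
      (cb.system hG).Com p (ι a) := by
    intro a p hp h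
    refine com_of_com_upper hS harch' (hG.map_nonneg a) (hG.map_le a) hp fun n k _ => ?_
    obtain ⟨r, hr, hre⟩ := upper_mem_bicomm cb hG hS a ((k : ℚ) / (2 ^ n : ℕ))
    rw [← hre]
    exact h r hr
  refine ⟨⟨fun a => ⟨cb.bicomm {a}, isBooleanSubalgebra_bicomm cb hG a, fun p hp => ?_⟩, ?_⟩, ?_⟩
  · rw [mem_C_iff cb hG hp]
    constructor
    · intro h q hq
      rw [mem_C_iff cb hG hp]
      exact ((mem_bicomm_iff cb hG _).1 hq).2.2 p hp fun x hx => by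
        rwa [Set.mem_singleton_iff.1 hx]
    · intro h
      exact key a _ (map_mem_system cb hG hp) fun q hq => (mem_C_iff cb hG hp).1 (h hq)
  · intro a b hab
    obtain ⟨_, ⟨p, hp, rfl⟩, hpg, hbi, hneg, hpos⟩ := hS.comparable (ι b - ι a)
    have hp' := map_mem_system cb hG hp
    have hcross : ∀ q ∈ cb.bicomm {a}, (cb.system hG).Com (ι q) (ι b) := fun q hq =>
      key b _ (map_mem_system cb hG hq.1) fun r hr => (mackey_iff cb hG hq.1 hr.1).1 (hab q hq r hr)
    have hcross' : ∀ r ∈ cb.bicomm {b}, (cb.system hG).Com (ι r) (ι a) := fun r hr =>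
      key a _ (map_mem_system cb hG hr.1) fun q hq =>
        ((mackey_iff cb hG hq.1 hr.1).1 (hab q hq r hr)).symm (map_mem_system cb hG hq.1)
          (map_mem_system cb hG hr.1)
    have hself : ∀ c, ∀ q ∈ cb.bicomm {c}, (cb.system hG).Com (ι q) (ι c) := fun c q hq =>
      ((mem_bicomm_iff cb hG _).1 hq).2.1 c rfl
    have hpa : (cb.system hG).Com (ι p) (ι a) := key a _ hp' fun q hq => by
      have hq' := map_mem_system cb hG hq.1
      exact (hbi _ hq' ((hcross q hq).sub (hself a q hq))).symm hq' hp'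
    have hpb : (cb.system hG).Com (ι p) (ι b) := by
      simpa using hpg.add hpa
    refine ⟨p, ?_, ?_, ?_⟩
    · rw [mem_bicomm_iff cb hG]
      refine ⟨hp, ?_, fun q hq hqab => ?_⟩
      · rintro x (rfl | rfl)
        · exact hpa
        · exact hpb
      · exact hbi _ (map_mem_system cb hG hq) ((hqab b (by simp)).sub (hqab a (by simp)))
    · rw [map_sub, system_J_apply cb hG hp, system_J_apply cb hG hp, sub_nonneg,
        hG.map_le_map_iff] at hpos
      exact hpos
    · rw [map_sub, system_J_compl_apply cb hG hp, system_J_compl_apply cb hG hp, sub_nonpos,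
        hG.map_le_map_iff] at hneg
      exact hneg
  · intro a
    obtain ⟨c, -, hc⟩ := supp_mem hS (ι a)
    exact ⟨c, isProjCover_of_supp cb hG hS a hc⟩

end Rat

end CompressionBase

end EffectAlgebra

namespace EffectAlgebra

/-! ### Binary strings -/

theorem strNum_append (w : List Bool) (b : Bool) : strNum (w ++ [b]) = 2 * strNum w + b.toNat := by
  simp [strNum]

theorem length_of_mem_binStrings {n : ℕ} {w : List Bool} (h : w ∈ binStrings n) : w.length = n := by
  induction n generalizing w with
  | zero => simpa [binStrings] using h
  | succ n ih =>
    simp only [binStrings, List.mem_flatMap, List.mem_cons, List.not_mem_nil, or_false] at h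
    obtain ⟨v, hv, rfl | rfl⟩ := h <;> simp [ih hv]

/-- The strings are listed in numerical order, which turns sums over strings into sums over an
initial segment of ℕ. -/
theorem map_strNum_binStrings (n : ℕ) : (binStrings n).map strNum = List.range (2 ^ n) := by
  have hr : ∀ m, List.range (2 * m) = (List.range m).flatMap fun k => [2 * k, 2 * k + 1] := by
    intro m
    induction m with
    | zero => rfl
    | succ m ih =>
      rw [mul_add, List.range_succ, List.range_succ, ih, List.range_succ, List.flatMap_append]
      simp
  induction n with
  | zero => rfl
  | succ n ih =>
    rw [pow_succ', hr, ← ih, binStrings, List.map_flatMap, List.flatMap_map]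
    simp [strNum_append]

theorem strNum_lt (w : List Bool) : strNum w < 2 ^ w.length := by
  induction w using List.reverseRecOn with
  | nil => simp [strNum]
  | append_singleton w b ih =>
    rw [strNum_append, List.length_append, List.length_singleton, pow_succ]
    cases b <;> simp <;> omega

theorem exists_strNum_eq {n k : ℕ} (h : k < 2 ^ n) :
    ∃ w : List Bool, w.length = n ∧ strNum w = k := by
  rw [← List.mem_range, ← map_strNum_binStrings, List.mem_map] at h
  obtain ⟨w, hw, rfl⟩ := h
  exact ⟨w, length_of_mem_binStrings hw, rfl⟩

theorem strVal_append_true (w : List Bool) :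
    strVal (w ++ [true]) = strVal w + 1 / (2 * 2 ^ w.length) := by
  simp only [strVal, strNum_append, List.length_append, List.length_singleton, pow_succ]
  push_cast [Bool.toNat_true]
  field_simp

theorem strVal_append_false (w : List Bool) : strVal (w ++ [false]) = strVal w := by
  simp only [strVal, strNum_append, List.length_append, List.length_singleton, pow_succ]
  push_cast [Bool.toNat_false]
  field_simp
  ring

theorem strValSucc_eq (w : List Bool) : strValSucc w = strVal w + 1 / 2 ^ w.length := by
  rw [strValSucc, strVal, add_div]

theorem strValSucc_append_true (w : List Bool) : strValSucc (w ++ [true]) = strValSucc w := by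
  rw [strValSucc_eq, strVal_append_true, strValSucc_eq, List.length_append, List.length_singleton,
    pow_succ]
  field_simp
  ring

theorem strValSucc_append_false (w : List Bool) :
    strValSucc (w ++ [false]) = strVal w + 1 / (2 * 2 ^ w.length) := by
  rw [strValSucc_eq, strVal_append_false, List.length_append, List.length_singleton, pow_succ,
    mul_comm (2 ^ w.length : ℚ)]

theorem strVal_nonneg (w : List Bool) : 0 ≤ strVal w := by rw [strVal]; positivity

theorem strValSucc_le_one (w : List Bool) : strValSucc w ≤ 1 := by
  rw [strValSucc, div_le_one (by positivity)]
  exact_mod_cast strNum_lt w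

theorem strVal_lt_strValSucc (w : List Bool) : strVal w < strValSucc w := by
  rw [strValSucc_eq]
  exact lt_add_of_pos_right _ (by positivity)

/-- Cancel factors 2 until the numerator is odd; its last binary digit is then 1. -/
theorem exists_strVal_append_true {n k : ℕ} (h0 : 0 < k) (hk : k < 2 ^ n) :
    ∃ w : List Bool, strVal (w ++ [true]) = (k : ℚ) / 2 ^ n := by
  induction n generalizing k with
  | zero => simp at hk; omega
  | succ n ih =>
    obtain ⟨j, rfl | rfl⟩ := k.even_or_odd'
    · obtain ⟨w, hw⟩ := ih (k := j) (by omega) (by rw [pow_succ] at hk; omega)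
      refine ⟨w, hw.trans ?_⟩
      push_cast
      rw [pow_succ']
      field_simp
    · obtain ⟨w, hw, rfl⟩ := exists_strNum_eq (n := n) (k := j) (by rw [pow_succ] at hk; omega)
      refine ⟨w, ?_⟩
      rw [strVal, strNum_append, List.length_append, hw]
      simp

theorem exists_strVal_eq {n k : ℕ} (hk : k < 2 ^ n) :
    ∃ w : List Bool, strVal w = (k : ℚ) / 2 ^ n := by
  obtain ⟨w, hw, rfl⟩ := exists_strNum_eq hk
  exact ⟨w, by rw [strVal, hw]⟩

theorem list_sum_map_range {M : Type*} [AddCommMonoid M] (f : ℕ → M) (n : ℕ) :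
    ((List.range n).map f).sum = ∑ k ∈ Finset.range n, f k := by
  induction n with
  | zero => simp
  | succ n ih => rw [List.range_succ, Finset.sum_range_succ, ← ih]; simp

theorem filter_le_range {n k : ℕ} (h : k < n) :
    (List.range n).filter (fun j => j ≤ k) = List.range (k + 1) := by
  obtain ⟨m, rfl⟩ := Nat.exists_eq_add_of_lt h
  rw [show k + m + 1 = k + 1 + m by ring, List.range_add, List.filter_append,
    List.filter_eq_self.2, List.filter_eq_nil_iff.2, List.append_nil]
  · simp only [List.mem_map, decide_eq_true_eq]
    rintro _ ⟨j, -, rfl⟩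
    omega
  · simp only [List.mem_range, decide_eq_true_eq]
    intro j hj
    omega

/-! ### Computation of the spectral resolution in the universal group -/

namespace CompressionSystem

variable {G : Type*} [AddCommGroup G] [PartialOrder G] [IsOrderedAddMonoid G] {u : G}
  {S : CompressionSystem G u}

theorem supp_map_supp (hS : S.Spectral) (g : G) : S.supp (S.J (S.supp g) g) = S.supp g := by
  apply supp_eq_of_map_eq hS
  intro q _
  rw [map_supp_of_nonneg hS (map_supp_nonneg hS g)]

end CompressionSystem

variable {E : Type v} [EffectAlgebra E] {G : Type v} [AddCommGroup G] [PartialOrder G]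
  [IsOrderedAddMonoid G] {ι : E → G} {u : G}

theorem inf_eq {A : Set E} {x : E} (h : IsGLB A x) : inf A = x := by
  have h' : ∃ x, IsGLB A x := ⟨x, h⟩
  rw [inf, dif_pos h']
  exact h'.choose_spec.unique h

theorem IsUniversalGroup.map_divBy (hG : IsUniversalGroup ι u) (hdiv : IsDivisible E) (a : E)
    {n : ℕ} (hn : 0 < n) : n • ι (divBy a n) = ι a := by
  have h : ∃ x, nmul n x = some a := (hdiv a n hn).exists
  rw [divBy, dif_pos h]
  exact (hG.nmul_eq_some_iff n).1 h.choose_spec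

theorem IsUniversalGroup.map_fracMul [Module ℚ G] (hG : IsUniversalGroup ι u)
    (hdiv : IsDivisible E) (a : E) {k n : ℕ} (hn : 0 < n) (hk : k ≤ n) :
    ι (fracMul k n a) = ((k : ℚ) / n) • ι a := by
  have h := hG.map_divBy hdiv a hn
  have hle : k • ι (divBy a n) ≤ ι a := by
    rw [← h]; exact nsmul_le_nsmul_left (hG.map_nonneg _) hk
  obtain ⟨c, hc⟩ := hG.exists_eq (nsmul_nonneg (hG.map_nonneg _) k) (hle.trans (hG.map_le a))
  have hn' : (n : ℚ) ≠ 0 := by positivity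
  rw [fracMul, (hG.nmul_eq_some_iff k).2 hc.symm, Option.getD_some, hc, ← h,
    ← Nat.cast_smul_eq_nsmul ℚ n, smul_smul, div_mul_cancel₀ _ hn', Nat.cast_smul_eq_nsmul]

namespace CompressionBase

open CompressionSystem

variable (cb : CompressionBase E) (hG : IsUniversalGroup ι u) {p q a b c : E}
  (hS : (cb.system hG).Spectral)
include hS

theorem map_cover (a : E) : ι (cb.cover a) = (cb.system hG).supp (ι a) := by
  obtain ⟨c, -, hc⟩ := supp_mem hS (ι a)
  have hca := isProjCover_of_supp cb hG hS a hc
  have h : ∃ p, cb.IsProjCover p a := ⟨c, hca⟩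
  have h' := h.choose_spec
  rw [cover, dif_pos h, ← hc]
  congr 1
  exact le_antisymm ((h'.2 _ hca.1).1 ((hca.2 _ hca.1).2 le_rfl))
    ((hca.2 _ h'.1).1 ((h'.2 _ h'.1).2 le_rfl))

/-- Any projection in `Ple` compares b - a with 0, so uniqueness of the positive part makes the
choice in the definition irrelevant. -/
theorem map_posPart (h : (cb.Ple a b).Nonempty) : ι (cb.posPart b a) =
    (cb.system hG).J ((cb.system hG).supp (ι b - ι a)) (ι b - ι a) := by
  obtain ⟨h1, h2, h3⟩ := h.choose_spec
  rw [mem_bicomm_iff cb hG] at h1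
  have hp' := map_mem_system cb hG h1.1
  rw [posPart, dif_pos h, hG.map_osub h2, ← map_eq_map_supp hS hp'
    ((h1.2.1 b (by simp)).sub (h1.2.1 a (by simp)))]
  · rw [map_sub, system_J_apply cb hG h1.1, system_J_apply cb hG h1.1]
  · rw [map_sub, system_J_compl_apply cb hG h1.1, system_J_compl_apply cb hG h1.1]
    exact sub_nonpos.2 (hG.map_le_map_iff.2 h3)
  · rw [map_sub, system_J_apply cb hG h1.1, system_J_apply cb hG h1.1]
    exact sub_nonneg.2 (hG.map_le_map_iff.2 h2)

omit hS

/-- The meet of an element and a commuting projection. -/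
theorem map_inf_pair (hq : q ∈ cb.P) (h : (cb.system hG).Com (ι q) (ι a)) :
    ι (inf {a, q}) = (cb.system hG).J (ι q) (ι a) := by
  have hq' := map_mem_system cb hG hq
  have hglb : IsGLB {a, q} (cb.J q a) := by
    constructor
    · rintro x (rfl | rfl)
      · rw [← hG.map_le_map_iff, ← system_J_apply cb hG hq]
        exact h.map_le hq' (hG.map_nonneg x)
      · exact cb.map_le_focus hq a
    · intro y hy
      rw [← hG.map_le_map_iff, ← system_J_apply cb hG hq]
      exact CompressionSystem.le_meet hq' (hG.map_nonneg y)
        (hG.map_le_map_iff.2 (hy (Or.inr rfl))) (hG.map_le_map_iff.2 (hy (Or.inl rfl)))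
  rw [inf_eq hglb, system_J_apply cb hG hq]

theorem map_inf_pair' (hq : q ∈ cb.P) (h : (cb.system hG).Com (ι q) (ι a)) :
    ι (inf {q, a}) = (cb.system hG).J (ι q) (ι a) := by
  rw [Set.pair_comm]; exact map_inf_pair cb hG hq h

include hG in
-- The same projections commute with c and with its complement. This guarantees that the positive
-- parts in the splitting recursion do not take their default value.
theorem commute_compl (c : E) : cb.Commute (compl c) c ∧ cb.Commute c (compl c) := by
  have key : ∀ p q, p ∈ cb.bicomm {compl c} → q ∈ cb.bicomm {c} →
      (cb.system hG).Com (ι p) (ι q) := by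
    intro p q hp hq
    rw [mem_bicomm_iff cb hG] at hp hq
    have h := hp.2.1 _ rfl
    rw [hG.map_compl] at h
    refine hq.2.2 p hp.1 fun x hx => ?_
    rw [Set.mem_singleton_iff.1 hx]
    simpa using (com_unit (map_mem_system cb hG hp.1)).sub h
  constructor
  · intro p hp q hq
    exact (mackey_iff cb hG hp.1 hq.1).2 (key p q hp hq)
  · intro p hp q hq
    exact (mackey_iff cb hG hp.1 hq.1).2 ((key q p hq hp).symm (map_mem_system cb hG hq.1)
      (map_mem_system cb hG hp.1))

variable [Module ℚ G] [PosSMulMono ℚ G] (hcb : cb.IsSpectral)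
include hS hcb

theorem map_posPart_compl (c : E) :
    ι (cb.posPart c (compl c)) =
      (cb.system hG).J ((cb.system hG).supp (2 • ι c - u)) (2 • ι c - u) ∧
    ι (cb.posPart (compl c) c) =
      (cb.system hG).J ((cb.system hG).supp (u - 2 • ι c)) (u - 2 • ι c) := by
  obtain ⟨h1, h2⟩ := commute_compl cb hG c
  rw [map_posPart cb hG hS (hcb.1.2 _ _ h1), map_posPart cb hG hS (hcb.1.2 _ _ h2), hG.map_compl,
    show ι c - (u - ι c) = 2 • ι c - u by abel, show u - ι c - ι c = u - 2 • ι c by abel]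
  exact ⟨rfl, rfl⟩

/-- One splitting step is one bisection of (s, t] at its midpoint m. The invariant is that the
second component is a - s u on the band, rescaled by the inverse length N of the interval. -/
theorem splitStep_spec (x : E × E) {s t N m : ℚ} (hN : 0 < N) (ht : t = s + 1 / N)
    (hm : m = s + 1 / (2 * N)) (h1 : ι x.1 = (cb.system hG).band (ι a) s t)
    (h2 : ι x.2 = N • (cb.system hG).J ((cb.system hG).band (ι a) s t) (ι a - s • u)) :
    (ι (cb.splitStep x false).1 = (cb.system hG).band (ι a) s m ∧
      ι (cb.splitStep x false).2 =
        (2 * N) • (cb.system hG).J ((cb.system hG).band (ι a) s m) (ι a - s • u)) ∧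
    ι (cb.splitStep x true).1 = (cb.system hG).band (ι a) m t ∧
      ι (cb.splitStep x true).2 =
        (2 * N) • (cb.system hG).J ((cb.system hG).band (ι a) m t) (ι a - m • u) := by
  obtain ⟨e1, e2, e3⟩ := map_supp_split hS (ι a) hN ht hm h2
  obtain ⟨f1, f2⟩ := map_posPart_compl cb hG hS hcb x.2
  set S := cb.system hG with hSdef
  have hmt : m ≤ t := by
    rw [hm, ht]
    have : 1 / (2 * N) ≤ 1 / N := one_div_le_one_div_of_le hN (by linarith)
    linarith
  have hsm : s ≤ m := by rw [hm]; exact le_add_of_nonneg_right (by positivity)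
  set v := S.band (ι a) s t with hv
  have hvP : v ∈ S.P := band_mem hS _ (hsm.trans hmt)
  have hpP : S.band (ι a) m t ∈ S.P := band_mem hS _ hmt
  have hv₀P : S.band (ι a) s m ∈ S.P := band_mem hS _ hsm
  have hvp : v - S.band (ι a) m t = S.band (ι a) s m := by simp only [hv, band]; abel
  have hvp' : v - S.band (ι a) s m = S.band (ι a) m t := by rw [← hvp, sub_sub_cancel]
  have hpv : S.band (ι a) m t ≤ v := sub_nonneg.1 (hvp ▸ mem_nonneg hv₀P)
  have hv₀v : S.band (ι a) s m ≤ v := sub_nonneg.1 (hvp' ▸ mem_nonneg hpP)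
  have hxP : x.1 ∈ cb.P := by rw [← map_mem_system_iff cb hG, h1]; exact hvP
  have hvcom : ∀ p ∈ S.P, p ≤ v → S.Com v (u - p) := fun p hp hpv =>
    (com_unit hvP).sub ((com_of_le hp hvP hpv).symm hp hvP)
  have hJv : ∀ p ∈ S.P, p ≤ v → S.J v (u - p) = v - p := fun p hp hpv => by
    rw [map_sub, S.map_unit v hvP, eq_of_le' hvP (mem_nonneg hp) hpv]
  have hcov : ι (compl (cb.cover (cb.posPart x.2 (compl x.2)))) = u - S.band (ι a) m t := by
    rw [hG.map_compl, map_cover cb hG hS, f1, supp_map_supp hS, e2]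
  have hlow : ι (cb.lowerProj x) = S.band (ι a) s m := by
    rw [lowerProj, map_inf_pair cb hG hxP (by rw [hcov, h1]; exact hvcom _ hpP hpv), hcov, h1,
      ← hSdef, hJv _ hpP hpv, hvp]
  have hc : S.Com v (ι x.2) := by
    rw [h2]
    exact (com_of_eq hvP (S.idem v hvP _)).rat_smul _
  have hneg : ι (inf {cb.posPart (compl x.2) x.2, x.1}) =
      -((2 * N) • S.J (S.band (ι a) s m) (ι a - m • u)) := by
    rw [map_inf_pair cb hG hxP, h1, f2, ← hSdef, e3]
    rw [h1, f2]
    refine com_map_supp hS hvP ((com_unit hvP).sub ?_)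
    rw [two_nsmul]
    exact hc.add hc
  -- On the lower half, 1 - 2N(m - a) = 2N(a - s) because m - s = 1/(2N).
  have hshift : S.band (ι a) s m - -((2 * N) • S.J (S.band (ι a) s m) (ι a - m • u)) =
      (2 * N) • S.J (S.band (ι a) s m) (ι a - s • u) := by
    have h : ι a - s • u = (ι a - m • u) + (1 / (2 * N)) • u := by rw [hm]; module
    rw [h, map_add (S.J (S.band (ι a) s m)), map_rat_smul _ (1 / (2 * N)) u, S.map_unit _ hv₀P,
      smul_add, smul_smul,
      mul_one_div_cancel (by positivity), one_smul, sub_neg_eq_add, add_comm]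
  refine ⟨⟨hlow, ?_⟩, ?_, ?_⟩
  · change ι (osub (cb.lowerProj x) (inf {cb.posPart (compl x.2) x.2, x.1})) = _
    rw [hG.map_osub, hlow, hneg, hshift]
    rw [← hG.map_le_map_iff, hlow, hneg, ← sub_nonneg, hshift]
    exact smul_nonneg (by positivity) (map_nonneg_of_le_upper hS _ hv₀P (band_le_upper hS _))
  · change ι (inf {x.1, compl (cb.lowerProj x)}) = _
    rw [map_inf_pair' cb hG hxP, hG.map_compl, hlow, h1, ← hSdef, hJv _ hv₀P hv₀v, hvp']
    rw [hG.map_compl, hlow, h1]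
    exact hvcom _ hv₀P hv₀v
  · change ι (inf {cb.posPart x.2 (compl x.2), x.1}) = _
    have hfix : S.J v ((2 * N) • S.J (S.band (ι a) m t) (ι a - m • u)) =
        (2 * N) • S.J (S.band (ι a) m t) (ι a - m • u) := by
      rw [map_rat_smul, map_map_of_le' hpP hvP hpv]
    rw [map_inf_pair cb hG hxP, f1, h1, e1, ← hSdef, hfix]
    rw [f1, h1, e1]
    exact com_of_eq hvP hfix

/-- The binary splitting yields the spectral projections of the dyadic intervals. -/
theorem map_splitPair (a : E) (w : List Bool) :
    ι (cb.splitPair a w).1 = (cb.system hG).band (ι a) (strVal w) (strValSucc w) ∧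
    ι (cb.splitPair a w).2 = (2 ^ w.length : ℚ) •
      (cb.system hG).J ((cb.system hG).band (ι a) (strVal w) (strValSucc w))
        (ι a - strVal w • u) := by
  induction w using List.reverseRecOn with
  | nil =>
    have h0 : strVal [] = 0 := by simp [strVal, strNum]
    have h1 : strValSucc [] = 1 := by simp [strValSucc, strNum]
    have hb : (cb.system hG).band (ι a) 0 1 = (cb.system hG).supp (ι a) := by
      rw [band, upper_one hS (hG.map_le a), upper_zero hS, sub_zero]
    rw [h0, h1, hb, splitPair, List.foldl_nil]
    refine ⟨map_cover cb hG hS a, ?_⟩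
    simp [map_supp_of_nonneg hS (hG.map_nonneg a)]
  | append_singleton w b ih =>
    have hstep := splitStep_spec cb hG hS hcb (a := a) (cb.splitPair a w)
      (N := 2 ^ w.length) (by positivity) (strValSucc_eq w) rfl ih.1 ih.2
    have hsp : cb.splitPair a (w ++ [b]) = cb.splitStep (cb.splitPair a w) b := by
      simp [splitPair]
    rw [hsp, List.length_append, List.length_singleton, pow_succ, mul_comm (2 ^ w.length : ℚ)]
    cases b
    · rw [strVal_append_false, strValSucc_append_false]
      exact hstep.1
    · rw [strVal_append_true, strValSucc_append_true]
      exact hstep.2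

omit hcb in
theorem exists_map_eq_compl_upper (a : E) (t : ℚ) :
    ∃ r ∈ cb.P, ι r = u - (cb.system hG).upper (ι a) t :=
  (cb.system hG).compl_mem _ (upper_mem hS (ι a) t)

theorem map_binProj (a : E) (w : List Bool) :
    ι (cb.binProj a w) = u - (cb.system hG).upper (ι a) (strVal (w ++ [true])) := by
  obtain ⟨r, -, hr⟩ := exists_map_eq_compl_upper cb hG hS a (strVal (w ++ [true]))
  set n := w.length + 1 with hn
  set K := strNum (w ++ [false]) with hK
  set f : ℕ → G := fun k =>
    (cb.system hG).band (ι a) ((k : ℚ) / 2 ^ n) (((k + 1 : ℕ) : ℚ) / 2 ^ n) with hf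
  have hKlt : K < 2 ^ n := by
    have := strNum_lt (w ++ [false])
    rwa [List.length_append, List.length_singleton] at this
  -- The last band summed is that of w0, with index K; its right endpoint (K + 1)/2^n is the value
  -- of w1.
  have hval : strVal (w ++ [true]) = ((K + 1 : ℕ) : ℚ) / 2 ^ n := by
    rw [strVal, hK, strNum_append, strNum_append, List.length_append, List.length_singleton, hn]
    simp
  have hmap : (((binStrings n).filter fun s => strNum s ≤ K).map
      fun s => ι (cb.splitPair a s).1) = (List.range (K + 1)).map f := by
    rw [← filter_le_range hKlt, ← map_strNum_binStrings, List.filter_map, List.map_map]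
    refine List.map_congr_left fun s hs => ?_
    have hlen := length_of_mem_binStrings (List.mem_of_mem_filter hs)
    rw [(map_splitPair cb hG hS hcb a s).1, strVal, strValSucc, hlen]
    simp [hf]
  have hsum : osum (compl (cb.cover a) ::
      ((binStrings n).filter fun s => strNum s ≤ K).map fun s => (cb.splitPair a s).1) =
      some r := by
    rw [hG.osum_eq_some_iff, List.map_cons, List.sum_cons, List.map_map]
    change _ + (((binStrings n).filter fun s => strNum s ≤ K).map
      fun s => ι (cb.splitPair a s).1).sum = _
    rw [hmap, list_sum_map_range, hr, hG.map_compl, map_cover cb hG hS, hval]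
    simp only [hf, band]
    rw [Finset.sum_range_sub' (fun k : ℕ => (cb.system hG).upper (ι a) ((k : ℚ) / 2 ^ n)),
      Nat.cast_zero, zero_div, upper_zero hS, sub_add_sub_cancel]
  rw [binProj, hsum, Option.getD_some, hr]

/-- The projection in `map_binProj` depends on the string only through its value, so the chosen
string does not matter. All dyadic values strictly between 0 and 1 occur, leaving only 1 for the
last branch. -/
theorem map_binRes (a : E) {k n : ℕ} (hk : k ≤ 2 ^ n) :
    ι (cb.binRes a ((k : ℚ) / 2 ^ n)) = u - (cb.system hG).upper (ι a) ((k : ℚ) / 2 ^ n) := by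
  rw [binRes]
  split_ifs with h0 h1
  · rw [h0, upper_zero hS, hG.map_compl, map_cover cb hG hS]
  · rw [map_binProj cb hG hS hcb, Classical.choose_spec h1]
  · have hk0 : 0 < k := Nat.pos_of_ne_zero fun h => h0 (by simp [h])
    have : k = 2 ^ n := by
      by_contra hne
      exact h1 (exists_strVal_append_true hk0 (lt_of_le_of_ne hk hne))
    rw [this, Nat.cast_pow, Nat.cast_ofNat, div_self (by positivity), upper_one hS (hG.map_le a),
      sub_zero, hG.map_one]

end CompressionBase

end EffectAlgebra

namespace EffectAlgebra

/-! ### The order unit norm -/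

section Norm

variable {G : Type*} [AddCommGroup G] [PartialOrder G] [IsOrderedAddMonoid G] {u : G}

theorem ouNorm_nonneg (u g : G) : 0 ≤ ouNorm u g :=
  Real.sInf_nonneg (by rintro _ ⟨n, k, -, -, -, rfl⟩; positivity)

theorem ouNorm_le {g : G} {n k : ℕ} (hk : 0 < k) (h1 : -(n • u) ≤ k • g) (h2 : k • g ≤ n • u) :
    ouNorm u g ≤ (n : ℝ) / k :=
  csInf_le ⟨0, by rintro _ ⟨n, k, -, -, -, rfl⟩; positivity⟩ ⟨n, k, hk, h1, h2, rfl⟩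

theorem bounds_of_ouNorm_eq_zero [Module ℚ G] [PosSMulMono ℚ G] (hu : 0 ≤ u)
    (hou : ∀ g : G, ∃ n : ℕ, g ≤ n • u) {g : G} (h : ouNorm u g = 0) (ε : ℚ) (hε : 0 < ε) :
    -(ε • u) ≤ g ∧ g ≤ ε • u := by
  obtain ⟨n₁, h1⟩ := hou g
  obtain ⟨n₂, h2⟩ := hou (-g)
  -- The real `sInf` of the empty set is 0, so nonemptiness must come from the order unit before the
  -- value 0 carries information.
  have hne : {r : ℝ | ∃ n k : ℕ, 0 < k ∧ -(n • u) ≤ k • g ∧ k • g ≤ n • u ∧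
      r = (n : ℝ) / k}.Nonempty := by
    refine ⟨_, n₁ + n₂, 1, one_pos, ?_, ?_, rfl⟩
    · rw [one_smul, neg_le, add_smul]
      exact h2.trans (le_add_of_nonneg_left (nsmul_nonneg hu _))
    · rw [one_smul, add_smul]
      exact h1.trans (le_add_of_nonneg_right (nsmul_nonneg hu _))
  obtain ⟨_, ⟨n, k, hk, ha, hb, rfl⟩, hlt⟩ := exists_lt_of_csInf_lt hne
    (show ouNorm u g < (ε : ℝ) by rw [h]; exact_mod_cast hε)
  have hk' : (0 : ℚ) < k := by exact_mod_cast hk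
  have hlt' : (n : ℚ) / k < ε := by
    rw [← Rat.cast_lt (K := ℝ)]
    push_cast
    exact hlt
  have hscale : ∀ x : G, k • x ≤ n • u → x ≤ ε • u := by
    intro x hx
    have := smul_le_smul_of_nonneg_left hx (one_div_pos.2 hk').le
    rw [← Nat.cast_smul_eq_nsmul ℚ k, ← Nat.cast_smul_eq_nsmul ℚ n, smul_smul, smul_smul,
      one_div_mul_cancel hk'.ne', one_smul, one_div_mul_eq_div] at this
    exact this.trans (CompressionSystem.smul_le_smul_rat hu hlt'.le)
  refine ⟨?_, hscale g hb⟩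
  rw [neg_le]
  refine hscale _ ?_
  rw [smul_neg, neg_le]
  exact ha

end Norm

theorem exists_dyadic_between {s t : ℚ} (hs : 0 ≤ s) (h : s < t) (hs1 : s < 1) :
    ∃ k n : ℕ, k ≤ 2 ^ n ∧ s < (k : ℚ) / 2 ^ n ∧ (k : ℚ) / 2 ^ n < t := by
  -- Capping t at 1 ensures that the numerator ⌊s 2^n⌋ + 1 is at most 2^n.
  have hδ : 0 < min t 1 - s := sub_pos.2 (lt_min h hs1)
  obtain ⟨n, hn⟩ := exists_pow_lt_of_lt_one hδ (by norm_num : (1 / 2 : ℚ) < 1)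
  have h2 : (0 : ℚ) < 2 ^ n := by positivity
  rw [one_div_pow, div_lt_iff₀ h2] at hn
  have h3 := Nat.floor_le (mul_nonneg hs h2.le)
  have h4 := Nat.lt_floor_add_one (s * 2 ^ n)
  have h5 : ((⌊s * 2 ^ n⌋₊ + 1 : ℕ) : ℚ) < min t 1 * 2 ^ n := by
    push_cast; linarith
  refine ⟨⌊s * 2 ^ n⌋₊ + 1, n, ?_, ?_, ?_⟩
  · have : ((⌊s * 2 ^ n⌋₊ + 1 : ℕ) : ℚ) ≤ (2 ^ n : ℕ) := by
      push_cast at h5 ⊢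
      exact (h5.trans_le ((mul_le_mul_of_nonneg_right (min_le_right t 1) h2.le).trans_eq
        (one_mul _))).le
    exact_mod_cast this
  · rw [lt_div_iff₀ h2]; push_cast; exact h4
  · rw [div_lt_iff₀ h2]
    exact h5.trans_le (mul_le_mul_of_nonneg_right (min_le_left t 1) h2.le)

variable {E : Type v} [EffectAlgebra E] {G : Type v} [AddCommGroup G] [PartialOrder G]
  [IsOrderedAddMonoid G] {ι : E → G} {u : G}

/-! ### Identification of the rational spectral resolutions -/

namespace CompressionBase

open CompressionSystem

variable (cb : CompressionBase E) (hG : IsUniversalGroup ι u)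
  (hS : (cb.system hG).Spectral) [Module ℚ G] [PosSMulMono ℚ G] (hcb : cb.IsSpectral)
  (harch : IsArchimedean E)
include hS harch

include hcb in
/-- The rational spectral resolution consists of the spectral projections in the universal
group. -/
theorem map_ratRes (a : E) {t : ℚ} (h0 : 0 ≤ t) (h1 : t ≤ 1) :
    ι (cb.ratRes a t) = u - (cb.system hG).upper (ι a) t := by
  obtain ⟨r, hrP, hr⟩ := exists_map_eq_compl_upper cb hG hS a t
  rw [ratRes, inf_eq (x := r), hr]
  constructor
  · rintro _ ⟨k, n, hk, hkt, rfl⟩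
    rw [← hG.map_le_map_iff, hr, map_binRes cb hG hS hcb a hk]
    exact sub_le_sub_left (upper_anti hS _ hkt.le) u
  · intro y hy
    -- The infimum is taken in E, so y need not be a projection; its cover c obeys the same bounds
    -- by projections and may replace it.
    obtain ⟨c, hcP, hc⟩ := hcb.2 y
    refine ((hc c hcP).2 le_rfl).trans ?_
    rw [← hG.map_le_map_iff, hr]
    -- At t = 1 there is no dyadic index beyond t, and the infimum of the empty family is 1.
    rcases h1.eq_or_lt with rfl | h1
    · rw [upper_one hS (hG.map_le a), sub_zero]
      exact hG.map_le c
    refine le_compl_upper_of_forall hS (fun x => hG.eq_zero_of_forall_nsmul_le harch)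
      (map_mem_system cb hG hcP) fun ε hε => ?_
    obtain ⟨k, n, hk, hlt, hlt'⟩ := exists_dyadic_between h0 (lt_add_of_pos_right t hε) h1
    refine ⟨_, hlt, hlt', ?_⟩
    obtain ⟨q, hqP, hq⟩ := exists_map_eq_compl_upper cb hG hS a ((k : ℚ) / 2 ^ n)
    rw [← hq, hG.map_le_map_iff, ← hc q hqP, ← hG.map_le_map_iff, hq,
      ← map_binRes cb hG hS hcb a hk, hG.map_le_map_iff]
    exact hy ⟨k, n, hk, hlt, rfl⟩

omit harch in
-- The element n a - m u is n times a - (m/n) u, and supports ignore positive scalars. The Rickart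
-- projection of a positive part is the complement of its support.
theorem map_specProj (a : E) (m : ℤ) {n : ℕ} (hn : 0 < n) :
    ι ((cb.extend hG).specProj (ι a) m n) = u - (cb.system hG).upper (ι a) ((m : ℚ) / n) := by
  have hn' : (0 : ℚ) < n := by exact_mod_cast hn
  set S := cb.system hG with hSdef
  set g := n • ι a - m • u with hg
  have hgs : g = (n : ℚ) • (ι a - ((m : ℚ) / n) • u) := by
    rw [smul_sub, smul_smul, mul_div_cancel₀ _ hn'.ne', Nat.cast_smul_eq_nsmul,
      Int.cast_smul_eq_zsmul]
  have hpos : (cb.extend hG).posPart g = S.J (S.supp g) g := by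
    have hex : ∃ x y, (cb.extend hG).IsOrthDecomp g x y := by
      obtain ⟨p, hp, hpe⟩ := supp_mem hS g
      refine ⟨S.J (S.supp g) g, -S.J (u - S.supp g) g, ?_, map_supp_nonneg hS g,
        neg_nonneg.2 (map_compl_supp_nonpos hS g), p, hp, ?_, ?_⟩
      · rw [sub_neg_eq_add]; exact (com_iff.1 (com_supp_self hS g)).symm
      · rw [← system_J, hpe]
      · rw [← system_J, hG.map_compl, hpe, neg_neg]
    rw [GroupCompressionBase.posPart, dif_pos hex]
    obtain ⟨y, hgy, hx, hy, p, hp, hpx, hpy⟩ := Classical.choose_spec hex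
    rw [← system_J] at hpx hpy
    rw [hG.map_compl] at hpy
    rw [← hpx]
    refine map_eq_map_supp hS (map_mem_system cb hG hp) ?_ ?_ ?_
    · rw [com_iff, hpx, hpy, ← sub_eq_add_neg]; exact hgy.symm
    · rw [hpy]; exact neg_nonpos.2 hy
    · rw [hpx]; exact hx
  obtain ⟨r, hrP, hr⟩ := S.compl_mem _ (supp_mem hS g)
  have hrick : (cb.extend hG).IsRickart (S.J (S.supp g) g) r := by
    refine ⟨hrP, fun p hp => ?_⟩
    have hp' := map_mem_system cb hG hp
    rw [mem_extend_C_iff, ← system_J, ← hG.map_le_map_iff, hr, le_sub_comm,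
      supp_le_iff hS (S.compl_mem _ hp'), sub_sub_cancel]
    refine (and_iff_right_of_imp fun h => ?_).symm
    exact com_of_eq_zero hp' (map_supp_nonneg hS g) h
  have hstar : (cb.extend hG).star (S.J (S.supp g) g) = r := by
    have hex : ∃ r, (cb.extend hG).IsRickart (S.J (S.supp g) g) r := ⟨r, hrick⟩
    rw [GroupCompressionBase.star, dif_pos hex]
    have h := Classical.choose_spec hex
    exact le_antisymm ((hrick.2 _ h.1).2 ((h.2 _ h.1).1 le_rfl))
      ((h.2 _ hrick.1).2 ((hrick.2 _ hrick.1).1 le_rfl))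
  rw [GroupCompressionBase.specProj, hpos, hstar, hr, hgs, supp_smul hS hn', upper]

include hcb in
theorem map_stepProj (a : E) (w : List Bool) :
    ι (cb.stepProj a w) = (cb.system hG).band (ι a) (strVal w) (strValSucc w) := by
  have hlt := (strVal_lt_strValSucc w).le
  have h1 := map_ratRes cb hG hS hcb harch a (strVal_nonneg w) (hlt.trans (strValSucc_le_one w))
  have h2 := map_ratRes cb hG hS hcb harch a ((strVal_nonneg w).trans hlt) (strValSucc_le_one w)
  set S := cb.system hG with hSdef
  have hP : ∀ t, S.upper (ι a) t ∈ S.P := fun t => upper_mem hS _ t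
  have hq : compl (cb.ratRes a (strVal w)) ∈ cb.P := by
    rw [← map_mem_system_iff cb hG, hG.map_compl, h1, sub_sub_cancel]
    exact hP _
  have hle := upper_anti hS (ι a) hlt
  have hcom := (com_of_le (hP _) (hP _) hle).symm (hP _) (hP _)
  have hc : S.Com (S.upper (ι a) (strVal w)) (u - S.upper (ι a) (strValSucc w)) :=
    (com_unit (hP _)).sub hcom
  rw [stepProj, map_inf_pair cb hG hq, hG.map_compl, h1, h2, sub_sub_cancel, map_sub,
    S.map_unit _ (hP _), eq_of_le' (hP _) (mem_nonneg (hP _)) hle, band]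
  rwa [hG.map_compl, h1, h2, sub_sub_cancel]

omit hS harch in
theorem sum_binStrings (hdiv : IsDivisible E) (a : E) (n : ℕ)
    (hstep : ∀ w, ι (cb.stepProj a w) =
      (cb.system hG).band (ι a) (strVal w) (strValSucc w)) :
    ((binStrings n).map fun w => ι (fracMul (strNum w) (2 ^ n) (cb.stepProj a w))).sum =
      ∑ k ∈ Finset.range (2 ^ n), ((k : ℚ) / (2 ^ n : ℕ)) •
        (cb.system hG).band (ι a) ((k : ℚ) / (2 ^ n : ℕ)) (((k + 1 : ℕ) : ℚ) / (2 ^ n : ℕ)) := by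
  rw [← list_sum_map_range, ← map_strNum_binStrings, List.map_map]
  refine congrArg List.sum (List.map_congr_left fun w hw => ?_)
  have hlen := length_of_mem_binStrings hw
  have hlt := strNum_lt w
  rw [hlen] at hlt
  rw [hG.map_fracMul hdiv _ (by positivity) hlt.le, hstep, strVal, strValSucc, hlen]
  simp

end CompressionBase

end EffectAlgebra

/-! ### The main theorem -/

open EffectAlgebra EffectAlgebra.CompressionSystem EffectAlgebra.CompressionBase in
theorem mainTheorem7 {E : Type v} [EffectAlgebra E] (harch : EffectAlgebra.IsArchimedean E)
    (hdiv : EffectAlgebra.IsDivisible E) (cb : EffectAlgebra.CompressionBase E) :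
    (∃ (G : Type v) (_ : AddCommGroup G) (_ : PartialOrder G) (_ : IsOrderedAddMonoid G)
      (u : G) (ι : E → G), EffectAlgebra.IsUniversalGroup ι u) ∧
    ∀ (G : Type v) [AddCommGroup G] [PartialOrder G] [IsOrderedAddMonoid G] (u : G) (ι : E → G)
      (hG : EffectAlgebra.IsUniversalGroup ι u),
      (cb.IsSpectral ↔ (cb.extend hG).IsSpectral) ∧
      (cb.IsSpectral →
        (∀ g : G, EffectAlgebra.ouNorm u g = 0 → g = 0) ∧
        ∀ a : E,
          (∀ (m : ℤ) (n : ℕ), 0 < n → 0 ≤ m → m ≤ n →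
            cb.ratRes a ((m : ℚ) / n) = (cb.extend hG).specProj (ι a) m n) ∧
          Filter.Tendsto
            (fun n : ℕ => EffectAlgebra.ouNorm u (ι a - ((EffectAlgebra.binStrings n).map fun w =>
              ι (EffectAlgebra.fracMul (EffectAlgebra.strNum w) (2 ^ n) (cb.stepProj a w))).sum))
            Filter.atTop (nhds 0) ∧
          (∀ b : E, a = b ↔ ∀ w : List Bool,
            cb.ratRes a (EffectAlgebra.strVal w) = cb.ratRes b (EffectAlgebra.strVal w)) ∧
          (∀ q ∈ cb.P, a ∈ cb.C q ↔ ∀ w : List Bool,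
            cb.ratRes a (EffectAlgebra.strVal w) ∈ cb.C q)) := by
  have := hdiv.twoDivisible
  refine ⟨exists_isUniversalGroup, fun G _ _ _ u ι hG => ?_⟩
  let _ : Module ℚ G := hG.ratModule hdiv
  have : PosSMulMono ℚ G := hG.posSMulMono hdiv
  refine ⟨⟨fun h => extend_isSpectral_of cb hG (spectral_of_isSpectral cb hG h),
    fun h => isSpectral_of_spectral cb hG harch (spectral_of_extend cb hG h)⟩, fun hcb => ?_⟩
  have hS := spectral_of_isSpectral cb hG hcb
  have harch' : ∀ x : G, 0 ≤ x → (∀ k : ℕ, k • x ≤ u) → x = 0 := fun x =>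
    hG.eq_zero_of_forall_nsmul_le harch
  have hw1 : ∀ w, strVal w ≤ 1 := fun w =>
    (strVal_lt_strValSucc w).le.trans (strValSucc_le_one w)
  have hres : ∀ (a : E) w, ι (cb.ratRes a (strVal w)) = u - (cb.system hG).upper (ι a) (strVal w) :=
    fun a w => map_ratRes cb hG hS hcb harch a (strVal_nonneg w) (hw1 w)
  refine ⟨fun g hg => eq_zero_of_small hS harch'
    (bounds_of_ouNorm_eq_zero hG.zero_le hG.order_unit hg), fun a => ⟨?_, ?_, ?_, ?_⟩⟩
  · intro m n hn hm hmn
    have hn' : (0 : ℚ) < n := by exact_mod_cast hn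
    apply hG.injective
    rw [map_specProj cb hG hS a m hn, map_ratRes cb hG hS hcb harch]
    · exact div_nonneg (by exact_mod_cast hm) hn'.le
    · rw [div_le_one hn']; exact_mod_cast hmn
  · refine squeeze_zero (fun n => ouNorm_nonneg u _) (fun n => ?_)
      (tendsto_pow_atTop_nhds_zero_of_lt_one (r := (1 / 2 : ℝ)) (by norm_num) (by norm_num))
    obtain ⟨h0, h1⟩ := riemann_sum_bounds hS (hG.map_nonneg a) (hG.map_le a) (m := 2 ^ n)
      (by positivity)
    rw [sum_binStrings cb hG hdiv a n (map_stepProj cb hG hS hcb harch a)]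
    refine (ouNorm_le (n := 1) (k := 2 ^ n) (by positivity) ?_ ?_).trans_eq (by simp)
    · exact (neg_nonpos.2 (nsmul_nonneg hG.zero_le 1)).trans (nsmul_nonneg h0 _)
    · have h2 : (0 : ℚ) < (2 ^ n : ℕ) := by positivity
      have := smul_le_smul_of_nonneg_left h1 h2.le
      rw [one_nsmul]
      rwa [smul_smul, mul_one_div_cancel h2.ne', Nat.cast_smul_eq_nsmul, one_smul] at this
  · intro b
    refine ⟨fun h w => by rw [h], fun h => hG.injective ?_⟩
    refine eq_of_upper_eq hS harch' (hG.map_nonneg a) (hG.map_le a) (hG.map_nonneg b)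
      (hG.map_le b) fun n k hk => ?_
    -- No string has value 1, but at the endpoint 1 the upper projections of both elements vanish.
    rcases hk.eq_or_lt with rfl | hk
    · rw [div_self (by positivity), upper_one hS (hG.map_le a), upper_one hS (hG.map_le b)]
    · obtain ⟨w, hw⟩ := exists_strVal_eq hk
      have e := congrArg ι (h w)
      rw [hres, hres, hw, sub_right_inj] at e
      exact_mod_cast e
  · intro q hq
    have hq' := map_mem_system cb hG hq
    constructor
    · intro h w
      rw [mem_C_iff cb hG hq] at h ⊢
      rw [hres]
      exact (com_unit hq').sub (com_upper hS hq' h _)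
    · intro h
      rw [mem_C_iff cb hG hq]
      refine com_of_com_upper hS harch' (hG.map_nonneg a) (hG.map_le a) hq' fun n k hk => ?_
      rcases hk.eq_or_lt with rfl | hk
      · rw [div_self (by positivity), upper_one hS (hG.map_le a)]
        exact com_of_eq hq' (map_zero _)
      · obtain ⟨w, hw⟩ := exists_strVal_eq hk
        have hc := (mem_C_iff cb hG hq).1 (h w)
        rw [hres, hw] at hc
        have := (com_unit hq').sub hc
        rw [sub_sub_cancel] at this
        exact_mod_cast this
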